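/- Schur–Zilber lemma, one-sided form. "Definable" means definable with parameters, in real or imaginary sorts (that is, interpretable). A first-order theory $\mathcal T$ is *finite-dimensional* if there is a function $\dim$ from the interpretable sets in models of $\mathcal T$ to $\mathbb N\cup\{-\infty\}$ such that: $\dim\varphi(x,a)=\dim\varphi(x,a')$ whenever $a$ and $a'$ have the same type; $\dim X=0$ if and only if $X$ is finite and non-empty, and $\dim\emptyset=-\infty$; $\dim(X\cup Y)=\max\{\dim X,\dim Y\}$; and if $f\colon X\to Y$ is an interpretable map with $\dim f^{-1}(y)\ge d$ for all $y\in Y$, then $\dim X\ge\dim Y+d$. Let $\mathcal T$ be a finite-dimensional theory in a language $L$, let $\kappa>2^{\aleph_0}$ be a regular cardinal with $|L|<\kappa$, and let $M$ be a $\kappa$-saturated model of $\mathcal T$. (For instance, $M$ may be a saturated model of inaccessible cardinality $\kappa>|L|$.) Call a set *bounded* if it has fewer than $\kappa$ elements, and *unbounded* otherwise; a set is *type-definable* if it is the intersection of a bounded family of definable sets, and *invariant* if it is the union of a bounded family of type-definable sets. A definable group is *connected* if it has no definable proper subgroup of finite index. For a definable abelian group $V$ in $M$, let $\operatorname{DefEnd}(V)$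 be the ring of definable endomorphisms of $V$; a set of definable endomorphisms is called type-definable if it is of the form $\{f_c : c\in P\}$, where $P$ is a type-definable set of parameters and the graphs of the $f_c$ are the fibres over $c\in P$ of one definable relation, and invariant if it is the union of a bounded family of such sets. Given a subring $S\le\operatorname{DefEnd}(V)$, one says that $V$ is *irreducible* as an $S$-module if $0$ and $V$ are the only definable, connected, $S$-invariant subgroups of $V$. **Theorem.** Let $V$ be a definable, connected, abelian group in $M$, and let $S\le\operatorname{DefEnd}(V)$ be an invariant, unbounded ring of definable endomorphisms such that $V$ is irreducible as an $S$-module. Then the centraliser $T=C_{\operatorname{DefEnd}(V)}(S)=\{t\in\operatorname{DefEnd}(V): ts=st\text{ for all }s\in S\}$ is a definable skew-field: it is a skew-field, and there are a definable set $K$ (contained in a real sort if $V$ is) and a bijection $K\to T$ such that the ring operations induced on $K$ and the induced action $K\times V\to V$ are definable. -/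

import Mathlib

open FirstOrder

universe u v w

namespace FinDim

variable {L : FirstOrder.Language.{u, v}}

/-! ### Imaginary sorts and interpretable sets

Throughout, "definable" means definable with parameters. -/

/-- An imaginary sort of arity `n` of the structure `M`: a definable equivalence relation on `Mⁿ`. -/
structure ImagSort (L : FirstOrder.Language.{u, v}) (M : Type w) [L.Structure M] (n : ℕ) where
  /-- the equivalence relation -/
  toSetoid : Setoid (Fin n → M)
  definable' : (Set.univ : Set M).Definable L
    {p : Fin n ⊕ Fin n → M | toSetoid (p ∘ Sum.inl) (p ∘ Sum.inr)}

namespace ImagSort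

variable {M : Type w} [L.Structure M] {n m k : ℕ}

/-- The elements of the sort, that is, the quotient of `Mⁿ` by the equivalence relation. -/
def Elem (E : ImagSort L M n) : Type w := Quotient E.toSetoid

/-- The class of a tuple. -/
def cls (E : ImagSort L M n) (x : Fin n → M) : E.Elem := Quotient.mk E.toSetoid x

/-- The sort is real if the equivalence relation is equality. -/
def IsReal (E : ImagSort L M n) : Prop := E.toSetoid = ⊥

/-- Definable subsets of the sort. A pair `(E, X)` with `E.IsDefinable X` is an interpretable set. -/
def IsDefinable (E : ImagSort L M n) (X : Set E.Elem) : Prop :=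
  (Set.univ : Set M).Definable L {x : Fin n → M | E.cls x ∈ X}

/-- Definable relations between two sorts. -/
def DefinableRel₂ (E : ImagSort L M n) (F : ImagSort L M m) (R : E.Elem → F.Elem → Prop) : Prop :=
  (Set.univ : Set M).Definable L
    {p : Fin n ⊕ Fin m → M | R (E.cls (p ∘ Sum.inl)) (F.cls (p ∘ Sum.inr))}

/-- Definable relations between three sorts. -/
def DefinableRel₃ (E : ImagSort L M n) (F : ImagSort L M m) (G : ImagSort L M k)
    (R : E.Elem → F.Elem → G.Elem → Prop) : Prop :=
  (Set.univ : Set M).Definable L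
    {p : Fin n ⊕ (Fin m ⊕ Fin k) → M |
      R (E.cls (p ∘ Sum.inl)) (F.cls (p ∘ Sum.inr ∘ Sum.inl)) (G.cls (p ∘ Sum.inr ∘ Sum.inr))}

/-- A map between interpretable sets is interpretable if its graph is definable. -/
def DefinableMap (E : ImagSort L M n) (F : ImagSort L M m) {X : Set E.Elem} {Y : Set F.Elem}
    (f : X → Y) : Prop :=
  DefinableRel₂ E F fun a b => ∃ x : X, x.1 = a ∧ (f x).1 = b

end ImagSort

/-! ### Finite-dimensional theories -/

/-- Two finite tuples, possibly in different structures, have the same type (over `∅`). -/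
def SameType {M N : Type w} [L.Structure M] [L.Structure N] {m : ℕ}
    (a : Fin m → M) (b : Fin m → N) : Prop :=
  ∀ φ : L.Formula (Fin m), φ.Realize a ↔ φ.Realize b

/-- A (fine, integer-valued) dimension function, from interpretable sets in models of `T` to
`ℕ ∪ {-∞}`. The value of `dim` on a set that is not definable is irrelevant. -/
structure DimensionFunction (T : L.Theory) where
  /-- the dimension of a subset of a sort -/
  dim : ∀ (N : T.ModelType.{u, v, w}) {n : ℕ} (E : ImagSort L N n), Set E.Elem → WithBot ℕ
  /-- Invariance. The interpretable set defined by the formulas `ε` (for the equivalence relation)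
  and `φ` (for the set) has a dimension that depends only on the type of the parameters. -/
  invariance : ∀ (N N' : T.ModelType.{u, v, w}) {m n : ℕ}
    (ε : L.Formula (Fin m ⊕ (Fin n ⊕ Fin n))) (φ : L.Formula (Fin m ⊕ Fin n))
    (a : Fin m → N) (a' : Fin m → N') (_ : SameType (L := L) a a')
    (E : ImagSort L N n) (E' : ImagSort L N' n) (X : Set E.Elem) (X' : Set E'.Elem)
    (_ : ∀ p : Fin n ⊕ Fin n → N,
      E.toSetoid (p ∘ Sum.inl) (p ∘ Sum.inr) ↔ ε.Realize (Sum.elim a p))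
    (_ : ∀ p : Fin n ⊕ Fin n → N',
      E'.toSetoid (p ∘ Sum.inl) (p ∘ Sum.inr) ↔ ε.Realize (Sum.elim a' p))
    (_ : ∀ x : Fin n → N, E.cls x ∈ X ↔ φ.Realize (Sum.elim a x))
    (_ : ∀ x : Fin n → N', E'.cls x ∈ X' ↔ φ.Realize (Sum.elim a' x)),
    dim N E X = dim N' E' X'
  /-- Algebraicity. -/
  algebraicity : ∀ (N : T.ModelType.{u, v, w}) {n : ℕ} (E : ImagSort L N n) (X : Set E.Elem),
    E.IsDefinable X → (dim N E X = 0 ↔ X.Finite ∧ X.Nonempty)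
  dim_empty : ∀ (N : T.ModelType.{u, v, w}) {n : ℕ} (E : ImagSort L N n), dim N E ∅ = ⊥
  /-- Union. -/
  union : ∀ (N : T.ModelType.{u, v, w}) {n : ℕ} (E : ImagSort L N n) (X Y : Set E.Elem),
    E.IsDefinable X → E.IsDefinable Y → dim N E (X ∪ Y) = max (dim N E X) (dim N E Y)
  /-- Fibration. -/
  fibration : ∀ (N : T.ModelType.{u, v, w}) {n m : ℕ} (E : ImagSort L N n) (F : ImagSort L N m)
    (X : Set E.Elem) (Y : Set F.Elem), E.IsDefinable X → F.IsDefinable Y →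
    ∀ (f : X → Y), ImagSort.DefinableMap E F f → ∀ d : ℕ,
    (∀ y : Y, (d : WithBot ℕ) ≤ dim N E (Subtype.val '' (f ⁻¹' {y}))) →
    dim N F Y + (d : WithBot ℕ) ≤ dim N E X

/-- A theory is finite-dimensional if it carries a dimension function. -/
def IsFiniteDimensional (T : L.Theory) : Prop :=
  Nonempty (DimensionFunction.{u, v, w} T)

/-! ### Saturation -/

/-- `M` is `κ`-saturated: for every set `A` of fewer than `κ` parameters and every finite `n`, every
finitely satisfiable family of `A`-definable subsets of `Mⁿ` has a common point. -/
def IsSaturated (L : FirstOrder.Language.{u, v}) (M : Type w) [L.Structure M] (κ : Cardinal.{w}) : Prop :=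
  ∀ A : Set M, Cardinal.mk A < κ → ∀ (n : ℕ) (𝒟 : Set (Set (Fin n → M))),
    (∀ D ∈ 𝒟, A.Definable L D) → (∀ 𝓕 ⊆ 𝒟, 𝓕.Finite → (⋂₀ 𝓕).Nonempty) → (⋂₀ 𝒟).Nonempty

/-! ### Definable abelian groups and their definable endomorphisms -/

/-- A definable abelian group (in an arbitrary, real or imaginary, sort). -/
structure DefAbGroup (L : FirstOrder.Language.{u, v}) (M : Type w) [L.Structure M] where
  /-- the number of variables -/
  arity : ℕ
  /-- the ambient sort -/
  sort : ImagSort L M arity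
  /-- the underlying set -/
  carrier : Set sort.Elem
  definable_carrier : sort.IsDefinable carrier
  /-- the group structure -/
  group : AddCommGroup carrier
  definable_add : ImagSort.DefinableRel₃ sort sort sort fun a b c =>
    ∃ x y : carrier, x.1 = a ∧ y.1 = b ∧ (x + y).1 = c

namespace DefAbGroup

variable {M : Type w} [L.Structure M]

/-- The elements of the group. -/
def Elem (V : DefAbGroup L M) : Type w := V.carrier

instance (V : DefAbGroup L M) : AddCommGroup V.Elem := V.group

variable (V : DefAbGroup L M)

/-- The graph of a self-map, as a set of pairs of tuples of elements of the structure. -/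
def graph (f : V.Elem → V.Elem) : Set (Fin V.arity ⊕ Fin V.arity → M) :=
  {p | ∃ x : V.Elem, x.1 = V.sort.cls (p ∘ Sum.inl) ∧ (f x).1 = V.sort.cls (p ∘ Sum.inr)}

/-- Definable self-maps. -/
def IsDefinableMap (f : V.Elem → V.Elem) : Prop :=
  (Set.univ : Set M).Definable L (V.graph f)

/-- Definable subgroups. -/
def IsDefinableSubgroup (W : AddSubgroup V.Elem) : Prop :=
  V.sort.IsDefinable {a | ∃ x : V.Elem, x ∈ W ∧ x.1 = a}

/-- Connected subgroups: those without a definable proper subgroup of finite index. -/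
def IsConnected (W : AddSubgroup V.Elem) : Prop :=
  ∀ H : AddSubgroup V.Elem, V.IsDefinableSubgroup H → H ≤ W → H.IsFiniteRelIndex W → H = W

section closure

variable {V} {f g : V.Elem → V.Elem}

theorem definable_of_eq {α : Type} {s t : Set (α → M)} (hs : (Set.univ : Set M).Definable L s)
    (h : t = s) : (Set.univ : Set M).Definable L t := h ▸ hs

theorem cls_mem {x : V.Elem} {a : Fin V.arity → M} (h : x.1 = V.sort.cls a) :
    V.sort.cls a ∈ V.carrier := h ▸ x.2

theorem exists_rep (x : V.Elem) : ∃ a : Fin V.arity → M, x.1 = V.sort.cls a := by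
  obtain ⟨a, ha⟩ := Quotient.exists_rep x.1
  exact ⟨a, ha.symm⟩

theorem definable_add' : (Set.univ : Set M).Definable L
    {p : Fin V.arity ⊕ (Fin V.arity ⊕ Fin V.arity) → M | ∃ x y : V.Elem,
      x.1 = V.sort.cls (p ∘ Sum.inl) ∧ y.1 = V.sort.cls (p ∘ Sum.inr ∘ Sum.inl) ∧
        (x + y).1 = V.sort.cls (p ∘ Sum.inr ∘ Sum.inr)} :=
  V.definable_add

theorem isDefinableMap_id : V.IsDefinableMap fun x => x := by
  have h1 := V.definable_carrier.preimage_comp (Sum.inl : Fin V.arity → Fin V.arity ⊕ Fin V.arity)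
  refine definable_of_eq (h1.inter V.sort.definable') ?_
  ext p
  symm
  constructor
  · rintro ⟨h, h'⟩
    exact ⟨⟨_, h⟩, rfl, Quotient.sound h'⟩
  · rintro ⟨x, h, h'⟩
    refine ⟨cls_mem h, Quotient.exact (h.symm.trans h')⟩

theorem IsDefinableMap.comp (hf : V.IsDefinableMap f) (hg : V.IsDefinableMap g) :
    V.IsDefinableMap fun x => f (g x) := by
  let A := Fin V.arity
  have h1 := hg.preimage_comp (Sum.elim (Sum.inl ∘ Sum.inl) Sum.inr : A ⊕ A → (A ⊕ A) ⊕ A)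
  have h2 := hf.preimage_comp (Sum.elim Sum.inr (Sum.inl ∘ Sum.inr) : A ⊕ A → (A ⊕ A) ⊕ A)
  refine definable_of_eq ((h1.inter h2).image_comp (Sum.inl : A ⊕ A → (A ⊕ A) ⊕ A)) ?_
  ext p
  symm
  constructor
  · rintro ⟨q, ⟨⟨x, hx, hx'⟩, ⟨y, hy, hy'⟩⟩, rfl⟩
    have : y = g x := Subtype.ext (hy.trans hx'.symm)
    subst this
    exact ⟨x, hx, hy'⟩
  · rintro ⟨x, hx, hx'⟩
    obtain ⟨a, ha⟩ := exists_rep (g x)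
    exact ⟨Sum.elim p a, ⟨⟨x, hx, ha⟩, ⟨g x, ha, hx'⟩⟩, rfl⟩

theorem IsDefinableMap.add (hf : V.IsDefinableMap f) (hg : V.IsDefinableMap g) :
    V.IsDefinableMap fun x => f x + g x := by
  let A := Fin V.arity
  have h1 := hf.preimage_comp
    (Sum.elim (Sum.inl ∘ Sum.inl) (Sum.inr ∘ Sum.inl) : A ⊕ A → (A ⊕ A) ⊕ (A ⊕ A))
  have h2 := hg.preimage_comp
    (Sum.elim (Sum.inl ∘ Sum.inl) (Sum.inr ∘ Sum.inr) : A ⊕ A → (A ⊕ A) ⊕ (A ⊕ A))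
  have h3 := (definable_add' (V := V)).preimage_comp
    (Sum.elim (Sum.inr ∘ Sum.inl) (Sum.elim (Sum.inr ∘ Sum.inr) (Sum.inl ∘ Sum.inr)) :
      A ⊕ (A ⊕ A) → (A ⊕ A) ⊕ (A ⊕ A))
  refine definable_of_eq (((h1.inter h2).inter h3).image_comp
    (Sum.inl : A ⊕ A → (A ⊕ A) ⊕ (A ⊕ A))) ?_
  ext p
  symm
  constructor
  · rintro ⟨q, ⟨⟨⟨x, hx, hx'⟩, ⟨y, hy, hy'⟩⟩, ⟨z, t, hz, ht, hzt⟩⟩, rfl⟩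
    have e1 : y = x := Subtype.ext (hy.trans hx.symm)
    subst e1
    have e2 : z = f y := Subtype.ext (hz.trans hx'.symm)
    have e3 : t = g y := Subtype.ext (ht.trans hy'.symm)
    subst e2 e3
    exact ⟨y, hx, hzt⟩
  · rintro ⟨x, hx, hx'⟩
    obtain ⟨a, ha⟩ := exists_rep (f x)
    obtain ⟨b, hb⟩ := exists_rep (g x)
    exact ⟨Sum.elim p (Sum.elim a b),
      ⟨⟨⟨x, hx, ha⟩, ⟨x, hx, hb⟩⟩, ⟨f x, g x, ha, hb, hx'⟩⟩, rfl⟩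

theorem isDefinableMap_zero : V.IsDefinableMap fun _ => 0 := by
  let A := Fin V.arity
  have h1 := V.definable_carrier.preimage_comp (Sum.inl : A → A ⊕ A)
  have h3 := (definable_add' (V := V)).preimage_comp
    (Sum.elim Sum.inr (Sum.elim Sum.inr Sum.inr) : A ⊕ (A ⊕ A) → A ⊕ A)
  refine definable_of_eq (h1.inter h3) ?_
  ext p
  symm
  constructor
  · rintro ⟨h, ⟨x, y, hx, hy, hxy⟩⟩
    have e1 : y = x := Subtype.ext (hy.trans hx.symm)
    subst e1
    have e2 : y + y = y := Subtype.ext (hxy.trans hx.symm)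
    have e3 : y = 0 := by simpa using e2
    subst e3
    exact ⟨⟨_, h⟩, rfl, hx⟩
  · rintro ⟨x, hx, hx'⟩
    exact ⟨cls_mem hx, 0, 0, hx', hx', by rw [add_zero]; exact hx'⟩

theorem IsDefinableMap.neg (hf : V.IsDefinableMap f) : V.IsDefinableMap fun x => -f x := by
  let A := Fin V.arity
  have h0 := (isDefinableMap_zero (V := V)).preimage_comp
    (Sum.elim (Sum.inl ∘ Sum.inl) (Sum.inr ∘ Sum.inr) : A ⊕ A → (A ⊕ A) ⊕ (A ⊕ A))
  have h1 := hf.preimage_comp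
    (Sum.elim (Sum.inl ∘ Sum.inl) (Sum.inr ∘ Sum.inl) : A ⊕ A → (A ⊕ A) ⊕ (A ⊕ A))
  have h3 := (definable_add' (V := V)).preimage_comp
    (Sum.elim (Sum.inr ∘ Sum.inl) (Sum.elim (Sum.inl ∘ Sum.inr) (Sum.inr ∘ Sum.inr)) :
      A ⊕ (A ⊕ A) → (A ⊕ A) ⊕ (A ⊕ A))
  refine definable_of_eq (((h0.inter h1).inter h3).image_comp
    (Sum.inl : A ⊕ A → (A ⊕ A) ⊕ (A ⊕ A))) ?_
  ext p
  symm
  constructor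
  · rintro ⟨q, ⟨⟨⟨x, hx, hx'⟩, ⟨y, hy, hy'⟩⟩, ⟨z, t, hz, ht, hzt⟩⟩, rfl⟩
    have e1 : y = x := Subtype.ext (hy.trans hx.symm)
    subst e1
    have e2 : z = f y := Subtype.ext (hz.trans hy'.symm)
    subst e2
    have e3 : f y + t = 0 := Subtype.ext (hzt.trans hx'.symm)
    have e4 : t = -f y := (neg_eq_of_add_eq_zero_right e3).symm
    subst e4
    exact ⟨y, hx, ht⟩
  · rintro ⟨x, hx, hx'⟩
    obtain ⟨a, ha⟩ := exists_rep (f x)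
    obtain ⟨b, hb⟩ := exists_rep (0 : V.Elem)
    exact ⟨Sum.elim p (Sum.elim a b), ⟨⟨⟨x, hx, hb⟩, ⟨x, hx, ha⟩⟩,
      ⟨f x, -f x, ha, hx', by rw [add_neg_cancel]; exact hb⟩⟩, rfl⟩

end closure

/-- The ring `DefEnd(V)` of definable endomorphisms, under composition. -/
def DefEnd : Subring (AddMonoid.End V.Elem) where
  carrier := {f | V.IsDefinableMap f}
  mul_mem' {f g} hf hg := IsDefinableMap.comp (f := f) (g := g) hf hg
  one_mem' := isDefinableMap_id
  add_mem' {f g} hf hg := IsDefinableMap.add (f := f) (g := g) hf hg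
  zero_mem' := isDefinableMap_zero
  neg_mem' {f} hf := IsDefinableMap.neg (f := f) hf

variable {V}

/-- A type-definable set of definable endomorphisms: the endomorphisms with a graph of the form
`G(c, -)`, for a fixed definable relation `G`, where the parameter `c` ranges over the intersection
of fewer than `κ` definable sets. -/
def IsTypeDefinable (κ : Cardinal.{w}) (F : Set V.DefEnd) : Prop :=
  ∃ (m : ℕ) (G : Set (Fin m ⊕ (Fin V.arity ⊕ Fin V.arity) → M)) (𝒟 : Set (Set (Fin m → M))),
    (Set.univ : Set M).Definable L G ∧ Cardinal.mk 𝒟 < κ ∧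
      (∀ D ∈ 𝒟, (Set.univ : Set M).Definable L D) ∧
      F = {f | ∃ c ∈ ⋂₀ 𝒟, V.graph f.1 = {p | Sum.elim c p ∈ G}}

/-- An invariant set of definable endomorphisms: a union of fewer than `κ` type-definable sets. -/
def IsInvariant (κ : Cardinal.{w}) (F : Set V.DefEnd) : Prop :=
  ∃ 𝓕 : Set (Set V.DefEnd), Cardinal.mk 𝓕 < κ ∧ (∀ F' ∈ 𝓕, IsTypeDefinable κ F') ∧ F = ⋃₀ 𝓕

/-- `V` is irreducible as an `S`-module, in the definable, connected category: the only definable,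
connected, `S`-invariant subgroups are `0` and `V`. -/
def IsIrreducible (S : Subring V.DefEnd) : Prop :=
  ∀ W : AddSubgroup V.Elem, V.IsDefinableSubgroup W → V.IsConnected W →
    (∀ s ∈ S, ∀ x ∈ W, s.1 x ∈ W) → W = ⊥ ∨ W = ⊤

/-- A ring `R` of definable endomorphisms is definable: it is in bijection with a definable subset
`K` of some sort, in such a way that the ring operations and the action on `V` are definable. If `V`
lives in a real sort, then the sort of `K` is required to be real too. -/
def IsDefinableRing (R : Subring V.DefEnd) : Prop :=
  ∃ (m : ℕ) (J : ImagSort L M m) (K : Set J.Elem) (e : K ≃ R),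
    (V.sort.IsReal → J.IsReal) ∧ J.IsDefinable K ∧
    ImagSort.DefinableRel₃ J J J
      (fun a b c => ∃ x y z : K, x.1 = a ∧ y.1 = b ∧ z.1 = c ∧ e x + e y = e z) ∧
    ImagSort.DefinableRel₃ J J J
      (fun a b c => ∃ x y z : K, x.1 = a ∧ y.1 = b ∧ z.1 = c ∧ e x * e y = e z) ∧
    ImagSort.DefinableRel₃ J V.sort V.sort
      (fun a b c => ∃ (x : K) (y z : V.Elem), x.1 = a ∧ y.1 = b ∧ z.1 = c ∧ (e x).1.1 y = z)

/-- A ring of definable endomorphisms is a definable skew-field. -/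
def IsDefinableSkewField (R : Subring V.DefEnd) : Prop :=
  (Nontrivial R ∧ ∀ r : R, r ≠ 0 → IsUnit r) ∧ IsDefinableRing R

end DefAbGroup

end FinDim

/-! A non-zero `t` in the centraliser `C` has a definable, connected, `S`-invariant image, so it is
surjective by irreducibility. Injectivity and definability remain. If `C` is finite, both are
elementary: cancelling a surjective `t` on the right is injective on `C`, hence `t` has a left
inverse in `C`.

Let `C` be infinite. Choose a non-zero `s ∈ S` with image of least dimension and call `sV` the line.
By `exists_minimal_range` and `irreducible_line`, the maps `s r` with `r ∈ S` induce on `sV` a ring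
`R` of endomorphisms that are zero or surjective, and `sV` is irreducible over `R`. Since `S` is
unbounded, it contains a type-definable family of more than continuum many elements. Finitely many
maps `f ↦ s j f i` separate it, so `R` inherits such a family. If `t ∈ C` were not injective on
`sV`, the kernels of its powers would have a countably infinite, `R`-invariant union. Two members of
the family would agree there, and their difference would be surjective with infinite kernel, which
dimension forbids (`injective_of_commute`). So an orbit of the infinite `C` on a non-zero vector of
the line is infinite and cannot lie in the finite kernel of a non-zero element of `R`: all of these
are bijective.

Dimension also bounds the length of a list that is independent over an infinite type-definable
family (`FamIndep.length_le_sdim`). One consequence is the Ore condition for `R`, so that `sV` is a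
vector space over the skew field `Q` of fractions. Another is that endomorphisms commuting with the
family are determined by their values on a finite maximal independent list, so a pointwise definable
family of them is uniformly definable (`defFun_of_commute`). Applied to `τ w : x ↦ g(x) w`, for a
`Q`-linear functional `g` with `g v = 1`, this makes the projection to `Qv` definable.
Irreducibility then yields `sV = Qv` (`exists_transitive_commuting`).

Finally `x ↦ (s j x)`, with `j` in a finite set, embeds `V` in a power of the line, and `τ w` acting
on coordinates preserves the image of `V`. This gives the element of `C` that sends `v` to `w`.
Hence `t ↦ t v` identifies `C` with the line, and the action is definable.

All of this takes place in `Coded` types, which are closed under products, definable subsets and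
definable quotients. -/

namespace FinDim

/-! ### Coded types -/

section Coding

variable (L : FirstOrder.Language.{u, v}) (M : Type w) [L.Structure M]

/-- A coding of the elements of `X` by tuples of elements of `M`, with definable equality. -/
class Coded (X : Type*) where
  /-- the variables -/
  idx : Type
  finite_idx : Finite idx
  /-- the tuple `a` is a code of `x` -/
  IsCode : (idx → M) → X → Prop
  exists_code : ∀ x, ∃ a, IsCode a x
  code_unique : ∀ {a x y}, IsCode a x → IsCode a y → x = y
  definable_code : (Set.univ : Set M).Definable L
    {p : idx ⊕ idx → M | ∃ x, IsCode (p ∘ Sum.inl) x ∧ IsCode (p ∘ Sum.inr) x}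

attribute [instance] Coded.finite_idx

variable {M} in
/-- The tuple `a` is a code of `x`. -/
abbrev Coded.Code {X : Type*} [Coded L M X] (a : Coded.idx L M X → M) (x : X) : Prop :=
  Coded.IsCode a x

variable {X Y Z W : Type*} [Coded L M X] [Coded L M Y] [Coded L M Z] [Coded L M W]

/-- The codes of the elements of a set. -/
def codes (S : Set X) : Set (Coded.idx L M X → M) := {a | ∃ x ∈ S, Coded.Code L a x}

/-- Definable subsets of a coded type. -/
def DefSet (S : Set X) : Prop := (Set.univ : Set M).Definable L (codes L M S)

variable {L M}

theorem codes_inter (S T : Set X) : codes L M (S ∩ T) = codes L M S ∩ codes L M T := by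
  ext a
  constructor
  · rintro ⟨x, ⟨h, h'⟩, hx⟩
    exact ⟨⟨x, h, hx⟩, ⟨x, h', hx⟩⟩
  · rintro ⟨⟨x, h, hx⟩, ⟨y, h', hy⟩⟩
    obtain rfl := Coded.code_unique hx hy
    exact ⟨x, ⟨h, h'⟩, hx⟩

theorem codes_union (S T : Set X) : codes L M (S ∪ T) = codes L M S ∪ codes L M T := by
  ext a
  constructor
  · rintro ⟨x, h | h, hx⟩
    · exact Or.inl ⟨x, h, hx⟩
    · exact Or.inr ⟨x, h, hx⟩
  · rintro (⟨x, h, hx⟩ | ⟨x, h, hx⟩)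
    · exact ⟨x, Or.inl h, hx⟩
    · exact ⟨x, Or.inr h, hx⟩

theorem codes_compl (S : Set X) : codes L M Sᶜ = codes L M Set.univ \ codes L M S := by
  ext a
  constructor
  · rintro ⟨x, h, hx⟩
    refine ⟨⟨x, trivial, hx⟩, ?_⟩
    rintro ⟨y, h', hy⟩
    obtain rfl := Coded.code_unique hx hy
    exact h h'
  · rintro ⟨⟨x, -, hx⟩, h⟩
    exact ⟨x, fun h' => h ⟨x, h', hx⟩, hx⟩

theorem DefSet.univ : DefSet L M (Set.univ : Set X) := by
  refine DefAbGroup.definable_of_eq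
    ((Coded.definable_code (L := L) (M := M) (X := X)).preimage_comp (Sum.elim id id)) ?_
  ext a
  constructor
  · rintro ⟨x, -, hx⟩
    exact ⟨x, hx, hx⟩
  · rintro ⟨x, hx, -⟩
    exact ⟨x, trivial, hx⟩

theorem DefSet.inter {S T : Set X} (hS : DefSet L M S) (hT : DefSet L M T) :
    DefSet L M (S ∩ T) := by
  unfold DefSet; rw [codes_inter]; exact Set.Definable.inter hS hT

theorem DefSet.union {S T : Set X} (hS : DefSet L M S) (hT : DefSet L M T) :
    DefSet L M (S ∪ T) := by
  unfold DefSet; rw [codes_union]; exact Set.Definable.union hS hT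

theorem DefSet.compl {S : Set X} (hS : DefSet L M S) : DefSet L M Sᶜ := by
  unfold DefSet; rw [codes_compl]; exact Set.Definable.sdiff DefSet.univ hS

instance : Coded L M (X × Y) where
  idx := Coded.idx L M X ⊕ Coded.idx L M Y
  finite_idx := inferInstance
  IsCode a p := Coded.Code L (a ∘ Sum.inl) p.1 ∧ Coded.Code L (a ∘ Sum.inr) p.2
  exists_code p := by
    obtain ⟨a, ha⟩ := Coded.exists_code (L := L) (M := M) p.1
    obtain ⟨b, hb⟩ := Coded.exists_code (L := L) (M := M) p.2
    exact ⟨Sum.elim a b, ha, hb⟩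
  code_unique h h' := Prod.ext (Coded.code_unique h.1 h'.1) (Coded.code_unique h.2 h'.2)
  definable_code := by
    have h1 := (Coded.definable_code (L := L) (M := M) (X := X)).preimage_comp
      (Sum.map Sum.inl Sum.inl : _ → (Coded.idx L M X ⊕ Coded.idx L M Y) ⊕
        (Coded.idx L M X ⊕ Coded.idx L M Y))
    have h2 := (Coded.definable_code (L := L) (M := M) (X := Y)).preimage_comp
      (Sum.map Sum.inr Sum.inr : _ → (Coded.idx L M X ⊕ Coded.idx L M Y) ⊕
        (Coded.idx L M X ⊕ Coded.idx L M Y))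
    refine DefAbGroup.definable_of_eq (h1.inter h2) ?_
    ext p
    constructor
    · rintro ⟨x, h, h'⟩
      exact ⟨⟨x.1, h.1, h'.1⟩, ⟨x.2, h.2, h'.2⟩⟩
    · rintro ⟨⟨x, h1, h2⟩, ⟨y, h3, h4⟩⟩
      exact ⟨(x, y), ⟨h1, h3⟩, ⟨h2, h4⟩⟩

theorem DefSet.proj {S : Set (X × Y)} (hS : DefSet L M S) :
    DefSet L M {x | ∃ y, (x, y) ∈ S} := by
  refine DefAbGroup.definable_of_eq (Set.Definable.image_comp hS
    (Sum.inl : Coded.idx L M X → Coded.idx L M X ⊕ Coded.idx L M Y)) ?_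
  ext a
  constructor
  · rintro ⟨x, ⟨y, hxy⟩, hx⟩
    obtain ⟨b, hb⟩ := Coded.exists_code (L := L) (M := M) y
    exact ⟨Sum.elim a b, ⟨(x, y), hxy, hx, hb⟩, rfl⟩
  · rintro ⟨p, ⟨⟨x, y⟩, hxy, hx, hy⟩, rfl⟩
    exact ⟨x, ⟨y, hxy⟩, hx⟩

variable (L M) in
/-- Maps between coded types that are induced by a map between the variables. -/
def IsReindex (f : X → Y) : Prop :=
  ∃ h : Coded.idx L M Y → Coded.idx L M X, ∀ a x, Coded.Code L a x → Coded.Code L (a ∘ h) (f x)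

theorem IsReindex.id : IsReindex L M (fun x : X => x) := ⟨fun i => i, fun _ _ h => h⟩

theorem IsReindex.comp {g : Y → Z} {f : X → Y} (hg : IsReindex L M g) (hf : IsReindex L M f) :
    IsReindex L M fun x => g (f x) := by
  obtain ⟨h, hh⟩ := hg
  obtain ⟨k, hk⟩ := hf
  exact ⟨fun i => k (h i), fun a x hx => hh _ _ (hk _ _ hx)⟩

theorem IsReindex.fst {f : Z → X × Y} (hf : IsReindex L M f) : IsReindex L M fun x => (f x).1 :=
  IsReindex.comp (g := Prod.fst) ⟨Sum.inl, fun _ _ h => h.1⟩ hf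

theorem IsReindex.snd {f : Z → X × Y} (hf : IsReindex L M f) : IsReindex L M fun x => (f x).2 :=
  IsReindex.comp (g := Prod.snd) ⟨Sum.inr, fun _ _ h => h.2⟩ hf

theorem IsReindex.prodMk {f : Z → X} {g : Z → Y} (hf : IsReindex L M f) (hg : IsReindex L M g) :
    IsReindex L M fun x => (f x, g x) := by
  obtain ⟨h, hh⟩ := hf
  obtain ⟨k, hk⟩ := hg
  exact ⟨Sum.elim h k, fun a x hx => ⟨hh _ _ hx, hk _ _ hx⟩⟩

theorem DefSet.preimage_reindex {f : X → Y} (hf : IsReindex L M f) {S : Set Y}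
    (hS : DefSet L M S) : DefSet L M {x | f x ∈ S} := by
  obtain ⟨h, hh⟩ := hf
  -- A tuple that codes nothing in `X` may still restrict along `h` to a code, hence the
  -- intersection with the codes of `X`.
  refine DefAbGroup.definable_of_eq (Set.Definable.inter (DefSet.univ (X := X))
    (Set.Definable.preimage_comp h hS)) ?_
  ext a
  constructor
  · rintro ⟨x, h1, hx⟩
    exact ⟨⟨x, trivial, hx⟩, ⟨f x, h1, hh _ _ hx⟩⟩
  · rintro ⟨⟨x, -, hx⟩, ⟨y, hy, hy'⟩⟩
    obtain rfl := Coded.code_unique (hh _ _ hx) hy'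
    exact ⟨x, hy, hx⟩

theorem DefSet.diagonal : DefSet L M {p : X × X | p.1 = p.2} := by
  refine DefAbGroup.definable_of_eq (Coded.definable_code (L := L) (M := M) (X := X)) ?_
  ext p
  constructor
  · rintro ⟨⟨x, y⟩, hxy, hx, hy⟩
    have hxy : x = y := hxy
    exact ⟨x, hx, hxy ▸ hy⟩
  · rintro ⟨x, hx, hy⟩
    exact ⟨(x, x), rfl, hx, hy⟩

theorem definable_singleton_tuple {ι : Type} [Finite ι] (a : ι → M) :
    (Set.univ : Set M).Definable L {a} := by
  have h : ∀ i, (Set.univ : Set M).Definable L {x : ι → M | x i = a i} := fun i =>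
    DefAbGroup.definable_of_eq
      (Set.Definable.preimage_comp (fun _ : Fin 1 => i)
        (Set.Definable.singleton_of_mem L (Set.mem_univ (a i)))) rfl
  refine DefAbGroup.definable_of_eq (Set.definable_iInter_of_finite h) ?_
  ext x
  simp [funext_iff]

theorem DefSet.singleton (x : X) : DefSet L M {x} := by
  obtain ⟨a, ha⟩ := Coded.exists_code (L := L) (M := M) x
  refine DefAbGroup.definable_of_eq (Set.Definable.image_comp
    ((Coded.definable_code (L := L) (M := M) (X := X)).inter
      ((definable_singleton_tuple (L := L) a).preimage_comp Sum.inr))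
    (Sum.inl : Coded.idx L M X → Coded.idx L M X ⊕ Coded.idx L M X)) ?_
  ext b
  constructor
  · rintro ⟨y, rfl, hy⟩
    exact ⟨Sum.elim b a, ⟨⟨y, hy, ha⟩, rfl⟩, rfl⟩
  · rintro ⟨p, ⟨⟨y, h1, h2⟩, h3⟩, rfl⟩
    have h3 : p ∘ Sum.inr = a := h3
    rw [h3] at h2
    exact ⟨y, Coded.code_unique h2 ha, h1⟩

variable (L M) in
/-- Definable maps between coded types. -/
@[fun_prop]
def DefFun (f : X → Y) : Prop := DefSet L M {p : X × Y | f p.1 = p.2}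

theorem DefFun.of_reindex {f : X → Y} (hf : IsReindex L M f) : DefFun L M f :=
  DefSet.preimage_reindex (f := fun p : X × Y => (f p.1, p.2))
    ((hf.comp IsReindex.id.fst).prodMk IsReindex.id.snd) DefSet.diagonal

@[fun_prop]
theorem DefFun.id : DefFun L M (fun x : X => x) := .of_reindex .id

@[fun_prop]
theorem DefFun.const (c : Y) : DefFun L M (fun _ : X => c) := by
  have := DefSet.preimage_reindex (f := fun p : X × Y => p.2) IsReindex.id.snd
    (DefSet.singleton (L := L) (M := M) c)
  refine (congrArg (DefSet L M) ?_).mp this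
  ext p
  exact eq_comm

theorem DefSet.preimage {f : X → Y} (hf : DefFun L M f) {S : Set Y} (hS : DefSet L M S) :
    DefSet L M {x | f x ∈ S} := by
  have := (DefSet.inter hf (DefSet.preimage_reindex (f := fun p : X × Y => p.2)
    IsReindex.id.snd hS)).proj
  refine (congrArg (DefSet L M) ?_).mp this
  ext x
  constructor
  · rintro ⟨y, hy, hy'⟩
    have hy : f x = y := hy
    subst hy
    exact hy'
  · intro h
    exact ⟨f x, rfl, h⟩

@[fun_prop]
theorem DefFun.comp {g : Y → Z} {f : X → Y} (hg : DefFun L M g) (hf : DefFun L M f) :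
    DefFun L M fun x => g (f x) := by
  have h1 : DefSet L M {p : (X × Z) × Y | f p.1.1 = p.2} := DefSet.preimage_reindex
    (f := fun p : (X × Z) × Y => (p.1.1, p.2)) (IsReindex.id.fst.fst.prodMk IsReindex.id.snd) hf
  have h2 : DefSet L M {p : (X × Z) × Y | g p.2 = p.1.2} := DefSet.preimage_reindex
    (f := fun p : (X × Z) × Y => (p.2, p.1.2)) (IsReindex.id.snd.prodMk IsReindex.id.fst.snd) hg
  refine (congrArg (DefSet L M) ?_).mp (h1.inter h2).proj
  ext p
  constructor
  · rintro ⟨y, hy, hy'⟩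
    have hy : f p.1 = y := hy
    subst hy
    exact hy'
  · intro h
    exact ⟨f p.1, rfl, h⟩

@[fun_prop]
theorem DefFun.prodMk {f : Z → X} {g : Z → Y} (hf : DefFun L M f) (hg : DefFun L M g) :
    DefFun L M fun x => (f x, g x) := by
  have h1 := DefSet.preimage_reindex
    (f := fun p : Z × (X × Y) => (p.1, p.2.1)) (IsReindex.id.fst.prodMk IsReindex.id.snd.fst) hf
  have h2 := DefSet.preimage_reindex
    (f := fun p : Z × (X × Y) => (p.1, p.2.2)) (IsReindex.id.fst.prodMk IsReindex.id.snd.snd) hg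
  refine (congrArg (DefSet L M) ?_).mp (h1.inter h2)
  ext p
  exact (Prod.ext_iff (x := (f p.1, g p.1)) (y := p.2)).symm

@[fun_prop]
theorem DefFun.fst : DefFun L M (Prod.fst : X × Y → X) := .of_reindex IsReindex.id.fst

@[fun_prop]
theorem DefFun.snd : DefFun L M (Prod.snd : X × Y → Y) := .of_reindex IsReindex.id.snd

/-! ### Predicates in set-builder form -/

theorem DefSet.and {φ ψ : X → Prop} (h : DefSet L M {x | φ x}) (h' : DefSet L M {x | ψ x}) :
    DefSet L M {x | φ x ∧ ψ x} := h.inter h'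

theorem DefSet.or {φ ψ : X → Prop} (h : DefSet L M {x | φ x}) (h' : DefSet L M {x | ψ x}) :
    DefSet L M {x | φ x ∨ ψ x} := h.union h'

theorem DefSet.not {φ : X → Prop} (h : DefSet L M {x | φ x}) : DefSet L M {x | ¬ φ x} := h.compl

theorem DefSet.imp {φ ψ : X → Prop} (h : DefSet L M {x | φ x}) (h' : DefSet L M {x | ψ x}) :
    DefSet L M {x | φ x → ψ x} := by
  simp only [imp_iff_not_or]
  exact h.not.or h'

theorem DefSet.ex {φ : X → Y → Prop} (h : DefSet L M {p : X × Y | φ p.1 p.2}) :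
    DefSet L M {x | ∃ y, φ x y} := h.proj

theorem DefSet.all {φ : X → Y → Prop} (h : DefSet L M {p : X × Y | φ p.1 p.2}) :
    DefSet L M {x | ∀ y, φ x y} := by
  have := h.not.ex (φ := fun x y => ¬ φ x y) |>.not
  simpa only [not_exists, not_not] using this

theorem DefSet.eq {f g : X → Y} (hf : DefFun L M f) (hg : DefFun L M g) :
    DefSet L M {x | f x = g x} :=
  DefSet.preimage (f := fun x => (f x, g x)) (by fun_prop) DefSet.diagonal

theorem DefSet.forall_finset {ι : Type*} (s : Finset ι) {φ : ι → X → Prop}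
    (h : ∀ i ∈ s, DefSet L M {x | φ i x}) : DefSet L M {x | ∀ i ∈ s, φ i x} := by
  classical
  induction s using Finset.induction_on with
  | empty => simpa using DefSet.univ
  | insert a s ha ih =>
    simp only [Finset.forall_mem_insert]
    exact (h a (by simp)).and (ih fun i hi => h i (by simp [hi]))

theorem DefSet.image {f : X → Y} (hf : DefFun L M f) {S : Set X} (hS : DefSet L M S) :
    DefSet L M (f '' S) :=
  DefSet.ex (φ := fun y x => x ∈ S ∧ f x = y)
    ((DefSet.preimage (f := Prod.snd) (by fun_prop) hS).and (DefSet.eq (by fun_prop) (by fun_prop)))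

theorem DefFun.of_graph {f : X → Y} {G : X → Y → Prop}
    (hG : DefSet L M {p : X × Y | G p.1 p.2}) (h : ∀ x y, f x = y ↔ G x y) : DefFun L M f := by
  refine (congrArg (DefSet L M) ?_).mp hG
  ext p
  exact (h _ _).symm

/-! ### Subtypes, quotients, tuples -/

/-- The coding of a definable subset. -/
@[reducible]
def Coded.subtype {p : X → Prop} (h : DefSet L M {x | p x}) : Coded L M {x // p x} where
  idx := Coded.idx L M X
  finite_idx := inferInstance
  IsCode a x := Coded.Code L a x.1
  exists_code x := Coded.exists_code x.1
  code_unique h h' := Subtype.ext (Coded.code_unique h h')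
  definable_code := by
    have := DefSet.preimage_reindex (f := fun p : X × X => p.1) IsReindex.id.fst h
    refine DefAbGroup.definable_of_eq (this.inter DefSet.diagonal) ?_
    ext q
    constructor
    · rintro ⟨x, hx, hx'⟩
      exact ⟨(x.1, x.1), ⟨x.2, rfl⟩, hx, hx'⟩
    · rintro ⟨⟨x, y⟩, ⟨hx, hxy⟩, hx', hy'⟩
      have hxy : x = y := hxy
      subst hxy
      exact ⟨⟨x, hx⟩, hx', hy'⟩

theorem DefFun.subtype_val {p : X → Prop} (h : DefSet L M {x | p x}) :
    letI := Coded.subtype h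
    DefFun L M (Subtype.val : {x // p x} → X) :=
  letI := Coded.subtype h
  .of_reindex ⟨fun i => i, fun _ _ h => h⟩

theorem DefFun.subtype_mk {p : X → Prop} (h : DefSet L M {x | p x}) {f : Y → {x // p x}}
    (hf : DefFun L M fun y => (f y).1) :
    letI := Coded.subtype h
    DefFun L M f := by
  let := Coded.subtype h
  have := DefSet.preimage_reindex (f := fun q : Y × {x // p x} => (q.1, q.2.1))
    (IsReindex.id.fst.prodMk (IsReindex.comp (g := Subtype.val)
      ⟨fun i => i, fun _ _ h => h⟩ IsReindex.id.snd)) hf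
  refine (congrArg (DefSet L M) ?_).mp this
  ext q
  exact Subtype.ext_iff.symm

/-- The coding of a quotient of a coded type. -/
@[reducible]
def Coded.ofSurjective {Q : Type*} {f : X → Q} (hf : Function.Surjective f)
    (h : DefSet L M {p : X × X | f p.1 = f p.2}) : Coded L M Q where
  idx := Coded.idx L M X
  finite_idx := inferInstance
  IsCode a y := ∃ x, Coded.Code L a x ∧ f x = y
  exists_code y := by
    obtain ⟨x, rfl⟩ := hf y
    obtain ⟨a, ha⟩ := Coded.exists_code (L := L) (M := M) x
    exact ⟨a, x, ha, rfl⟩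
  code_unique := by
    rintro a x y ⟨z, hz, rfl⟩ ⟨t, ht, rfl⟩
    rw [Coded.code_unique hz ht]
  definable_code := by
    refine DefAbGroup.definable_of_eq h ?_
    ext q
    constructor
    · rintro ⟨y, ⟨x, hx, rfl⟩, ⟨z, hz, hxz⟩⟩
      exact ⟨(x, z), hxz.symm, hx, hz⟩
    · rintro ⟨⟨x, z⟩, hxz, hx, hz⟩
      exact ⟨f x, ⟨x, hx, rfl⟩, ⟨z, hz, hxz.symm⟩⟩

theorem DefFun.ofSurjective {Q : Type*} {f : X → Q} (hf : Function.Surjective f)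
    (h : DefSet L M {p : X × X | f p.1 = f p.2}) :
    letI := Coded.ofSurjective hf h
    DefFun L M f :=
  letI := Coded.ofSurjective hf h
  .of_reindex ⟨fun i => i, fun _ x hx => ⟨x, hx, rfl⟩⟩

instance Coded.tuple (ι : Type) [Finite ι] : Coded L M (ι → M) where
  idx := ι
  finite_idx := inferInstance
  IsCode a x := a = x
  exists_code x := ⟨x, rfl⟩
  code_unique h h' := h.symm.trans h'
  definable_code := by
    have h : ∀ i, (Set.univ : Set M).Definable L {p : ι ⊕ ι → M | p (.inl i) = p (.inr i)} :=
      fun i => DefAbGroup.definable_of_eq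
        (Set.Definable.preimage_comp ![Sum.inl i, Sum.inr i] (Set.Definable.diagonal L Set.univ)) rfl
    refine DefAbGroup.definable_of_eq (Set.definable_iInter_of_finite h) ?_
    ext p
    simp only [Set.mem_iInter]
    constructor
    · rintro ⟨x, h1, h2⟩ i
      exact congrFun (h1.trans h2.symm) i
    · intro h
      exact ⟨_, rfl, funext fun i => (h i).symm⟩

theorem codes_tuple {ι : Type} [Finite ι] (S : Set (ι → M)) : codes L M S = S := by
  ext a
  constructor
  · rintro ⟨x, hx, h⟩
    have h : a = x := h
    exact h ▸ hx
  · intro h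
    exact ⟨a, h, rfl⟩

theorem defSet_tuple_iff {ι : Type} [Finite ι] {S : Set (ι → M)} :
    DefSet L M S ↔ (Set.univ : Set M).Definable L S := by
  unfold DefSet; rw [codes_tuple]

end Coding

end FinDim

namespace FinDim

/-! ### Compactness -/

section Compactness

variable {L : FirstOrder.Language.{u, v}} {M : Type w} [L.Structure M] {κ : Cardinal.{w}}
variable {X Y : Type*} [Coded L M X] [Coded L M Y]

/-- Each definable set needs only finitely many parameters, so fewer than `κ` sets need fewer than
`κ` in all, and saturation applies to their sets of codes. -/
theorem IsSaturated.nonempty_iInter (hM : IsSaturated L M κ) (hκ : Cardinal.aleph0 ≤ κ)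
    {I : Type w} (hI : Cardinal.mk I < κ) {D : I → Set X} (hD : ∀ i, DefSet L M (D i))
    (h : ∀ s : Finset I, (⋂ i ∈ s, D i).Nonempty) : (⋂ i, D i).Nonempty := by
  classical
  let e := Finite.equivFin (Coded.idx L M X)
  let C : Set X → Set (Fin (Nat.card (Coded.idx L M X)) → M) :=
    fun S => (fun g => g ∘ e) ⁻¹' codes L M S
  have hC : ∀ S, DefSet L M S → (Set.univ : Set M).Definable L (C S) :=
    fun S hS => Set.Definable.preimage_comp e hS
  -- The extra member `univ` forces the common tuple to be a code even if `I` is empty.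
  let E : Option I → Set X := fun o => o.elim Set.univ D
  have hE : ∀ o, DefSet L M (E o) := by
    rintro (_ | i)
    · exact DefSet.univ
    · exact hD i
  choose A hA hA' using fun o => Set.definable_iff_finitely_definable.mp (hC _ (hE o))
  have hcard : Cardinal.mk (⋃ o, (A o : Set M)) < κ := by
    rcases finite_or_infinite (Option I) with hfin | hinf
    · exact lt_of_lt_of_le (Cardinal.lt_aleph0_iff_finite.mpr
        (Set.finite_iUnion fun o => (A o).finite_toSet).to_subtype) hκ
    · have : Cardinal.mk (Option I) < κ := by
        rw [Cardinal.mk_option]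
        exact Cardinal.add_lt_of_lt hκ hI (lt_of_lt_of_le Cardinal.one_lt_aleph0 hκ)
      refine lt_of_le_of_lt (Cardinal.mk_iUnion_le_sum_mk.trans
        ((Cardinal.sum_le_sum _ (fun _ => Cardinal.aleph0) fun o =>
          (Cardinal.lt_aleph0_of_finite _).le))) ?_
      rw [Cardinal.sum_const', Cardinal.mul_aleph0_eq (Cardinal.aleph0_le_mk _)]
      exact this
  obtain ⟨g, hg⟩ := hM _ hcard _ (Set.range fun o => C (E o))
    (by
      rintro _ ⟨o, rfl⟩
      exact (hA' o).mono (Set.subset_iUnion (fun o => (A o : Set M)) o))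
    (by
      intro 𝓕 h𝓕 hfin
      choose! k hk using fun S (hS : S ∈ 𝓕) => h𝓕 hS
      let s : Finset I := (hfin.toFinset.image k).eraseNone
      obtain ⟨x, hx⟩ := h s
      obtain ⟨a, ha⟩ := Coded.exists_code (L := L) (M := M) x
      refine ⟨a ∘ e.symm, ?_⟩
      intro S hS
      rw [← hk S hS]
      refine ⟨x, ?_, by simpa [Function.comp_assoc] using ha⟩
      have hkS : k S ∈ hfin.toFinset.image k := Finset.mem_image_of_mem _ (by simpa using hS)
      rcases hkS' : k S with _ | i
      · trivial
      · rw [hkS'] at hkS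
        exact Set.mem_iInter₂.mp hx i (by simpa [s] using hkS))
  obtain ⟨x, -, hx⟩ := hg _ ⟨none, rfl⟩
  refine ⟨x, Set.mem_iInter.mpr fun i => ?_⟩
  obtain ⟨y, hy, hy'⟩ := hg _ ⟨some i, rfl⟩
  obtain rfl := Coded.code_unique hx hy'
  exact hy

variable (L M κ) in
/-- Intersections of fewer than `κ` definable sets. -/
def TDef (S : Set X) : Prop :=
  ∃ (I : Type w) (D : I → Set X), Cardinal.mk I < κ ∧ (∀ i, DefSet L M (D i)) ∧ S = ⋂ i, D i

theorem DefSet.tdef (hκ : Cardinal.aleph0 ≤ κ) {S : Set X} (hS : DefSet L M S) : TDef L M κ S :=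
  ⟨PUnit, fun _ => S, by
    rw [Cardinal.mk_punit]; exact lt_of_lt_of_le Cardinal.one_lt_aleph0 hκ, fun _ => hS, (Set.iInter_const S).symm⟩

theorem TDef.inter (hκ : Cardinal.aleph0 ≤ κ) {S T : Set X} (hS : TDef L M κ S)
    (hT : TDef L M κ T) : TDef L M κ (S ∩ T) := by
  obtain ⟨I, D, hI, hD, rfl⟩ := hS
  obtain ⟨J, E, hJ, hE, rfl⟩ := hT
  refine ⟨I ⊕ J, Sum.elim D E, ?_, by rintro (i | j) <;> simp [hD, hE], by
    ext; simp [Set.mem_iInter]⟩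
  rw [Cardinal.mk_sum, Cardinal.lift_id, Cardinal.lift_id]
  exact Cardinal.add_lt_of_lt hκ hI hJ

theorem TDef.preimage {f : X → Y} (hf : DefFun L M f) {S : Set Y} (hS : TDef L M κ S) :
    TDef L M κ {x | f x ∈ S} := by
  obtain ⟨I, D, hI, hD, rfl⟩ := hS
  exact ⟨I, fun i => {x | f x ∈ D i}, hI, fun i => DefSet.preimage hf (hD i), by ext; simp⟩

theorem TDef.and (hκ : Cardinal.aleph0 ≤ κ) {φ ψ : X → Prop} (h : TDef L M κ {x | φ x})
    (h' : TDef L M κ {x | ψ x}) : TDef L M κ {x | φ x ∧ ψ x} := h.inter hκ h'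

theorem mk_finset_lt (hκ : Cardinal.aleph0 ≤ κ) {I : Type w} (hI : Cardinal.mk I < κ) :
    Cardinal.mk (Finset I) < κ := by
  rcases finite_or_infinite I with _ | _
  · exact lt_of_lt_of_le (Cardinal.lt_aleph0_of_finite _) hκ
  · rwa [Cardinal.mk_finset_of_infinite]

/-- By saturation, projection commutes with the intersection once all finite subintersections are
projected, hence the new index type `Finset I`. -/
theorem TDef.ex (hM : IsSaturated L M κ) (hκ : Cardinal.aleph0 ≤ κ) {φ : X → Y → Prop}
    (h : TDef L M κ {p : X × Y | φ p.1 p.2}) : TDef L M κ {x | ∃ y, φ x y} := by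
  classical
  obtain ⟨I, D, hI, hD, hS⟩ := h
  have hfin : ∀ s : Finset I, DefSet L M {p : X × Y | ∀ i ∈ s, p ∈ D i} := fun s =>
    DefSet.forall_finset s fun i _ => hD i
  refine ⟨Finset I, fun s => {x | ∃ y, ∀ i ∈ s, (x, y) ∈ D i}, mk_finset_lt hκ hI,
    fun s => DefSet.ex (hfin s), ?_⟩
  ext x
  simp only [Set.mem_iInter]
  constructor
  · rintro ⟨y, hy⟩ s
    have : (x, y) ∈ ⋂ i, D i := hS ▸ hy
    exact ⟨y, fun i _ => Set.mem_iInter.mp this i⟩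
  · intro hx
    obtain ⟨y, hy⟩ := hM.nonempty_iInter hκ hI (D := fun i => {y | (x, y) ∈ D i})
      (fun i => DefSet.preimage (f := fun y => (x, y)) (by fun_prop) (hD i))
      (fun s => by
        obtain ⟨y, hy⟩ := hx s
        exact ⟨y, Set.mem_iInter₂.mpr hy⟩)
    refine ⟨y, ?_⟩
    have : (x, y) ∈ {p : X × Y | φ p.1 p.2} := by
      rw [hS]; exact Set.mem_iInter.mpr fun i => Set.mem_iInter.mp hy i
    exact this

theorem IsSaturated.exists_finset_disjoint (hM : IsSaturated L M κ) (hκ : Cardinal.aleph0 ≤ κ)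
    {I : Type w} (hI : Cardinal.mk I < κ) {D : I → Set X} (hD : ∀ i, DefSet L M (D i))
    {T : Set X} (hT : TDef L M κ T) (h : ∀ x, (∀ i, x ∈ D i) → x ∉ T) :
    ∃ s : Finset I, ∀ x, (∀ i ∈ s, x ∈ D i) → x ∉ T := by
  classical
  obtain ⟨J, E, hJ, hE, rfl⟩ := hT
  by_contra! hcon
  obtain ⟨x, hx⟩ := hM.nonempty_iInter hκ (I := I ⊕ J) (D := Sum.elim D E)
    (by
      rw [Cardinal.mk_sum, Cardinal.lift_id, Cardinal.lift_id]
      exact Cardinal.add_lt_of_lt hκ hI hJ)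
    (by rintro (i | j) <;> simp [hD, hE])
    (fun s => by
      obtain ⟨x, hx, hx'⟩ := hcon s.toLeft
      refine ⟨x, Set.mem_iInter₂.mpr ?_⟩
      rintro (i | j) hi
      · exact hx i (by simpa using hi)
      · exact Set.mem_iInter.mp hx' j)
  rw [Set.mem_iInter] at hx
  exact h x (fun i => hx (.inl i)) (Set.mem_iInter.mpr fun j => hx (.inr j))

/-- By compactness, finitely many of the sets that cut out `S` already avoid the complement. -/
theorem TDef.defSet (hM : IsSaturated L M κ) (hκ : Cardinal.aleph0 ≤ κ) {S : Set X}
    (hS : TDef L M κ S) (hS' : TDef L M κ Sᶜ) : DefSet L M S := by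
  obtain ⟨I, D, hI, hD, rfl⟩ := hS
  obtain ⟨s, hs⟩ := hM.exists_finset_disjoint hκ hI hD hS' fun x hx => by simpa using hx
  refine (congrArg (DefSet L M) ?_).mp (DefSet.forall_finset s (φ := fun i x => x ∈ D i)
    fun i _ => hD i)
  ext x
  exact ⟨fun hx => by simpa using hs x hx, fun hx i _ => Set.mem_iInter.mp hx i⟩

/-- A function with a type-definable graph is definable. -/
theorem DefFun.of_tdef (hM : IsSaturated L M κ) (hκ : Cardinal.aleph0 ≤ κ) {f : X → Y}
    (hf : TDef L M κ {p : X × Y | f p.1 = p.2}) : DefFun L M f := by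
  refine TDef.defSet hM hκ hf ?_
  -- The complement of a graph is a projection of the graph itself, so it is type-definable too.
  have : TDef L M κ {p : X × Y | ∃ y, f p.1 = y ∧ y ≠ p.2} := by
    refine TDef.ex hM hκ (TDef.and hκ ?_ ?_)
    · exact TDef.preimage (f := fun q : (X × Y) × Y => (q.1.1, q.2)) (by fun_prop) hf
    · exact DefSet.tdef hκ (DefSet.not (DefSet.eq (by fun_prop) (by fun_prop)))
  refine (congrArg (TDef L M κ) ?_).mp this
  ext p
  simp

end Compactness

end FinDim

namespace FinDim

/-! ### Dimension of definable subsets of coded types -/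

section ToSort

variable {L : FirstOrder.Language.{u, v}} {M : Type w} [L.Structure M]

variable (L M) in
/-- The imaginary sort of a coded type. The tuples that are not codes form an additional element. -/
noncomputable def Coded.toSort (X : Type*) [Coded L M X] :
    ImagSort L M (Nat.card (Coded.idx L M X)) where
  toSetoid :=
    { r := fun a b =>
        ∀ x : X, Coded.Code L (a ∘ Finite.equivFin _) x ↔ Coded.Code L (b ∘ Finite.equivFin _) x
      iseqv := ⟨fun _ _ => Iff.rfl, fun h x => (h x).symm, fun h h' x => (h x).trans (h' x)⟩ }
  definable' := by
    have h1 := (Coded.definable_code (L := L) (M := M) (X := X)).preimage_comp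
      (Sum.map (Finite.equivFin _) (Finite.equivFin _))
    have h2 := (DefSet.univ (L := L) (M := M) (X := X)).preimage_comp
      (Sum.inl ∘ Finite.equivFin _ : _ → Fin (Nat.card (Coded.idx L M X)) ⊕ Fin (Nat.card (Coded.idx L M X)))
    have h3 := (DefSet.univ (L := L) (M := M) (X := X)).preimage_comp
      (Sum.inr ∘ Finite.equivFin _ : _ → Fin (Nat.card (Coded.idx L M X)) ⊕ Fin (Nat.card (Coded.idx L M X)))
    refine DefAbGroup.definable_of_eq (h1.union (h2.compl.inter h3.compl)) ?_
    ext p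
    constructor
    · intro h
      by_cases hx : ∃ x : X, Coded.Code L ((p ∘ Sum.inl) ∘ Finite.equivFin _) x
      · obtain ⟨x, hx⟩ := hx
        exact Or.inl ⟨x, hx, (h x).mp hx⟩
      · refine Or.inr ⟨?_, ?_⟩
        · rintro ⟨x, -, hx'⟩
          exact hx ⟨x, hx'⟩
        · rintro ⟨x, -, hx'⟩
          exact hx ⟨x, (h x).mpr hx'⟩
    · rintro (⟨x, hx, hx'⟩ | ⟨h, h'⟩) y
      · constructor
        · intro hy
          rw [← Coded.code_unique hx hy]
          exact hx'
        · intro hy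
          rw [← Coded.code_unique hx' hy]
          exact hx
      · exact ⟨fun hy => (h ⟨y, trivial, hy⟩).elim, fun hy => (h' ⟨y, trivial, hy⟩).elim⟩

variable {X Y : Type*} [Coded L M X] [Coded L M Y]

variable (L M) in
/-- The inclusion of a coded type in its sort. -/
noncomputable def Coded.incl (x : X) : (Coded.toSort L M X).Elem :=
  (Coded.toSort L M X).cls
    ((Coded.exists_code (L := L) (M := M) x).choose ∘ (Finite.equivFin _).symm)

theorem Coded.cls_eq_incl {a : Fin (Nat.card (Coded.idx L M X)) → M} {x : X} :
    (Coded.toSort L M X).cls a = Coded.incl L M x ↔ Coded.Code L (a ∘ Finite.equivFin _) x := by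
  have hc := (Coded.exists_code (L := L) (M := M) x).choose_spec
  constructor
  · intro h
    refine (Quotient.exact h x).mpr ?_
    simpa [Function.comp_assoc] using hc
  · intro h
    refine Quotient.sound fun y => ?_
    rw [Function.comp_assoc, Equiv.symm_comp_self, Function.comp_id]
    constructor
    · intro hy
      rwa [← Coded.code_unique h hy]
    · intro hy
      rwa [← Coded.code_unique hc hy]

theorem Coded.incl_injective : Function.Injective (Coded.incl L M : X → _) := by
  intro x y h
  have hc := (Coded.exists_code (L := L) (M := M) x).choose_spec
  have := Coded.cls_eq_incl.mp h
  rw [Function.comp_assoc, Equiv.symm_comp_self, Function.comp_id] at this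
  exact Coded.code_unique hc this

theorem Coded.cls_mem_image {a : Fin (Nat.card (Coded.idx L M X)) → M} {S : Set X} :
    (Coded.toSort L M X).cls a ∈ Coded.incl L M '' S ↔ a ∘ Finite.equivFin _ ∈ codes L M S :=
  exists_congr fun _ => and_congr_right fun _ => eq_comm.trans Coded.cls_eq_incl

theorem DefSet.isDefinable {S : Set X} (hS : DefSet L M S) :
    (Coded.toSort L M X).IsDefinable (Coded.incl L M '' S) := by
  refine DefAbGroup.definable_of_eq (Set.Definable.preimage_comp (Finite.equivFin _) hS) ?_
  ext a
  exact Coded.cls_mem_image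

end ToSort

section Dimension

variable {L : FirstOrder.Language.{u, v}} {T : L.Theory} (D : DimensionFunction.{u, v, w} T)
  (M : FirstOrder.Language.Theory.ModelType.{u, v, w} T) {X Y : Type*} [Coded L M X] [Coded L M Y]

/-- The dimension of a subset of a coded type. -/
noncomputable def DimensionFunction.sdim (S : Set X) : WithBot ℕ :=
  D.dim M (Coded.toSort L M X) (Coded.incl L M '' S)

variable {D M}

theorem sdim_eq_zero_iff {S : Set X} (hS : DefSet L M S) :
    D.sdim M (S : Set X) = 0 ↔ S.Finite ∧ S.Nonempty := by
  rw [DimensionFunction.sdim, D.algebraicity _ _ _ hS.isDefinable,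
    Set.finite_image_iff Coded.incl_injective.injOn, Set.image_nonempty]

theorem sdim_union {S S' : Set X} (hS : DefSet L M S) (hS' : DefSet L M S') :
    D.sdim M (S ∪ S') = max (D.sdim M S) (D.sdim M S') := by
  rw [DimensionFunction.sdim, Set.image_union, D.union _ _ _ _ hS.isDefinable hS'.isDefinable]
  rfl

theorem sdim_mono {S S' : Set X} (hS : DefSet L M S) (hS' : DefSet L M S') (h : S ⊆ S') :
    D.sdim M S ≤ D.sdim M S' := by
  rw [← Set.union_eq_self_of_subset_left h, sdim_union hS hS']
  exact le_max_left _ _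

theorem sdim_nonneg {S : Set X} (hS : DefSet L M S) (h : S.Nonempty) : 0 ≤ D.sdim M S := by
  obtain ⟨x, hx⟩ := h
  rw [← (sdim_eq_zero_iff (D := D) (M := M) (DefSet.singleton x)).mpr
    ⟨Set.finite_singleton x, Set.singleton_nonempty x⟩]
  exact sdim_mono (DefSet.singleton x) hS (Set.singleton_subset_iff.mpr hx)

theorem exists_sdim_eq {S : Set X} (hS : DefSet L M S) (h : S.Nonempty) :
    ∃ n : ℕ, D.sdim M S = n := by
  have := sdim_nonneg (D := D) hS h
  cases hd : D.sdim M S with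
  | bot => rw [hd] at this; simp at this
  | coe n => exact ⟨n, rfl⟩

theorem one_le_sdim {S : Set X} (hS : DefSet L M S) (h : S.Infinite) :
    ((1 : ℕ) : WithBot ℕ) ≤ D.sdim M S := by
  obtain ⟨n, hn⟩ := exists_sdim_eq (D := D) hS h.nonempty
  have : n ≠ 0 := by
    rintro rfl
    exact h ((sdim_eq_zero_iff hS).mp hn).1
  rw [hn]
  exact_mod_cast Nat.one_le_iff_ne_zero.mpr this

/-- Only the restriction of `f` to `A` has to be definable, so `f` may be chosen arbitrarily
elsewhere. -/
theorem sdim_fibration {A : Set X} {B : Set Y} (hA : DefSet L M A) (hB : DefSet L M B)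
    {f : X → Y} (hf : DefSet L M {p : X × Y | p.1 ∈ A ∧ f p.1 = p.2}) (hAB : ∀ x ∈ A, f x ∈ B)
    (d : ℕ) (h : ∀ y ∈ B, (d : WithBot ℕ) ≤ D.sdim M {x | x ∈ A ∧ f x = y}) :
    D.sdim M B + (d : WithBot ℕ) ≤ D.sdim M A := by
  choose g hgA hg using fun a : Coded.incl L M '' A => a.2
  let F : Coded.incl L M '' A → Coded.incl L M '' B :=
    fun a => ⟨Coded.incl L M (f (g a)), Set.mem_image_of_mem _ (hAB _ (hgA a))⟩
  have hgi : ∀ x (hx : x ∈ A), g ⟨Coded.incl L M x, Set.mem_image_of_mem _ hx⟩ = x :=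
    fun x hx => Coded.incl_injective (hg _)
  refine D.fibration M _ _ _ _ hA.isDefinable hB.isDefinable F ?_ d ?_
  · refine DefAbGroup.definable_of_eq (Set.Definable.preimage_comp
      (Sum.map (Finite.equivFin _) (Finite.equivFin _)) hf) ?_
    ext p
    constructor
    · rintro ⟨x, hx, hx'⟩
      have e1 : Coded.Code L ((p ∘ Sum.inl) ∘ Finite.equivFin _) (g x) :=
        Coded.cls_eq_incl.mp (hx.symm.trans (hg x).symm)
      have e2 : Coded.Code L ((p ∘ Sum.inr) ∘ Finite.equivFin _) (f (g x)) :=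
        Coded.cls_eq_incl.mp hx'.symm
      exact ⟨(g x, f (g x)), ⟨hgA x, rfl⟩, e1, e2⟩
    · rintro ⟨⟨x, y⟩, ⟨hx, hxy⟩, h1, h2⟩
      have e1 : (Coded.toSort L M X).cls (p ∘ Sum.inl) = Coded.incl L M x :=
        Coded.cls_eq_incl.mpr h1
      have e2 : (Coded.toSort L M Y).cls (p ∘ Sum.inr) = Coded.incl L M y :=
        Coded.cls_eq_incl.mpr h2
      refine ⟨⟨Coded.incl L M x, Set.mem_image_of_mem _ hx⟩, e1.symm, ?_⟩
      have hxy : f x = y := hxy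
      change Coded.incl L M (f (g _)) = _
      rw [hgi x hx, hxy]
      exact e2.symm
  · rintro ⟨_, y, hy, rfl⟩
    convert h y hy using 1
    rw [DimensionFunction.sdim]
    congr 1
    ext a
    constructor
    · rintro ⟨b, hb, rfl⟩
      refine ⟨g b, ⟨hgA b, ?_⟩, hg b⟩
      exact Coded.incl_injective (congrArg Subtype.val hb)
    · rintro ⟨x, ⟨hx, rfl⟩, rfl⟩
      refine ⟨⟨Coded.incl L M x, Set.mem_image_of_mem _ hx⟩, Subtype.ext ?_, rfl⟩
      change Coded.incl L M (f (g _)) = _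
      rw [hgi x hx]

theorem sdim_image_le {A : Set X} (hA : DefSet L M A) {f : X → Y} (hf : DefFun L M f) :
    D.sdim M (f '' A) ≤ D.sdim M A := by
  have h1 : ∀ y, DefSet L M {x | x ∈ A ∧ f x = y} := fun y => hA.and (DefSet.eq hf (by fun_prop))
  have := sdim_fibration (D := D) hA (hA.image hf) (f := f)
    ((DefSet.preimage (f := Prod.fst) (by fun_prop) hA).and (DefSet.eq (by fun_prop) (by fun_prop)))
    (fun x hx => Set.mem_image_of_mem f hx) 0 (by
      rintro _ ⟨x, hx, rfl⟩
      exact sdim_nonneg (h1 _) ⟨x, hx, rfl⟩)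
  simpa using this

end Dimension

end FinDim

namespace FinDim

/-! ### Definable groups in coded types -/

section Groups

variable (L : FirstOrder.Language.{u, v}) (M : Type w) [L.Structure M]

/-- The addition of the coded group `X` is definable. -/
class DefAdd (X : Type*) [AddCommGroup X] [Coded L M X] : Prop where
  defFun_add : DefFun L M fun p : X × X => p.1 + p.2

variable {X Y Z : Type*} [AddCommGroup X] [Coded L M X]
  [AddCommGroup Y] [Coded L M Y] [Coded L M Z]

/-- Connected subgroups: those without a definable proper subgroup of finite index. -/
def IsConn (H : AddSubgroup X) : Prop :=
  ∀ K : AddSubgroup X, DefSet L M (K : Set X) → K ≤ H → K.IsFiniteRelIndex H → K = H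

variable {L M}

theorem defSet_bot : DefSet L M ((⊥ : AddSubgroup X) : Set X) := DefSet.singleton 0

theorem defSet_inf {H K : AddSubgroup X} (hH : DefSet L M (H : Set X))
    (hK : DefSet L M (K : Set X)) : DefSet L M ((H ⊓ K : AddSubgroup X) : Set X) := hH.inter hK

theorem defSet_ker {f : X →+ Y} (hf : DefFun L M f) : DefSet L M (f.ker : Set X) :=
  DefSet.eq (f := f) (g := fun _ => 0) hf (by fun_prop)

theorem defSet_comap {f : X →+ Y} (hf : DefFun L M f) {K : AddSubgroup Y}
    (hK : DefSet L M (K : Set Y)) : DefSet L M (K.comap f : Set X) := DefSet.preimage hf hK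

theorem defSet_map {f : X →+ Y} (hf : DefFun L M f) {K : AddSubgroup X}
    (hK : DefSet L M (K : Set X)) : DefSet L M (K.map f : Set Y) := DefSet.image hf hK

theorem isConn_bot : IsConn L M (⊥ : AddSubgroup X) := fun _ _ h _ => le_bot_iff.mp h

theorem IsConn.le_of_isFiniteRelIndex {H K : AddSubgroup X} (hH : IsConn L M H)
    (hHd : DefSet L M (H : Set X)) (hK : DefSet L M (K : Set X)) (h : K.IsFiniteRelIndex H) :
    H ≤ K := by
  have := hH (K ⊓ H) (defSet_inf hK hHd) inf_le_right
    ⟨by rw [AddSubgroup.inf_relIndex_right]; exact h.relIndex_ne_zero⟩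
  exact inf_eq_right.mp this

theorem IsConn.map {H : AddSubgroup X} (hH : IsConn L M H) (hHd : DefSet L M (H : Set X))
    {f : X →+ Y} (hf : DefFun L M f) : IsConn L M (H.map f) := by
  intro K hK hle hKi
  refine le_antisymm hle (AddSubgroup.map_le_iff_le_comap.mpr ?_)
  refine hH.le_of_isFiniteRelIndex hHd (defSet_comap hf hK) ⟨?_⟩
  rw [AddSubgroup.relIndex_comap]
  exact hKi.relIndex_ne_zero

theorem IsConn.sup {H K : AddSubgroup X} (hH : IsConn L M H) (hHd : DefSet L M (H : Set X))
    (hK : IsConn L M K) (hKd : DefSet L M (K : Set X)) : IsConn L M (H ⊔ K) := by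
  intro G hG hGle hGi
  refine le_antisymm hGle (sup_le ?_ ?_)
  · exact hH.le_of_isFiniteRelIndex hHd hG (AddSubgroup.isFiniteRelIndex_of_le_right (L := H ⊔ K) _ le_sup_left)
  · exact hK.le_of_isFiniteRelIndex hKd hG (AddSubgroup.isFiniteRelIndex_of_le_right (L := H ⊔ K) _ le_sup_right)

variable [DefAdd L M X]

@[fun_prop]
theorem DefFun.add {f g : Z → X} (hf : DefFun L M f) (hg : DefFun L M g) :
    DefFun L M fun z => f z + g z :=
  DefFun.comp (g := fun p : X × X => p.1 + p.2) DefAdd.defFun_add (hf.prodMk hg)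

@[fun_prop]
theorem DefFun.neg {f : Z → X} (hf : DefFun L M f) : DefFun L M fun z => -f z := by
  refine DefFun.comp (g := fun x : X => -x) (DefFun.of_graph (G := fun x y => x + y = 0)
    (DefSet.eq (by fun_prop) (by fun_prop)) fun x y => ?_) hf
  rw [neg_eq_iff_add_eq_zero]

@[fun_prop]
theorem DefFun.sub {f g : Z → X} (hf : DefFun L M f) (hg : DefFun L M g) :
    DefFun L M fun z => f z - g z := by
  simp only [sub_eq_add_neg]
  fun_prop

theorem defSet_sup {H K : AddSubgroup X} (hH : DefSet L M (H : Set X))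
    (hK : DefSet L M (K : Set X)) : DefSet L M ((H ⊔ K : AddSubgroup X) : Set X) := by
  have : DefSet L M {x : X | ∃ y : X, ∃ z : X, y ∈ (H : Set X) ∧ z ∈ (K : Set X) ∧ y + z = x} := by
    refine DefSet.ex (DefSet.ex (.and ?_ (.and ?_ (.eq ?_ ?_))))
    · exact DefSet.preimage (f := fun p : (X × X) × X => p.1.2) (by fun_prop) hH
    · exact DefSet.preimage (f := fun p : (X × X) × X => p.2) (by fun_prop) hK
    · fun_prop
    · fun_prop
  refine (congrArg (DefSet L M) ?_).mp this
  ext x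
  simp [AddSubgroup.mem_sup]

theorem finset_sup_def_conn {ι : Type*} (s : Finset ι) {W : ι → AddSubgroup X}
    (hd : ∀ i ∈ s, DefSet L M (W i : Set X)) (hc : ∀ i ∈ s, IsConn L M (W i)) :
    DefSet L M ((s.sup W : AddSubgroup X) : Set X) ∧ IsConn L M (s.sup W) := by
  classical
  induction s using Finset.induction_on with
  | empty => exact ⟨defSet_bot, isConn_bot⟩
  | insert a s ha ih =>
    rw [Finset.sup_insert]
    obtain ⟨h1, h2⟩ := ih (fun i hi => hd i (by simp [hi])) (fun i hi => hc i (by simp [hi]))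
    exact ⟨defSet_sup (hd a (by simp)) h1, (hc a (by simp)).sup (hd a (by simp)) h2 h1⟩

end Groups

/-! ### Dimension, kernels and subgroups of finite index -/

section GroupDim

variable {L : FirstOrder.Language.{u, v}} {T : L.Theory} (D : DimensionFunction.{u, v, w} T)
  {M : FirstOrder.Language.Theory.ModelType.{u, v, w} T} {X Y : Type*} [AddCommGroup X] [Coded L M X]

include D

/-- A nonempty family of definable subgroups has a member of maximal dimension. -/
theorem exists_sdim_max {P : AddSubgroup X → Prop} (hne : ∃ H, P H)
    (hP : ∀ H, P H → DefSet L M (H : Set X)) :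
    ∃ H, P H ∧ ∀ K, P K → D.sdim M (K : Set X) ≤ D.sdim M (H : Set X) := by
  obtain ⟨n, hn⟩ := exists_sdim_eq (D := D) (M := M) (S := (Set.univ : Set X)) DefSet.univ
    Set.univ_nonempty
  have hb : ∀ H, P H → ∃ m : ℕ, D.sdim M (H : Set X) = m ∧ m ≤ n := fun H hH => by
    obtain ⟨m, hm⟩ := exists_sdim_eq (D := D) (hP H hH) ⟨0, zero_mem _⟩
    refine ⟨m, hm, ?_⟩
    have := sdim_mono (D := D) (hP H hH) DefSet.univ (Set.subset_univ _)
    rw [hm, hn] at this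
    exact_mod_cast this
  classical
  let Q : ℕ → Prop := fun m => ∃ H, P H ∧ D.sdim M (H : Set X) = m
  obtain ⟨H₀, hH₀⟩ := hne
  obtain ⟨m₀, hm₀, hm₀n⟩ := hb H₀ hH₀
  obtain ⟨H, hH, hHd⟩ : Q (Nat.findGreatest Q n) :=
    Nat.findGreatest_spec (P := Q) hm₀n ⟨H₀, hH₀, hm₀⟩
  refine ⟨H, hH, fun K hK => ?_⟩
  obtain ⟨m, hm, hmn⟩ := hb K hK
  rw [hm, hHd]
  have := Nat.le_findGreatest (P := Q) hmn ⟨K, hK, hm⟩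
  exact_mod_cast this

theorem exists_sdim_min {P : AddSubgroup X → Prop} (hne : ∃ H, P H)
    (hP : ∀ H, P H → DefSet L M (H : Set X)) :
    ∃ H, P H ∧ ∀ K, P K → D.sdim M (H : Set X) ≤ D.sdim M (K : Set X) := by
  classical
  have hb : ∀ H, P H → ∃ m : ℕ, D.sdim M (H : Set X) = m := fun H hH =>
    exists_sdim_eq (D := D) (hP H hH) ⟨0, zero_mem _⟩
  have hex : ∃ m : ℕ, ∃ H, P H ∧ D.sdim M (H : Set X) = m := by
    obtain ⟨H, hH⟩ := hne
    obtain ⟨m, hm⟩ := hb H hH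
    exact ⟨m, H, hH, hm⟩
  obtain ⟨H, hH, hHd⟩ := Nat.find_spec hex
  refine ⟨H, hH, fun K hK => ?_⟩
  obtain ⟨m, hm⟩ := hb K hK
  rw [hm, hHd]
  exact_mod_cast Nat.find_min' hex ⟨K, hK, hm⟩

variable [DefAdd L M X]

theorem sdim_map_add_sdim_ker_le [AddCommGroup Y] [Coded L M Y] {f : X →+ Y} (hf : DefFun L M f)
    {G : AddSubgroup X} (hG : DefSet L M (G : Set X)) :
    D.sdim M (G.map f : Set Y) + D.sdim M ((f.ker ⊓ G : AddSubgroup X) : Set X) ≤ D.sdim M (G : Set X) := by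
  have hK := defSet_inf (defSet_ker hf) hG
  obtain ⟨n, hn⟩ := exists_sdim_eq (D := D) hK ⟨0, zero_mem _⟩
  rw [hn]
  refine sdim_fibration hG (defSet_map hf hG) (f := f)
    ((DefSet.preimage (f := Prod.fst) (by fun_prop) hG).and (DefSet.eq (by fun_prop) (by fun_prop)))
    (fun x hx => AddSubgroup.mem_map_of_mem f hx) n ?_
  rintro _ ⟨g, hg, rfl⟩
  rw [← hn]
  have h1 : DefSet L M {x | x ∈ (G : Set X) ∧ f x = f g} := hG.and (DefSet.eq hf (by fun_prop))
  -- The fibre over `f g` is a coset of `f.ker ⊓ G`; translation by `-g` shows that its dimension is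
  -- at least that of the subgroup.
  refine (sdim_mono hK (h1.image (f := fun x => x - g) (by fun_prop)) ?_).trans
    (sdim_image_le h1 (by fun_prop))
  rintro x ⟨hx, hx'⟩
  have hx : f x = 0 := hx
  exact ⟨x + g, ⟨G.add_mem hx' hg, by simp [hx]⟩, by simp⟩

/-- An infinite kernel has dimension at least 1, and the fibration inequality would give `dim X + 1
≤ dim X`. -/
theorem finite_ker_of_surjective {f : X →+ X} (hf : DefFun L M f) (h : Function.Surjective f) :
    (f.ker : Set X).Finite := by
  have hu : DefSet L M ((⊤ : AddSubgroup X) : Set X) := DefSet.univ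
  have h1 := sdim_map_add_sdim_ker_le D hf hu
  rw [AddSubgroup.map_top_of_surjective f h, inf_top_eq] at h1
  obtain ⟨n, hn⟩ := exists_sdim_eq (D := D) hu ⟨0, zero_mem _⟩
  by_contra hinf
  have h2 := (add_le_add_right (one_le_sdim (D := D) (defSet_ker hf) hinf) _).trans h1
  rw [hn] at h2
  have : n + 1 ≤ n := by exact_mod_cast h2
  omega

/-- The image of `G` in the interpretable quotient `X ⧸ H` is finite: otherwise its dimension is at
least 1, and `G` has dimension at least `1 + dim H`. The dimension of imaginaries is essential here.
-/
theorem isFiniteRelIndex_of_sdim_le {H G : AddSubgroup X} (hH : DefSet L M (H : Set X))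
    (hG : DefSet L M (G : Set X)) (hle : H ≤ G) (h : D.sdim M (G : Set X) ≤ D.sdim M (H : Set X)) :
    H.IsFiniteRelIndex G := by
  have hq : DefSet L M {p : X × X | QuotientAddGroup.mk' H p.1 = QuotientAddGroup.mk' H p.2} := by
    simp only [QuotientAddGroup.mk'_apply, QuotientAddGroup.eq]
    exact DefSet.preimage (f := fun p : X × X => -p.1 + p.2) (by fun_prop) hH
  let := Coded.ofSurjective (QuotientAddGroup.mk'_surjective H) hq
  have hf : DefFun L M (QuotientAddGroup.mk' H) := DefFun.ofSurjective _ hq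
  have h1 := sdim_map_add_sdim_ker_le D hf hG
  rw [QuotientAddGroup.ker_mk', inf_eq_left.mpr hle] at h1
  have hfin : (G.map (QuotientAddGroup.mk' H) : Set (X ⧸ H)).Finite := by
    by_contra hinf
    have h2 := ((add_le_add_left (one_le_sdim (D := D) (defSet_map hf hG) hinf) _).trans h1).trans h
    obtain ⟨n, hn⟩ := exists_sdim_eq (D := D) hH ⟨0, zero_mem _⟩
    rw [hn] at h2
    have : 1 + n ≤ n := by exact_mod_cast h2
    omega
  refine ⟨?_⟩
  have := AddSubgroup.relIndex_ker G (QuotientAddGroup.mk' H)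
  rw [QuotientAddGroup.ker_mk'] at this
  rw [this]
  have := hfin.to_subtype
  have : Finite (G.map (QuotientAddGroup.mk' H)) := this
  exact Nat.card_pos.ne'

/-- This plays the part of a chain condition: extremal dimension forces equality of connected
groups. -/
theorem IsConn.eq_of_le_of_sdim_le {H G : AddSubgroup X} (hc : IsConn L M G)
    (hH : DefSet L M (H : Set X)) (hG : DefSet L M (G : Set X)) (hle : H ≤ G)
    (h : D.sdim M (G : Set X) ≤ D.sdim M (H : Set X)) : H = G :=
  hc H hH hle (isFiniteRelIndex_of_sdim_le D hH hG hle h)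

end GroupDim

end FinDim

namespace FinDim

/-! ### Uniformly type-definable families of endomorphisms -/

section Families

variable {L : FirstOrder.Language.{u, v}} {M : Type w} [L.Structure M] {κ : Cardinal.{w}}
variable {X W : Type*} [AddCommGroup X] [Coded L M X] [Coded L M W]

variable (L M κ) in
/-- A uniformly definable family of endomorphisms over a type-definable set of parameters. -/
def UnifTDef (F : Set (AddMonoid.End X)) : Prop :=
  ∃ (C : Type w) (_ : Coded L M C) (P : Set C) (ev : C → X → X → Prop), TDef L M κ P ∧
    DefSet L M {p : C × (X × X) | ev p.1 p.2.1 p.2.2} ∧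
    (∀ c ∈ P, ∃ f ∈ F, ∀ x y, ev c x y ↔ f x = y) ∧
    (∀ f ∈ F, ∃ c ∈ P, ∀ x y, ev c x y ↔ f x = y)

variable (hM : IsSaturated L M κ) (hκ : Cardinal.aleph0 ≤ κ) {F : Set (AddMonoid.End X)}

include hM hκ

/-- Quantifying over `F` amounts to quantifying over the parameters in `P`. Two arguments are
allowed because both must be evaluated at the same `f`. -/
theorem UnifTDef.ex (hF : UnifTDef L M κ F) {a b : W → X} (ha : DefFun L M a) (hb : DefFun L M b)
    {φ : W → X → X → Prop} (hφ : TDef L M κ {q : W × (X × X) | φ q.1 q.2.1 q.2.2}) :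
    TDef L M κ {x | ∃ f ∈ F, φ x (f (a x)) (f (b x))} := by
  obtain ⟨C, _, P, ev, hP, hev, h1, h2⟩ := hF
  have : TDef L M κ {x : W | ∃ c : C, c ∈ P ∧ ∃ y : X, ∃ z : X,
      ev c (a x) y ∧ ev c (b x) z ∧ φ x y z} := by
    refine TDef.ex hM hκ (TDef.and hκ (TDef.preimage (f := Prod.snd) (by fun_prop) hP)
      (TDef.ex hM hκ (TDef.ex hM hκ (TDef.and hκ ?_ (TDef.and hκ ?_ ?_)))))
    · exact (DefSet.preimage (f := fun p : ((W × C) × X) × X => (p.1.1.2, (a p.1.1.1, p.1.2)))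
        (by fun_prop) hev).tdef hκ
    · exact (DefSet.preimage (f := fun p : ((W × C) × X) × X => (p.1.1.2, (b p.1.1.1, p.2)))
        (by fun_prop) hev).tdef hκ
    · exact TDef.preimage (f := fun p : ((W × C) × X) × X => (p.1.1.1, (p.1.2, p.2)))
        (by fun_prop) hφ
  refine (congrArg (TDef L M κ) ?_).mp this
  ext x
  constructor
  · rintro ⟨c, hc, y, z, hy, hz, h⟩
    obtain ⟨f, hf, hfe⟩ := h1 c hc
    rw [hfe] at hy hz
    subst hy hz
    exact ⟨f, hf, h⟩
  · rintro ⟨f, hf, h⟩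
    obtain ⟨c, hc, hfe⟩ := h2 f hf
    exact ⟨c, hc, _, _, (hfe _ _).mpr rfl, (hfe _ _).mpr rfl, h⟩

omit hM in
-- Differences are parametrised by pairs of parameters; `f ≠ f'` is a definable condition because it
-- is witnessed at a point.
theorem UnifTDef.sub_ne [DefAdd L M X] (hF : UnifTDef L M κ F) :
    UnifTDef L M κ {g | ∃ f ∈ F, ∃ f' ∈ F, f ≠ f' ∧ g = f - f'} := by
  obtain ⟨C, _, P, ev, hP, hev, h1, h2⟩ := hF
  refine ⟨C × C, inferInstance, {c | c.1 ∈ P ∧ c.2 ∈ P ∧ ∃ x y y', ev c.1 x y ∧ ev c.2 x y' ∧ y ≠ y'},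
    fun c x y => ∃ y₁ y₂, ev c.1 x y₁ ∧ ev c.2 x y₂ ∧ y = y₁ - y₂, ?_, ?_, ?_, ?_⟩
  · refine TDef.and hκ (TDef.preimage (f := Prod.fst) (by fun_prop) hP)
      (TDef.and hκ (TDef.preimage (f := Prod.snd) (by fun_prop) hP) (DefSet.tdef hκ ?_))
    refine DefSet.ex (DefSet.ex (DefSet.ex (.and ?_ (.and ?_ (.not (.eq ?_ ?_))))))
    · exact DefSet.preimage (f := fun p : (((C × C) × X) × X) × X => (p.1.1.1.1, (p.1.1.2, p.1.2)))
        (by fun_prop) hev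
    · exact DefSet.preimage (f := fun p : (((C × C) × X) × X) × X => (p.1.1.1.2, (p.1.1.2, p.2)))
        (by fun_prop) hev
    · fun_prop
    · fun_prop
  · refine DefSet.ex (DefSet.ex (.and ?_ (.and ?_ (.eq ?_ ?_))))
    · exact DefSet.preimage (f := fun p : (((C × C) × (X × X)) × X) × X =>
        (p.1.1.1.1, (p.1.1.2.1, p.1.2))) (by fun_prop) hev
    · exact DefSet.preimage (f := fun p : (((C × C) × (X × X)) × X) × X =>
        (p.1.1.1.2, (p.1.1.2.1, p.2))) (by fun_prop) hev
    · fun_prop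
    · fun_prop
  · rintro ⟨c, c'⟩ ⟨hc, hc', x, y, y', h, h', hne⟩
    obtain ⟨f, hf, hfe⟩ := h1 c hc
    obtain ⟨f', hf', hfe'⟩ := h1 c' hc'
    refine ⟨f - f', ⟨f, hf, f', hf', ?_, rfl⟩, fun x y => ?_⟩
    · rintro rfl
      exact hne (((hfe _ _).mp h).symm.trans ((hfe' _ _).mp h'))
    · simp only [hfe, hfe']
      constructor
      · rintro ⟨_, _, rfl, rfl, rfl⟩
        rfl
      · rintro rfl
        exact ⟨_, _, rfl, rfl, rfl⟩
  · rintro _ ⟨f, hf, f', hf', hne, rfl⟩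
    obtain ⟨c, hc, hfe⟩ := h2 f hf
    obtain ⟨c', hc', hfe'⟩ := h2 f' hf'
    refine ⟨(c, c'), ⟨hc, hc', ?_⟩, fun x y => ?_⟩
    · obtain ⟨x, hx⟩ := DFunLike.ne_iff.mp hne
      exact ⟨x, f x, f' x, (hfe _ _).mpr rfl, (hfe' _ _).mpr rfl, hx⟩
    · simp only [hfe, hfe']
      constructor
      · rintro ⟨_, _, rfl, rfl, rfl⟩
        rfl
      · rintro rfl
        exact ⟨_, _, rfl, rfl, rfl⟩

omit hM hκ

/-- The sums `∑ fᵢ aᵢ` with `fᵢ ∈ F`. -/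
def famSums (F : Set (AddMonoid.End X)) : List X → Set X
  | [] => {0}
  | a :: l => {z | ∃ f ∈ F, ∃ z' ∈ famSums F l, z = f a + z'}

/-- The pairs `(∑ fᵢ aᵢ, ∑ fᵢ (φ x aᵢ))` with `fᵢ ∈ F`. -/
def famGraph (F : Set (AddMonoid.End X)) (φ : W → AddMonoid.End X) : List X → W → X → X → Prop
  | [], _, z, z' => z = 0 ∧ z' = 0
  | a :: l, x, z, z' => ∃ f ∈ F, famGraph F φ l x (z - f a) (z' - f (φ x a))

/-- The sums `∑ fᵢ aᵢ` with `fᵢ ∈ F` determine the `fᵢ`. -/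
def FamIndep (F : Set (AddMonoid.End X)) : List X → Prop
  | [] => True
  | a :: l => FamIndep F l ∧ ∀ f ∈ F, ∀ f' ∈ F, f ≠ f' →
      ∀ z ∈ famSums F l, ∀ z' ∈ famSums F l, f a + z ≠ f' a + z'

omit [Coded L M X] [Coded L M W] in
-- Commutation with `F` gives `φ x (∑ fᵢ aᵢ) = ∑ fᵢ (φ x aᵢ)`, so `famGraph` is contained in the
-- graph of `φ x`; conversely, `famGraph_of_mem` shows that it covers the sums over `l`.
theorem eq_of_famGraph {φ : W → AddMonoid.End X}
    (hφ : ∀ x, ∀ f ∈ F, ∀ a, φ x (f a) = f (φ x a)) {l : List X} {x : W} {z z' : X}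
    (h : famGraph F φ l x z z') : z' = φ x z := by
  induction l generalizing z z' with
  | nil =>
    obtain ⟨rfl, rfl⟩ := h
    simp
  | cons a l ih =>
    obtain ⟨f, hf, h⟩ := h
    have := ih h
    rw [map_sub, hφ x f hf] at this
    exact sub_left_injective this

omit [Coded L M X] [Coded L M W] in
theorem famGraph_of_mem {φ : W → AddMonoid.End X}
    (hφ : ∀ x, ∀ f ∈ F, ∀ a, φ x (f a) = f (φ x a)) {l : List X} {x : W} {z : X}
    (h : z ∈ famSums F l) : famGraph F φ l x z (φ x z) := by
  induction l generalizing z with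
  | nil =>
    obtain rfl : z = 0 := h
    exact ⟨rfl, map_zero _⟩
  | cons a l ih =>
    obtain ⟨f, hf, z', hz', rfl⟩ := h
    refine ⟨f, hf, ?_⟩
    rw [add_sub_cancel_left, map_add, hφ x f hf, add_sub_cancel_left]
    exact ih hz'

include hM hκ

/-- Only the finitely many values `φ x a` with `a` in `l` occur, so definability of `φ` in `x` for
each fixed `a` suffices. -/
theorem tdef_famGraph [DefAdd L M X] (hF : UnifTDef L M κ F) {φ : W → AddMonoid.End X}
    (hφ : ∀ a, DefFun L M fun x => φ x a) (l : List X) :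
    TDef L M κ {p : W × (X × X) | famGraph F φ l p.1 p.2.1 p.2.2} := by
  induction l with
  | nil =>
    exact DefSet.tdef hκ ((DefSet.eq (f := fun p : W × (X × X) => p.2.1) (g := fun _ => 0)
      (by fun_prop) (by fun_prop)).and (.eq (by fun_prop) (by fun_prop)))
  | cons a l ih =>
    have hφa := hφ a
    exact UnifTDef.ex hM hκ hF (a := fun _ : W × (X × X) => a) (b := fun p => φ p.1 a)
      (φ := fun p y z => famGraph F φ l p.1 (p.2.1 - y) (p.2.2 - z)) (by fun_prop) (by fun_prop)
      (TDef.preimage (f := fun q : (W × (X × X)) × (X × X) =>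
        (q.1.1, (q.1.2.1 - q.2.1, q.1.2.2 - q.2.2))) (by fun_prop) ih)

theorem tdef_famSums [DefAdd L M X] (hF : UnifTDef L M κ F) (l : List X) :
    TDef L M κ (famSums F l) := by
  induction l with
  | nil => exact DefSet.tdef hκ (DefSet.singleton 0)
  | cons a l ih =>
    refine UnifTDef.ex hM hκ hF (a := fun _ : X => a) (b := fun _ => a)
      (φ := fun z y _ => ∃ z' ∈ famSums F l, z = y + z') (by fun_prop) (by fun_prop) ?_
    refine TDef.ex hM hκ (φ := fun (q : X × (X × X)) z' => z' ∈ famSums F l ∧ q.1 = q.2.1 + z')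
      (TDef.and hκ ?_ (DefSet.tdef hκ (DefSet.eq ?_ ?_)))
    · exact TDef.preimage (f := Prod.snd) (by fun_prop) ih
    · fun_prop
    · fun_prop

theorem tdef_famOrbit (hF : UnifTDef L M κ F) (a : X) : TDef L M κ {z | ∃ f ∈ F, z = f a} :=
  UnifTDef.ex hM hκ hF (a := fun _ : X => a) (b := fun _ => a)
    (φ := fun z y _ => z = y) (by fun_prop) (by fun_prop)
    (DefSet.tdef hκ (DefSet.eq (by fun_prop) (by fun_prop)))

/-- Type-definable sets with a direct sum that is contained in a definable set `Z` are contained in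
definable sets with the same property. -/
theorem exists_defSet_directSum [DefAdd L M X] {A B Z : Set X} (hA : TDef L M κ A)
    (hB : TDef L M κ B) (hZ : DefSet L M Z) (hAB : ∀ a ∈ A, ∀ b ∈ B, a + b ∈ Z)
    (hdir : ∀ a ∈ A, ∀ a' ∈ A, ∀ b ∈ B, ∀ b' ∈ B, a + b = a' + b' → b = b') :
    ∃ A' B' : Set X, DefSet L M A' ∧ DefSet L M B' ∧ A ⊆ A' ∧ B ⊆ B' ∧
      (∀ a ∈ A', ∀ b ∈ B', a + b ∈ Z) ∧
      ∀ a ∈ A', ∀ a' ∈ A', ∀ b ∈ B', ∀ b' ∈ B', a + b = a' + b' → b = b' := by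
  classical
  obtain ⟨I, D, hI, hD, rfl⟩ := hA
  obtain ⟨J, E, hJ, hE, rfl⟩ := hB
  -- For `p = ((a, a'), (b, b'))` this collects both failures: `a + b` outside `Z`, or two
  -- decompositions of one sum with distinct second terms.
  have hbad : DefSet L M {p : (X × X) × (X × X) |
      p.1.1 + p.2.1 ∈ Z → p.1.1 + p.2.1 = p.1.2 + p.2.2 ∧ p.2.1 ≠ p.2.2} := by
    refine DefSet.imp ?_ (.and (.eq ?_ ?_) (.not (.eq ?_ ?_)))
    · exact DefSet.preimage (f := fun p : (X × X) × (X × X) => p.1.1 + p.2.1) (by fun_prop) hZ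
    all_goals fun_prop
  obtain ⟨s, hs⟩ := hM.exists_finset_disjoint hκ (I := I ⊕ J)
    (D := Sum.elim (fun i => {p : (X × X) × (X × X) | p.1.1 ∈ D i ∧ p.1.2 ∈ D i})
      (fun j => {p : (X × X) × (X × X) | p.2.1 ∈ E j ∧ p.2.2 ∈ E j}))
    (by
      rw [Cardinal.mk_sum, Cardinal.lift_id, Cardinal.lift_id]
      exact Cardinal.add_lt_of_lt hκ hI hJ)
    (by
      rintro (i | j)
      · exact (DefSet.preimage (f := fun p : (X × X) × (X × X) => p.1.1) (by fun_prop) (hD i)).and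
          (DefSet.preimage (f := fun p : (X × X) × (X × X) => p.1.2) (by fun_prop) (hD i))
      · exact (DefSet.preimage (f := fun p : (X × X) × (X × X) => p.2.1) (by fun_prop) (hE j)).and
          (DefSet.preimage (f := fun p : (X × X) × (X × X) => p.2.2) (by fun_prop) (hE j)))
    (DefSet.tdef hκ hbad)
    (by
      rintro ⟨⟨a, a'⟩, ⟨b, b'⟩⟩ h hb
      have ha : ∀ i, a ∈ D i ∧ a' ∈ D i := fun i => h (.inl i)
      have hb' : ∀ j, b ∈ E j ∧ b' ∈ E j := fun j => h (.inr j)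
      obtain ⟨h1, h2⟩ := hb (hAB a (Set.mem_iInter.mpr fun i => (ha i).1) b
        (Set.mem_iInter.mpr fun i => (hb' i).1))
      exact h2 (hdir a (Set.mem_iInter.mpr fun i => (ha i).1) a'
        (Set.mem_iInter.mpr fun i => (ha i).2) b (Set.mem_iInter.mpr fun i => (hb' i).1) b'
        (Set.mem_iInter.mpr fun i => (hb' i).2) h1))
  have hs' : ∀ a ∈ {x | ∀ i ∈ s.toLeft, x ∈ D i}, ∀ a' ∈ {x | ∀ i ∈ s.toLeft, x ∈ D i},
      ∀ b ∈ {x | ∀ j ∈ s.toRight, x ∈ E j}, ∀ b' ∈ {x | ∀ j ∈ s.toRight, x ∈ E j},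
      ¬ (a + b ∈ Z → a + b = a' + b' ∧ b ≠ b') := by
    intro a ha a' ha' b hb b' hb'
    refine hs ((a, a'), (b, b')) ?_
    rintro (i | j) h
    · exact ⟨ha i (by simpa using h), ha' i (by simpa using h)⟩
    · exact ⟨hb j (by simpa using h), hb' j (by simpa using h)⟩
  refine ⟨{x | ∀ i ∈ s.toLeft, x ∈ D i}, {x | ∀ j ∈ s.toRight, x ∈ E j},
    DefSet.forall_finset _ fun i _ => hD i, DefSet.forall_finset _ fun j _ => hE j,
    fun x hx i _ => Set.mem_iInter.mp hx i, fun x hx i _ => Set.mem_iInter.mp hx i, ?_, ?_⟩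
  · intro a ha b hb
    -- Taking the same pair twice excludes the second failure and leaves `a + b ∈ Z`.
    have := hs' a ha a ha b hb b hb
    tauto
  · intro a ha a' ha' b hb b' hb' h
    have := hs' a ha a' ha' b hb b' hb'
    tauto

end Families

/-! ### Dimension bounds for independent lists, and definability of commuting maps -/

section FamDim

variable {L : FirstOrder.Language.{u, v}} {T : L.Theory} (D : DimensionFunction.{u, v, w} T)
  {M : FirstOrder.Language.Theory.ModelType.{u, v, w} T} {κ : Cardinal.{w}}
  (hM : IsSaturated L M κ) (hκ : Cardinal.aleph0 ≤ κ)
  {X W : Type*} [AddCommGroup X] [Coded L M X] [DefAdd L M X] [Coded L M W]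
  {F : Set (AddMonoid.End X)}

/-- The second summand is a well-defined map from `A + B` onto `B`, and its fibres are translates of
the infinite set `A`. -/
theorem sdim_add_one_le {A B Z : Set X} (hA : DefSet L M A) (hB : DefSet L M B)
    (hZ : DefSet L M Z) (hAB : ∀ a ∈ A, ∀ b ∈ B, a + b ∈ Z)
    (hdir : ∀ a ∈ A, ∀ a' ∈ A, ∀ b ∈ B, ∀ b' ∈ B, a + b = a' + b' → b = b') (hinf : A.Infinite) :
    D.sdim M B + ((1 : ℕ) : WithBot ℕ) ≤ D.sdim M Z := by
  classical
  have hG : DefSet L M {p : X × X | ∃ a, a ∈ A ∧ p.2 ∈ B ∧ a + p.2 = p.1} := by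
    refine DefSet.ex (.and ?_ (.and ?_ (.eq ?_ ?_)))
    · exact DefSet.preimage (f := Prod.snd) (by fun_prop) hA
    · exact DefSet.preimage (f := fun q : (X × X) × X => q.1.2) (by fun_prop) hB
    all_goals fun_prop
  have hS : DefSet L M {x | ∃ b, ∃ a, a ∈ A ∧ b ∈ B ∧ a + b = x} := DefSet.ex hG
  choose! f hf using fun x (hx : ∃ b, ∃ a, a ∈ A ∧ b ∈ B ∧ a + b = x) => hx
  have hfu : ∀ a ∈ A, ∀ b ∈ B, f (a + b) = b := fun a ha b hb => by
    obtain ⟨a', ha', hb', h⟩ := hf _ ⟨b, a, ha, hb, rfl⟩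
    exact hdir a' ha' a ha _ hb' b hb h
  refine (sdim_fibration (f := f) hS hB ?_ ?_ 1 ?_).trans (sdim_mono hS hZ ?_)
  · refine (congrArg (DefSet L M) ?_).mp hG
    ext ⟨x, b⟩
    constructor
    · rintro ⟨a, ha, hb, h⟩
      have h : a + b = x := h
      subst h
      exact ⟨⟨b, a, ha, hb, rfl⟩, hfu a ha b hb⟩
    · rintro ⟨hx, h⟩
      have h : f x = b := h
      subst h
      exact hf x hx
  · intro x hx
    obtain ⟨_, -, h, -⟩ := hf x hx
    exact h
  · intro b hb
    refine (one_le_sdim (hA.image (f := fun a => a + b) (by fun_prop))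
      (hinf.image (add_left_injective b).injOn)).trans (sdim_mono
        (hA.image (f := fun a => a + b) (by fun_prop)) ?_ ?_)
    · refine (congrArg (DefSet L M) ?_).mp (hA.image (f := fun a => a + b) (by fun_prop))
      ext x
      constructor
      · rintro ⟨a, ha, rfl⟩
        exact ⟨⟨b, a, ha, hb, rfl⟩, hfu a ha b hb⟩
      · rintro ⟨hx, rfl⟩
        obtain ⟨a, ha, -, h⟩ := hf x hx
        exact ⟨a, ha, h⟩
    · rintro _ ⟨a, ha, rfl⟩
      exact ⟨⟨b, a, ha, hb, rfl⟩, hfu a ha b hb⟩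
  · rintro _ ⟨b, a, ha, hb, rfl⟩
    exact hAB a ha b hb

include D hM hκ

/-- Each entry `a` contributes an infinite orbit `F a`, in direct sum with the sums over the tail.
These sets are only type-definable, so compactness enlarges them to definable `A` and `B`. The
induction varies `Z` because `B` replaces it for the tail. -/
theorem FamIndep.length_le_sdim (hF : UnifTDef L M κ F) (hinf : F.Infinite) {l : List X}
    (hl : FamIndep F l) {Z : Set X} (hZ : DefSet L M Z) (h : famSums F l ⊆ Z) :
    (l.length : WithBot ℕ) ≤ D.sdim M Z := by
  induction l generalizing Z with
  | nil => exact sdim_nonneg hZ ⟨0, h rfl⟩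
  | cons a l ih =>
    obtain ⟨hl, ha⟩ := hl
    have hne : ∀ l : List X, (famSums F l).Nonempty := by
      intro l
      induction l with
      | nil => exact ⟨0, rfl⟩
      | cons a l ih =>
        obtain ⟨z, hz⟩ := ih
        obtain ⟨f, hf⟩ := hinf.nonempty
        exact ⟨f a + z, f, hf, z, hz, rfl⟩
    obtain ⟨A, B, hA, hB, hYA, hZB, hAB, hdir⟩ := exists_defSet_directSum hM hκ
      (tdef_famOrbit hM hκ hF a) (tdef_famSums hM hκ hF l) hZ
      (by
        rintro _ ⟨f, hf, rfl⟩ z hz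
        exact h ⟨f, hf, z, hz, rfl⟩)
      (by
        rintro _ ⟨f, hf, rfl⟩ _ ⟨f', hf', rfl⟩ z hz z' hz' heq
        by_contra hzz
        refine ha f hf f' hf' ?_ z hz z' hz' heq
        rintro rfl
        exact hzz (add_left_cancel heq))
    have hAinf : A.Infinite := by
      obtain ⟨z, hz⟩ := hne l
      refine (hinf.image (f := fun f => f a) ?_).mono ?_
      · intro f hf f' hf' h
        by_contra hff
        exact ha f hf f' hf' hff z hz z hz (congrArg (· + z) h)
      · rintro _ ⟨f, hf, rfl⟩
        exact hYA ⟨f, hf, rfl⟩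
    have := (add_le_add_left (ih hl hB hZB) _).trans (sdim_add_one_le D hA hB hZ hAB hdir hAinf)
    rw [List.length_cons]
    exact_mod_cast this

/-- For a list `l` of maximal length, adjoining `x` destroys independence, and the collision that
appears is a relation `(f - f') x = z - z'`. -/
theorem exists_maximal_famIndep (hF : UnifTDef L M κ F) (hinf : F.Infinite) :
    ∃ n : ℕ, ∃ l : List X, (∀ l', FamIndep F l' → l'.length ≤ n) ∧ ∀ x : X,
      ∃ f ∈ F, ∃ f' ∈ F, f ≠ f' ∧ ∃ z ∈ famSums F l, ∃ z' ∈ famSums F l, (f - f') x = z - z' := by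
  classical
  obtain ⟨n, hn⟩ := exists_sdim_eq (D := D) (M := M) (S := (Set.univ : Set X)) DefSet.univ
    Set.univ_nonempty
  have hb : ∀ l : List X, FamIndep F l → l.length ≤ n := fun l hl => by
    have := hl.length_le_sdim D hM hκ hF hinf DefSet.univ (Set.subset_univ _)
    rw [hn] at this
    exact_mod_cast this
  let Q : ℕ → Prop := fun m => ∃ l : List X, FamIndep F l ∧ l.length = m
  obtain ⟨l, hl, hlen⟩ : Q (Nat.findGreatest Q n) :=
    Nat.findGreatest_spec (P := Q) (Nat.zero_le n) ⟨[], trivial, rfl⟩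
  refine ⟨n, l, hb, fun x => ?_⟩
  by_contra! hcon
  have hxl : FamIndep F (x :: l) := by
    refine ⟨hl, fun f hf f' hf' hne z hz z' hz' h => hcon f hf f' hf' hne z' hz' z hz ?_⟩
    change f x - f' x = z' - z
    rw [sub_eq_sub_iff_add_eq_add, h, add_comm]
  have := Nat.le_findGreatest (P := Q) (hb _ hxl) ⟨_, hxl, rfl⟩
  rw [List.length_cons, hlen] at this
  omega

/-- A uniform family of endomorphisms that commute with `F` is definable. -/
theorem defFun_of_commute (hF : UnifTDef L M κ F) (hinf : F.Infinite)
    (hinj : ∀ f ∈ F, ∀ f' ∈ F, f ≠ f' → Function.Injective (f - f')) {φ : W → AddMonoid.End X}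
    (hφ : ∀ a, DefFun L M fun x => φ x a) (hc : ∀ x, ∀ f ∈ F, ∀ a, φ x (f a) = f (φ x a)) :
    DefFun L M fun p : W × X => φ p.1 p.2 := by
  obtain ⟨-, l, -, hl⟩ := exists_maximal_famIndep D hM hκ hF hinf
  refine DefFun.of_tdef hM hκ ?_
  have hg := tdef_famGraph hM hκ hF hφ l
  -- Every `a` satisfies `(f - f') a = z - z'` with sums `z`, `z'` over `l`. Applying `φ x` gives
  -- `(f - f') (φ x a) = φ x z - φ x z'`, which determines `φ x a` since `f - f'` is injective.
  have : TDef L M κ {p : (W × X) × X | ∃ g ∈ {g | ∃ f ∈ F, ∃ f' ∈ F, f ≠ f' ∧ g = f - f'},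
      ∃ q : (X × X) × (X × X), famGraph F φ l p.1.1 q.1.1 q.1.2 ∧
        famGraph F φ l p.1.1 q.2.1 q.2.2 ∧ g p.1.2 = q.1.1 - q.2.1 ∧ g p.2 = q.1.2 - q.2.2} := by
    refine UnifTDef.ex hM hκ (hF.sub_ne hκ) (a := fun p : (W × X) × X => p.1.2) (b := fun p => p.2)
      (φ := fun p y z => ∃ q : (X × X) × (X × X), famGraph F φ l p.1.1 q.1.1 q.1.2 ∧
        famGraph F φ l p.1.1 q.2.1 q.2.2 ∧ y = q.1.1 - q.2.1 ∧ z = q.1.2 - q.2.2)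
      (by fun_prop) (by fun_prop) (TDef.ex hM hκ (TDef.and hκ ?_ (TDef.and hκ ?_
        (DefSet.tdef hκ (.and (.eq ?_ ?_) (.eq ?_ ?_))))))
    · exact TDef.preimage (f := fun r : (((W × X) × X) × (X × X)) × ((X × X) × (X × X)) =>
        (r.1.1.1.1, r.2.1)) (by fun_prop) hg
    · exact TDef.preimage (f := fun r : (((W × X) × X) × (X × X)) × ((X × X) × (X × X)) =>
        (r.1.1.1.1, r.2.2)) (by fun_prop) hg
    all_goals fun_prop
  refine (congrArg (TDef L M κ) ?_).mp this
  ext ⟨⟨x, a⟩, b⟩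
  constructor
  · rintro ⟨_, ⟨f, hf, f', hf', hne, rfl⟩, q, h1, h2, h3, h4⟩
    have h1 := eq_of_famGraph hc h1
    have h2 := eq_of_famGraph hc h2
    refine hinj f hf f' hf' hne ?_
    have h3 : f a - f' a = q.1.1 - q.2.1 := h3
    have h4 : f b - f' b = q.1.2 - q.2.2 := h4
    change f (φ x a) - f' (φ x a) = f b - f' b
    rw [← hc x f hf, ← hc x f' hf', ← map_sub, h3, map_sub, h4, h1, h2]
  · intro hb
    have hb : φ x a = b := hb
    subst hb
    obtain ⟨f, hf, f', hf', hne, z, hz, z', hz', h⟩ := hl a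
    have h : f a - f' a = z - z' := h
    refine ⟨f - f', ⟨f, hf, f', hf', hne, rfl⟩, ((z, φ x z), (z', φ x z')),
      famGraph_of_mem hc hz, famGraph_of_mem hc hz', h, ?_⟩
    change f (φ x a) - f' (φ x a) = φ x z - φ x z'
    rw [← hc x f hf, ← hc x f' hf', ← map_sub, h, map_sub]

end FamDim

end FinDim

namespace FinDim

/-! ### Rings of bijective endomorphisms -/

section Fractions

variable {X : Type*} [AddCommGroup X] {R : NonUnitalSubring (AddMonoid.End X)}

/-- The left fractions of a ring of bijective endomorphisms with the left Ore condition. -/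
def leftFractions (R : NonUnitalSubring (AddMonoid.End X)) (hne : ∃ r ∈ R, r ≠ 0)
    (hore : ∀ a ∈ R, ∀ b ∈ R, a ≠ 0 → b ≠ 0 → ∃ x ∈ R, ∃ y ∈ R, x * a = y * b ∧ x * a ≠ 0) :
    Subring (AddMonoid.End X) where
  carrier := {q | ∃ a ∈ R, a ≠ 0 ∧ a * q ∈ R}
  zero_mem' := by
    obtain ⟨r, hr, hr0⟩ := hne
    exact ⟨r, hr, hr0, by rw [mul_zero]; exact R.zero_mem⟩
  one_mem' := by
    obtain ⟨r, hr, hr0⟩ := hne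
    exact ⟨r, hr, hr0, by rwa [mul_one]⟩
  neg_mem' := by
    rintro q ⟨a, ha, ha0, h⟩
    exact ⟨a, ha, ha0, by rw [mul_neg]; exact R.neg_mem h⟩
  add_mem' := by
    rintro q q' ⟨a, ha, ha0, h⟩ ⟨a', ha', ha0', h'⟩
    obtain ⟨x, hx, y, hy, hxy, hne⟩ := hore a ha a' ha' ha0 ha0'
    refine ⟨x * a, R.mul_mem hx ha, hne, ?_⟩
    rw [mul_add]
    nth_rw 2 [hxy]
    rw [mul_assoc, mul_assoc]
    exact R.add_mem (R.mul_mem hx h) (R.mul_mem hy h')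
  mul_mem' := by
    rintro q q' ⟨a, ha, ha0, h⟩ ⟨a', ha', ha0', h'⟩
    by_cases hb : a * q = 0
    · exact ⟨a, ha, ha0, by rw [← mul_assoc, hb, zero_mul]; exact R.zero_mem⟩
    -- The Ore condition for `a q` and `a'` gives `x (a q) = y a'`, so `x a` is a denominator of `q
    -- q'`.
    · obtain ⟨x, hx, y, hy, hxy, hne⟩ := hore _ h a' ha' hb ha0'
      refine ⟨x * a, R.mul_mem hx ha, ?_, ?_⟩
      · intro h0
        rw [← mul_assoc, h0, zero_mul] at hne
        exact hne rfl
      · have : x * a * (q * q') = y * (a' * q') := by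
          rw [← mul_assoc, mul_assoc x a q, hxy, mul_assoc]
        rw [this]
        exact R.mul_mem hy h'

variable {hne : ∃ r ∈ R, r ≠ 0}
  {hore : ∀ a ∈ R, ∀ b ∈ R, a ≠ 0 → b ≠ 0 → ∃ x ∈ R, ∃ y ∈ R, x * a = y * b ∧ x * a ≠ 0}

theorem mem_leftFractions_of_mem {r : AddMonoid.End X} (hr : r ∈ R) :
    r ∈ leftFractions R hne hore := by
  by_cases h : r = 0
  · rw [h]
    exact Subring.zero_mem _
  · exact ⟨r, hr, h, R.mul_mem hr hr⟩

theorem isUnit_leftFractions (hbij : ∀ r ∈ R, r ≠ 0 → Function.Bijective r)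
    (q : leftFractions R hne hore) : IsUnit q ∨ q = 0 := by
  rcases eq_or_ne q 0 with rfl | hq
  · exact Or.inr rfl
  refine Or.inl ?_
  obtain ⟨q, a, ha, ha0, h⟩ := q
  have hq : q ≠ 0 := fun h => hq (Subtype.ext h)
  have hainj := (hbij a ha ha0).1
  have hb0 : a * q ≠ 0 := by
    intro h0
    refine hq (DFunLike.ext _ _ fun x => hainj ?_)
    have := DFunLike.congr_fun h0 x
    exact this.trans (map_zero a).symm
  have hb := hbij _ h hb0
  have hqb : Function.Bijective q := (Function.Bijective.of_comp_iff' (hbij a ha ha0) q).mp hb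
  let e : X ≃+ X := AddEquiv.ofBijective q hqb
  let q' : AddMonoid.End X := e.symm.toAddMonoidHom
  have h1 : q * q' = 1 := DFunLike.ext _ _ fun x => e.apply_symm_apply x
  have h2 : q' * q = 1 := DFunLike.ext _ _ fun x => e.symm_apply_apply x
  -- The inverse has denominator `a q`, since `(a q) q⁻¹ = a`.
  have hq' : q' ∈ leftFractions R hne hore := by
    refine ⟨a * q, h, hb0, ?_⟩
    rw [mul_assoc, h1, mul_one]
    exact ha
  exact ⟨⟨⟨q, a, ha, ha0, h⟩, ⟨_, hq'⟩, Subtype.ext h1, Subtype.ext h2⟩, rfl⟩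

/-- The sequence `a v, a b v, a b² v, …`. -/
def orePowers (a b : AddMonoid.End X) : ℕ → X → List X
  | 0, _ => []
  | n + 1, x => a x :: orePowers a b n (b x)

theorem length_orePowers (a b : AddMonoid.End X) (n : ℕ) (x : X) :
    (orePowers a b n x).length = n := by
  induction n generalizing x with
  | zero => rfl
  | succ n ih => simp [orePowers, ih]

theorem eq_zero_of_apply_eq_zero (hbij : ∀ r ∈ R, r ≠ 0 → Function.Bijective r)
    {r : AddMonoid.End X} (hr : r ∈ R) {x : X} (hx : x ≠ 0) (h : r x = 0) : r = 0 := by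
  by_contra hne
  exact hx ((hbij r hr hne).1 (h.trans (map_zero r).symm))

/-- If `R a` and `R b` meet only in zero, the sum of `R a`, `R a b`, `R a b²`, … is direct. It
remains direct after evaluation at `v`, because an element of `R` that kills a non-zero vector is
zero. -/
theorem famIndep_orePowers (hbij : ∀ r ∈ R, r ≠ 0 → Function.Bijective r)
    {F : Set (AddMonoid.End X)} (hF : ∀ f ∈ F, f ∈ R) {a b : AddMonoid.End X} (ha : a ∈ R)
    (hb : b ∈ R) (ha0 : a ≠ 0) (hb0 : b ≠ 0)
    (h : ∀ x ∈ R, ∀ y ∈ R, x * a = y * b → x * a = 0) (n : ℕ) {v : X} (hv : v ≠ 0) :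
    FamIndep F (orePowers a b n v) ∧
      ∀ z ∈ famSums F (orePowers a b n v), ∃ r ∈ R, z = r v := by
  induction n generalizing v with
  | zero =>
    refine ⟨trivial, ?_⟩
    rintro z hz
    obtain rfl : z = 0 := hz
    exact ⟨0, R.zero_mem, rfl⟩
  | succ n ih =>
    have hbv : b v ≠ 0 := fun h0 => hv ((hbij b hb hb0).1 (h0.trans (map_zero b).symm))
    obtain ⟨h1, h2⟩ := ih hbv
    refine ⟨⟨h1, ?_⟩, ?_⟩
    · intro f hf f' hf' hne z hz z' hz' heq
      obtain ⟨r, hr, rfl⟩ := h2 z hz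
      obtain ⟨r', hr', rfl⟩ := h2 z' hz'
      have hmem := R.sub_mem (hF f hf) (hF f' hf')
      have hmem' := R.sub_mem hr' hr
      have h3 : (f - f') * a - (r' - r) * b = 0 := by
        refine eq_zero_of_apply_eq_zero hbij
          (R.sub_mem (R.mul_mem hmem ha) (R.mul_mem hmem' hb)) hv ?_
        change f (a v) - f' (a v) - (r' (b v) - r (b v)) = 0
        rw [sub_eq_zero, sub_eq_sub_iff_add_eq_add, heq, add_comm]
      have h4 := h _ hmem _ hmem' (sub_eq_zero.mp h3)
      refine hne (sub_eq_zero.mp (DFunLike.ext _ _ fun x => ?_))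
      obtain ⟨y, rfl⟩ := (hbij a ha ha0).2 x
      exact DFunLike.congr_fun h4 y
    · rintro _ ⟨f, hf, z, hz, rfl⟩
      obtain ⟨r, hr, rfl⟩ := h2 z hz
      exact ⟨f * a + r * b, R.add_mem (R.mul_mem (hF f hf) ha) (R.mul_mem hr hb), rfl⟩

end Fractions

/-! ### Irreducible modules over rings of bijections are one-dimensional -/

section Line

variable {L : FirstOrder.Language.{u, v}} {T : L.Theory} (D : DimensionFunction.{u, v, w} T)
  {M : FirstOrder.Language.Theory.ModelType.{u, v, w} T} {κ : Cardinal.{w}}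
  (hM : IsSaturated L M κ) (hκ : Cardinal.aleph0 ≤ κ)
  {X : Type*} [AddCommGroup X] [Coded L M X] [DefAdd L M X]

include D hM hκ

/-- An irreducible module over a ring `R` of definable bijective endomorphisms that contains an
infinite type-definable family is a line over the ring of fractions of `R`, so that its `R`-linear
endomorphisms form a uniformly definable family indexed by its elements. -/
theorem exists_transitive_commuting (R : NonUnitalSubring (AddMonoid.End X))
    (hbij : ∀ r ∈ R, r ≠ 0 → Function.Bijective r) (hdef : ∀ r ∈ R, DefFun L M r)
    {F : Set (AddMonoid.End X)} (hFR : ∀ f ∈ F, f ∈ R) (hF : UnifTDef L M κ F) (hinf : F.Infinite)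
    (hconn : IsConn L M (⊤ : AddSubgroup X))
    (hirr : ∀ W : AddSubgroup X, DefSet L M (W : Set X) → IsConn L M W →
      (∀ r ∈ R, ∀ x ∈ W, r x ∈ W) → W = ⊥ ∨ W = ⊤) {v : X} (hv : v ≠ 0) :
    ∃ τ : X → AddMonoid.End X, (∀ x, τ x v = x) ∧ (∀ x, ∀ r ∈ R, ∀ y, τ x (r y) = r (τ x y)) ∧
      DefFun L M (fun p : X × X => τ p.1 p.2) ∧
      ∀ x, ∃ q : AddMonoid.End X, DefFun L M q ∧ q v = x ∧ ∀ y z, τ y (q z) = q (τ y z) := by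
  have hinj : ∀ f ∈ F, ∀ f' ∈ F, f ≠ f' → Function.Injective (f - f') :=
    fun f hf f' hf' hne => (hbij _ (R.sub_mem (hFR f hf) (hFR f' hf')) (sub_ne_zero.mpr hne)).1
  have hne : ∃ r ∈ R, r ≠ 0 := by
    obtain ⟨f, hf, f', hf', h⟩ := hinf.nontrivial
    exact ⟨f - f', R.sub_mem (hFR f hf) (hFR f' hf'), sub_ne_zero.mpr h⟩
  -- A failure of the Ore condition would produce independent lists of every length.
  have hore : ∀ a ∈ R, ∀ b ∈ R, a ≠ 0 → b ≠ 0 → ∃ x ∈ R, ∃ y ∈ R, x * a = y * b ∧ x * a ≠ 0 := by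
    intro a ha b hb ha0 hb0
    by_contra! hcon
    obtain ⟨n, -, hn, -⟩ := exists_maximal_famIndep D hM hκ hF hinf
    have := hn _ (famIndep_orePowers hbij hFR ha hb ha0 hb0 hcon (n + 1) hv).1
    rw [length_orePowers] at this
    omega
  let Q := leftFractions R hne hore
  have : Nontrivial Q := ⟨0, 1, fun h => hv (DFunLike.congr_fun (congrArg Subtype.val h) v).symm⟩
  let := DivisionRing.ofIsUnitOrEqZero (R := Q) (isUnit_leftFractions hbij)
  let : Module Q X :=
    { smul := fun q x => q.1 x
      one_smul := fun _ => rfl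
      mul_smul := fun _ _ _ => rfl
      smul_zero := fun q => map_zero q.1
      smul_add := fun q => map_add q.1
      add_smul := fun _ _ _ => rfl
      zero_smul := fun _ => rfl }
  have hQ : ∀ q : Q, DefFun L M q.1 := by
    rintro ⟨q, a, ha, ha0, h⟩
    have h1 := hdef a ha
    have h2 := hdef _ h
    refine DefFun.of_graph (G := fun x y => (a * q) x = a y)
      (DefSet.eq (by fun_prop) (by fun_prop)) fun x y => ?_
    exact (hbij a ha ha0).1.eq_iff.symm
  -- A `Q`-linear functional with `g v = 1`. Nothing makes `g` definable at this point.
  obtain ⟨g, hg⟩ := (LinearMap.toSpanSingleton Q X v).exists_leftInverse_of_injective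
    (LinearMap.ker_toSpanSingleton Q hv)
  have hgv : ∀ q : Q, g (q.1 v) = q := fun q => LinearMap.congr_fun hg q
  have hgR : ∀ r ∈ R, ∀ x, (g (r x)).1 = r * (g x).1 := fun r hr x =>
    congrArg Subtype.val (g.map_smul (⟨r, mem_leftFractions_of_mem hr⟩ : Q) x)
  have hgQ : ∀ (q : Q) x, (g (q.1 x)).1 = q.1 * (g x).1 := fun q x =>
    congrArg Subtype.val (g.map_smul q x)
  let τ : X → AddMonoid.End X := fun w =>
    { toFun := fun x => (g x).1 w
      map_zero' := by rw [map_zero]; rfl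
      map_add' := fun x y => by rw [map_add]; rfl }
  have hτR : ∀ x, ∀ r ∈ R, ∀ y, τ x (r y) = r (τ x y) := fun x r hr y =>
    DFunLike.congr_fun (hgR r hr y) x
  -- For fixed `a` the map `w ↦ g(a) w` is an element of `Q`, hence definable; commutation with `F`
  -- makes the definability uniform in `a`.
  have hτ : DefFun L M fun p : X × X => τ p.1 p.2 :=
    defFun_of_commute D hM hκ hF hinf hinj (fun a => hQ (g a)) fun x f hf a => hτR x f (hFR f hf) a
  have hπ : DefFun L M (τ v) := DefFun.comp (f := fun x => (v, x)) hτ (by fun_prop)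
  have hu : DefSet L M ((⊤ : AddSubgroup X) : Set X) := DefSet.univ
  have hvv : τ v v = v := by
    have := hgv 1
    change (g v).1 v = v
    have h1 : g v = 1 := this
    rw [h1]
    rfl
  -- `τ v` is the projection `x ↦ g(x) v` to `Qv`. Being definable, it has a definable connected
  -- image, which is `R`-invariant and contains `v`.
  have htop : (⊤ : AddSubgroup X).map (τ v : X →+ X) = ⊤ := by
    refine (hirr _ (defSet_map hπ hu) (hconn.map hu hπ) ?_).resolve_left ?_
    · rintro r hr _ ⟨x, -, rfl⟩
      exact ⟨r x, trivial, hτR v r hr x⟩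
    · intro h
      have : τ v v ∈ (⊥ : AddSubgroup X) := h ▸ ⟨v, trivial, rfl⟩
      rw [hvv] at this
      exact hv this
  have hgx : ∀ x, (g x).1 v = x := by
    intro x
    obtain ⟨y, -, rfl⟩ : x ∈ (⊤ : AddSubgroup X).map (τ v : X →+ X) := by
      rw [htop]; trivial
    change (g ((g y).1 v)).1 v = (g y).1 v
    rw [hgv]
  have hgv1 : g v = 1 := hgv 1
  refine ⟨τ, fun x => ?_, hτR, hτ, fun x => ⟨(g x).1, hQ _, hgx x, fun y z => ?_⟩⟩
  · change (g v).1 x = x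
    rw [hgv1]
    rfl
  · exact DFunLike.congr_fun (hgQ (g x) z) y

end Line

end FinDim

namespace FinDim

/-! ### Irreducible modules and their lines -/

section SubgroupCoding

variable {L : FirstOrder.Language.{u, v}} {M : Type w} [L.Structure M]
  {X Y : Type*} [AddCommGroup X] [Coded L M X] [Coded L M Y]

/-- The coding of a definable subgroup. -/
@[reducible]
def Coded.addSubgroup {H : AddSubgroup X} (h : DefSet L M (H : Set X)) : Coded L M H :=
  Coded.subtype (p := fun x => x ∈ H) h

variable {H : AddSubgroup X} (h : DefSet L M (H : Set X))

theorem defFun_coe : letI := Coded.addSubgroup h; DefFun L M (fun x : H => (x : X)) :=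
  DefFun.subtype_val h

theorem defFun_to_addSubgroup {f : Y → H} (hf : DefFun L M fun y => (f y : X)) :
    letI := Coded.addSubgroup h; DefFun L M f :=
  DefFun.subtype_mk h hf

theorem DefAdd.addSubgroup [DefAdd L M X] : letI := Coded.addSubgroup h; DefAdd L M H := by
  let := Coded.addSubgroup h
  have := defFun_coe h
  refine ⟨DefFun.subtype_mk (p := fun x => x ∈ H) h ?_⟩
  change DefFun L M fun p : H × H => (p.1 : X) + (p.2 : X)
  fun_prop

end SubgroupCoding

section Module

variable {L : FirstOrder.Language.{u, v}} {T : L.Theory} (D : DimensionFunction.{u, v, w} T)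
  {M : FirstOrder.Language.Theory.ModelType.{u, v, w} T} {κ : Cardinal.{w}}
  {X : Type w} [AddCommGroup X] [Coded L M X]
  {S : Subring (AddMonoid.End X)}

theorem defSet_range {f : AddMonoid.End X} (hf : DefFun L M f) :
    DefSet L M (AddMonoidHom.range f : Set X) :=
  (congrArg (fun H : AddSubgroup X => DefSet L M (H : Set X))
    (AddMonoidHom.range_eq_map (f : X →+ X))).mpr (defSet_map hf DefSet.univ)

theorem isConn_range {f : AddMonoid.End X} (hconn : IsConn L M (⊤ : AddSubgroup X))
    (hf : DefFun L M f) : IsConn L M (AddMonoidHom.range f) :=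
  (congrArg (IsConn L M) (AddMonoidHom.range_eq_map (f : X →+ X))).mpr (hconn.map DefSet.univ hf)

variable [DefAdd L M X] (hS : ∀ s ∈ S, DefFun L M s) (hconn : IsConn L M (⊤ : AddSubgroup X))
  (hirr : ∀ W : AddSubgroup X, DefSet L M (W : Set X) → IsConn L M W →
    (∀ s ∈ S, ∀ x ∈ W, s x ∈ W) → W = ⊥ ∨ W = ⊤)

include D hS hirr in
-- A finite sum of images `r W` of maximal dimension absorbs every further `r W` by connectedness,
-- so it is `S`-invariant. It is non-zero because `1 ∈ S`.
theorem exists_finset_sup_map_eq_top {W : AddSubgroup X} (hW : DefSet L M (W : Set X))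
    (hWc : IsConn L M W) (hne : W ≠ ⊥) :
    ∃ I : Finset (AddMonoid.End X), (∀ r ∈ I, r ∈ S) ∧ (I.sup fun r => W.map (r : X →+ X)) = ⊤ := by
  classical
  have hdc : ∀ I : Finset (AddMonoid.End X), (∀ r ∈ I, r ∈ S) →
      DefSet L M ((I.sup fun r => W.map (r : X →+ X) : AddSubgroup X) : Set X) ∧
        IsConn L M (I.sup fun r => W.map (r : X →+ X)) := fun I hI =>
    finset_sup_def_conn I (fun r hr => defSet_map (hS r (hI r hr)) hW)
      fun r hr => hWc.map hW (hS r (hI r hr))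
  obtain ⟨H, ⟨I, hI, rfl⟩, hmax⟩ := exists_sdim_max D (M := M)
    (P := fun H => ∃ I : Finset (AddMonoid.End X), (∀ r ∈ I, r ∈ S) ∧
      H = I.sup fun r => W.map (r : X →+ X))
    ⟨_, ∅, by simp, rfl⟩ (by rintro _ ⟨I, hI, rfl⟩; exact (hdc I hI).1)
  refine ⟨I, hI, ?_⟩
  set H := I.sup fun r => W.map (r : X →+ X) with hH
  have hle : ∀ r ∈ S, W.map (r : X →+ X) ≤ H := by
    intro r hr
    have hI' : ∀ q ∈ insert r I, q ∈ S := by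
      intro q hq
      rcases Finset.mem_insert.mp hq with rfl | hq
      · exact hr
      · exact hI q hq
    have hins : (insert r I).sup (fun r => W.map (r : X →+ X)) = W.map (r : X →+ X) ⊔ H :=
      Finset.sup_insert
    have := (hdc _ hI').2.eq_of_le_of_sdim_le D (hdc I hI).1 (hdc _ hI').1
      (by rw [hins]; exact le_sup_right) (hmax _ ⟨_, hI', rfl⟩)
    rw [hins] at this
    change H = _ at this
    rw [this]
    exact le_sup_left
  refine (hirr H (hdc I hI).1 (hdc I hI).2 ?_).resolve_left ?_
  · intro s hs
    have : H ≤ H.comap (s : X →+ X) := by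
      refine Finset.sup_le fun r hr => ?_
      rintro _ ⟨x, hx, rfl⟩
      exact hle (s * r) (S.mul_mem hs (hI r hr)) ⟨x, hx, rfl⟩
    exact this
  · intro hbot
    refine hne (le_bot_iff.mp ?_)
    rw [← hbot]
    intro x hx
    exact hle 1 S.one_mem ⟨x, hx, rfl⟩

omit [DefAdd L M X] in
include hconn hirr in
theorem surjective_of_commute {t : AddMonoid.End X} (ht : DefFun L M t)
    (hc : ∀ s ∈ S, s * t = t * s) (hne : t ≠ 0) : Function.Surjective t := by
  have : AddMonoidHom.range t = ⊤ := by
    refine (hirr _ (defSet_range ht) (isConn_range hconn ht) ?_).resolve_left ?_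
    · rintro s hs _ ⟨x, rfl⟩
      exact ⟨s x, (DFunLike.congr_fun (hc s hs) x).symm⟩
    · intro h
      exact hne (AddMonoidHom.range_eq_bot_iff.mp h)
  exact AddMonoidHom.range_eq_top.mp this

include D hS hconn in
-- For a non-zero `s` with image of least dimension, the image of a non-zero `s r s` lies in that of
-- `s` and has no smaller dimension, so connectedness gives equality.
theorem exists_minimal_range (hne : ∃ s ∈ S, s ≠ 0) :
    ∃ s ∈ S, s ≠ 0 ∧ ∀ r ∈ S, s * r * s ≠ 0 →
      AddMonoidHom.range (s * r * s) = AddMonoidHom.range s := by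
  obtain ⟨s₀, hs₀, hs₀'⟩ := hne
  obtain ⟨H, ⟨s, hs, hs0, rfl⟩, hmin⟩ := exists_sdim_min D (M := M)
    (P := fun H : AddSubgroup X => ∃ s ∈ S, s ≠ 0 ∧ H = AddMonoidHom.range s)
    ⟨_, s₀, hs₀, hs₀', rfl⟩ (by rintro _ ⟨s, hs, -, rfl⟩; exact defSet_range (hS s hs))
  refine ⟨s, hs, hs0, fun r hr hne => ?_⟩
  have hm := S.mul_mem (S.mul_mem hs hr) hs
  refine (isConn_range hconn (hS s hs)).eq_of_le_of_sdim_le D (defSet_range (hS _ hm))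
    (defSet_range (hS s hs)) ?_ (hmin _ ⟨_, hm, hne, rfl⟩)
  rintro _ ⟨x, rfl⟩
  exact ⟨r (s x), rfl⟩

/-- The endomorphism `s r` of the image of `s`. -/
def lineEnd (s r : AddMonoid.End X) : AddMonoid.End (AddMonoidHom.range s) where
  toFun x := ⟨s (r x), r x, rfl⟩
  map_zero' := Subtype.ext (by
    change s (r 0) = 0
    rw [map_zero, map_zero])
  map_add' x y := Subtype.ext (by
    change s (r (x.1 + y.1)) = s (r x.1) + s (r y.1)
    rw [map_add, map_add])

/-- The ring of the endomorphisms of the image of `s` that are induced by elements of `s S`. -/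
def lineRing {s : AddMonoid.End X} (hs : s ∈ S) :
    NonUnitalSubring (AddMonoid.End (AddMonoidHom.range s)) where
  carrier := {ρ | ∃ r ∈ S, ρ = lineEnd s r}
  zero_mem' := ⟨0, S.zero_mem, DFunLike.ext _ _ fun x => Subtype.ext (map_zero s).symm⟩
  add_mem' := by
    rintro _ _ ⟨r, hr, rfl⟩ ⟨r', hr', rfl⟩
    exact ⟨r + r', S.add_mem hr hr', DFunLike.ext _ _ fun x => Subtype.ext (map_add s _ _).symm⟩
  neg_mem' := by
    rintro _ ⟨r, hr, rfl⟩
    exact ⟨-r, S.neg_mem hr, DFunLike.ext _ _ fun x => Subtype.ext (map_neg s _).symm⟩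
  mul_mem' := by
    rintro _ _ ⟨r, hr, rfl⟩ ⟨r', hr', rfl⟩
    exact ⟨r * s * r', S.mul_mem (S.mul_mem hr hs) hr', rfl⟩

theorem lineEnd_mem {s : AddMonoid.End X} (hs : s ∈ S) {r : AddMonoid.End X} (hr : r ∈ S) :
    lineEnd s r ∈ lineRing hs := ⟨r, hr, rfl⟩

omit [DefAdd L M X] in
include hS in
theorem defFun_of_mem_lineRing {s : AddMonoid.End X} (hs : s ∈ S)
    {ρ : AddMonoid.End (AddMonoidHom.range s)} (hρ : ρ ∈ lineRing hs) :
    letI := Coded.addSubgroup (defSet_range (hS s hs)); DefFun L M ρ := by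
  let := Coded.addSubgroup (defSet_range (hS s hs))
  obtain ⟨r, hr, rfl⟩ := hρ
  have h1 := hS s hs
  have h2 := hS r hr
  have h3 := defFun_coe (defSet_range (hS s hs))
  refine DefFun.subtype_mk (p := fun x => x ∈ AddMonoidHom.range s) (defSet_range (hS s hs)) ?_
  change DefFun L M fun x : AddMonoidHom.range s => s (r (x : X))
  fun_prop

theorem surjective_of_mem_lineRing {s : AddMonoid.End X} (hs : s ∈ S)
    (hmin : ∀ r ∈ S, s * r * s ≠ 0 → AddMonoidHom.range (s * r * s) = AddMonoidHom.range s)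
    {ρ : AddMonoid.End (AddMonoidHom.range s)} (hρ : ρ ∈ lineRing hs) (hne : ρ ≠ 0) :
    Function.Surjective ρ := by
  obtain ⟨r, hr, rfl⟩ := hρ
  have h0 : s * r * s ≠ 0 := by
    intro h0
    refine hne (DFunLike.ext _ _ ?_)
    rintro ⟨_, x, rfl⟩
    exact Subtype.ext (DFunLike.congr_fun h0 x)
  rintro ⟨y, hy⟩
  rw [← hmin r hr h0] at hy
  obtain ⟨x, rfl⟩ := hy
  exact ⟨⟨s x, x, rfl⟩, rfl⟩

omit [DefAdd L M X] in
include hconn in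
theorem isConn_line {s : AddMonoid.End X} (hsd : DefFun L M s) :
    letI := Coded.addSubgroup (defSet_range hsd)
    IsConn L M (⊤ : AddSubgroup (AddMonoidHom.range s)) := by
  let := Coded.addSubgroup (defSet_range hsd)
  have h : DefFun L M (AddMonoidHom.rangeRestrict s) :=
    defFun_to_addSubgroup (defSet_range hsd) (f := AddMonoidHom.rangeRestrict s) hsd
  have := hconn.map DefSet.univ h
  rwa [AddSubgroup.map_top_of_surjective _ (AddMonoidHom.rangeRestrict_surjective s)] at this

include D hS hirr in
-- A non-zero invariant `W` generates `X` under finitely many `r ∈ S`; applying `s` shows that the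
-- line is the sum of the groups `s r W`, all contained in `W`.
theorem irreducible_line {s : AddMonoid.End X} (hs : s ∈ S) :
    letI := Coded.addSubgroup (defSet_range (hS s hs))
    ∀ W : AddSubgroup (AddMonoidHom.range s), DefSet L M (W : Set (AddMonoidHom.range s)) →
      IsConn L M W → (∀ ρ ∈ lineRing hs, ∀ x ∈ W, ρ x ∈ W) → W = ⊥ ∨ W = ⊤ := by
  let := Coded.addSubgroup (defSet_range (hS s hs))
  intro W hW hWc hinv
  have h3 : DefFun L M (AddSubgroup.subtype (AddMonoidHom.range s)) :=
    defFun_coe (defSet_range (hS s hs))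
  by_cases hne : W = ⊥
  · exact Or.inl hne
  refine Or.inr (top_le_iff.mp ?_)
  obtain ⟨I, hI, htop⟩ := exists_finset_sup_map_eq_top D hS hirr (defSet_map h3 hW)
    (hWc.map hW h3) (fun h => hne ((AddSubgroup.map_eq_bot_iff_of_injective _
      Subtype.val_injective).mp h))
  have hle : (⊤ : AddSubgroup X) ≤ (W.map (AddSubgroup.subtype (AddMonoidHom.range s))).comap
      (s : X →+ X) := by
    rw [← htop]
    refine Finset.sup_le fun r hr => ?_
    rintro _ ⟨_, ⟨x, hx, rfl⟩, rfl⟩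
    exact ⟨lineEnd s r x, hinv _ (lineEnd_mem hs (hI r hr)) x hx, rfl⟩
  rintro ⟨_, x, rfl⟩ -
  obtain ⟨y, hy, hyx⟩ := hle (AddSubgroup.mem_top x)
  have : y = ⟨s x, x, rfl⟩ := Subtype.ext hyx
  subst this
  exact hy

include D hS hirr in
-- Choose `J` so that the intersection of the kernels of `s r`, `r ∈ J`, has least dimension. A
-- further kernel cuts it in finite index, so a connected `C` inside it is killed by every `s r`.
-- Were `C` non-zero, its translates would generate `X`, and `s` would vanish.
theorem exists_finset_inf_ker {s : AddMonoid.End X} (hs : s ∈ S) (hs0 : s ≠ 0) :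
    ∃ J : Finset (AddMonoid.End X), (∀ r ∈ J, r ∈ S) ∧ ∀ C : AddSubgroup X,
      DefSet L M (C : Set X) → IsConn L M C → (∀ r ∈ J, ∀ x ∈ C, s (r x) = 0) → C = ⊥ := by
  classical
  let N : Finset (AddMonoid.End X) → AddSubgroup X := fun J => J.inf fun r =>
    AddMonoidHom.ker (s * r : AddMonoid.End X)
  have hN : ∀ J : Finset (AddMonoid.End X), (∀ r ∈ J, r ∈ S) → DefSet L M (N J : Set X) := by
    intro J
    induction J using Finset.induction_on with
    | empty => exact fun _ => DefSet.univ
    | insert r J hr ih =>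
      intro hJ
      have : N (insert r J) = AddMonoidHom.ker (s * r : AddMonoid.End X) ⊓ N J := Finset.inf_insert
      rw [this]
      exact defSet_inf (defSet_ker (hS _ (S.mul_mem hs (hJ r (by simp)))))
        (ih fun q hq => hJ q (by simp [hq]))
  obtain ⟨H, ⟨J, hJ, rfl⟩, hmin⟩ := exists_sdim_min D (M := M)
    (P := fun H : AddSubgroup X => ∃ J : Finset (AddMonoid.End X), (∀ r ∈ J, r ∈ S) ∧ H = N J)
    ⟨_, ∅, by simp, rfl⟩ (by rintro _ ⟨J, hJ, rfl⟩; exact hN J hJ)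
  refine ⟨J, hJ, fun C hC hCc hCJ => ?_⟩
  have hCN : C ≤ N J := Finset.le_inf fun r hr x hx => hCJ r hr x hx
  have hker : ∀ r ∈ S, ∀ x ∈ C, s (r x) = 0 := by
    intro r hr
    have hJ' : ∀ q ∈ insert r J, q ∈ S := by
      intro q hq
      rcases Finset.mem_insert.mp hq with rfl | hq
      · exact hr
      · exact hJ q hq
    have hle : N (insert r J) ≤ N J := Finset.inf_mono (Finset.subset_insert r J)
    have hfin := isFiniteRelIndex_of_sdim_le D (hN _ hJ') (hN J hJ) hle (hmin _ ⟨_, hJ', rfl⟩)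
    have h1 := hCc.le_of_isFiniteRelIndex hC (hN _ hJ')
      (AddSubgroup.isFiniteRelIndex_of_le_right (L := N J) _ hCN)
    have h2 : N (insert r J) ≤ AddMonoidHom.ker (s * r : AddMonoid.End X) :=
      Finset.inf_le (Finset.mem_insert_self r J)
    exact fun x hx => h2 (h1 hx)
  by_contra hne
  obtain ⟨I, hI, htop⟩ := exists_finset_sup_map_eq_top D hS hirr hC hCc hne
  refine hs0 (AddMonoidHom.ker_eq_top_iff.mp (top_le_iff.mp ?_))
  rw [← htop]
  refine Finset.sup_le fun r hr => ?_
  rintro _ ⟨x, hx, rfl⟩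
  exact hker r (hI r hr) x hx

end Module

end FinDim

/-! ### Counting endomorphisms, and injectivity on the line -/

namespace FinDim

section LineFamily

variable {L : FirstOrder.Language.{u, v}} {T : L.Theory} (D : DimensionFunction.{u, v, w} T)
  {M : FirstOrder.Language.Theory.ModelType.{u, v, w} T} {κ : Cardinal.{w}}
  {X : Type w} [AddCommGroup X] [Coded L M X] [DefAdd L M X]

omit [DefAdd L M X] in
theorem UnifTDef.lineEnd {F : Set (AddMonoid.End X)}
    (hF : UnifTDef L M κ F) {s i j : AddMonoid.End X} (hs : DefFun L M s) (hi : DefFun L M i)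
    (hj : DefFun L M j) :
    letI := Coded.addSubgroup (defSet_range hs)
    UnifTDef L M κ ((fun f => FinDim.lineEnd s (j * f * i)) '' F) := by
  let := Coded.addSubgroup (defSet_range hs)
  have hc := defFun_coe (defSet_range hs)
  obtain ⟨C, _, P, ev, hP, hev, h1, h2⟩ := hF
  have key : ∀ (c : C) (f : AddMonoid.End X), (∀ x y, ev c x y ↔ f x = y) →
      ∀ x y : AddMonoidHom.range s, (∃ z, ev c (i x) z ∧ s (j z) = y) ↔
        FinDim.lineEnd s (j * f * i) x = y := by
    intro c f hf x y
    rw [Subtype.ext_iff]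
    simp only [hf]
    constructor
    · rintro ⟨_, rfl, h⟩
      exact h
    · intro h
      exact ⟨_, rfl, h⟩
  refine ⟨C, inferInstance, P, fun c x y => ∃ z, ev c (i x) z ∧ s (j z) = y, hP, ?_, ?_, ?_⟩
  · refine DefSet.ex (.and ?_ (.eq ?_ ?_))
    · exact DefSet.preimage
        (f := fun p : (C × (AddMonoidHom.range s × AddMonoidHom.range s)) × X =>
          (p.1.1, (i p.1.2.1, p.2))) (by fun_prop) hev
    · fun_prop
    · fun_prop
  · intro c hcP
    obtain ⟨f, hf, hfe⟩ := h1 c hcP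
    exact ⟨_, ⟨f, hf, rfl⟩, key c f hfe⟩
  · rintro _ ⟨f, hf, rfl⟩
    obtain ⟨c, hcP, hfe⟩ := h2 f hf
    exact ⟨c, hcP, key c f hfe⟩

/-- If an unbounded set of endomorphisms is separated by finitely many maps, then one of the maps
has an unbounded image. -/
theorem exists_continuum_lt_image {A B ι : Type w} [Finite ι] {F : Set A}
    (hF : Cardinal.continuum < Cardinal.mk F) (g : ι → A → B)
    (hg : ∀ f ∈ F, ∀ f' ∈ F, (∀ i, g i f = g i f') → f = f') :
    ∃ i, Cardinal.continuum < Cardinal.mk (g i '' F) := by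
  by_contra! hcon
  let Φ : F → ∀ i, g i '' F := fun f i => ⟨g i f, Set.mem_image_of_mem _ f.2⟩
  have hΦ : Function.Injective Φ := fun f f' h =>
    Subtype.ext (hg _ f.2 _ f'.2 fun i => congrArg Subtype.val (congrFun h i))
  refine absurd hF (not_lt.mpr ?_)
  calc Cardinal.mk F ≤ Cardinal.mk (∀ i, g i '' F) := Cardinal.mk_le_of_injective hΦ
    _ = Cardinal.prod fun i => Cardinal.mk (g i '' F) := Cardinal.mk_pi _
    _ ≤ Cardinal.prod fun _ : ι => Cardinal.continuum.{w} := Cardinal.prod_le_prod _ _ hcon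
    _ = Cardinal.continuum ^ Cardinal.mk ι := Cardinal.prod_const' _ _
    _ ≤ Cardinal.continuum ^ Cardinal.aleph0 :=
      Cardinal.power_le_power_left Cardinal.continuum_ne_zero (Cardinal.lt_aleph0_of_finite ι).le
    _ = Cardinal.continuum := Cardinal.continuum_power_aleph0

include D in
/-- An endomorphism that commutes with an unbounded ring of endomorphisms that are zero or
surjective is injective if it is surjective. -/
theorem injective_of_commute {Y : Type w} [AddCommGroup Y] [Coded L M Y] [DefAdd L M Y]
    {R : NonUnitalSubring (AddMonoid.End Y)} (hR : ∀ r ∈ R, DefFun L M r)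
    (hsurj : ∀ r ∈ R, r ≠ 0 → Function.Surjective r) {F : Set (AddMonoid.End Y)}
    (hFR : ∀ f ∈ F, f ∈ R) (hF : Cardinal.continuum < Cardinal.mk F) {t : AddMonoid.End Y}
    (ht : DefFun L M t) (hts : Function.Surjective t) (hc : ∀ r ∈ R, ∀ x, r (t x) = t (r x)) :
    Function.Injective t := by
  have hpow : ∀ n : ℕ, DefFun L M (t^[n]) ∧ Function.Surjective (t^[n]) ∧
      (∀ r ∈ R, ∀ x, r (t^[n] x) = t^[n] (r x)) ∧ t^[n] 0 = 0 := by
    intro n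
    induction n with
    | zero => exact ⟨DefFun.id, Function.surjective_id, fun _ _ _ => rfl, rfl⟩
    | succ n ih =>
      obtain ⟨h1, h2, h3, h4⟩ := ih
      refine ⟨?_, hts.iterate _, fun r hr x => ?_, ?_⟩
      · simp only [Function.iterate_succ']
        exact DefFun.comp (g := t) (f := t^[n]) ht h1
      · rw [Function.iterate_succ_apply', Function.iterate_succ_apply', hc r hr, h3 r hr]
      · rw [Function.iterate_succ_apply', h4, map_zero]
  -- The union of the kernels of the powers of `t`: each is finite, so `E` is countable, and `R`
  -- preserves it.
  let E : Set Y := {x | ∃ n : ℕ, t^[n] x = 0}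
  have hEc : E.Countable := by
    have : E = ⋃ n : ℕ, {x | t^[n] x = 0} := by ext; simp [E]
    rw [this]
    refine Set.countable_iUnion fun n => Set.Finite.countable ?_
    have hpn : ∀ x, (t ^ n : AddMonoid.End Y) x = t^[n] x := fun x => by
      rw [AddMonoid.End.coe_pow]
    have h1 : DefFun L M (t ^ n : AddMonoid.End Y) := by
      rw [AddMonoid.End.coe_pow]; exact (hpow n).1
    have h2 : Function.Surjective (t ^ n : AddMonoid.End Y) := by
      rw [AddMonoid.End.coe_pow]; exact (hpow n).2.1
    refine (finite_ker_of_surjective D h1 h2).subset fun x hx => ?_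
    exact (hpn x).trans hx
  by_contra hinj
  -- `t` maps `E` onto `E`. On a finite `E` it would be injective, and `E` contains the kernel of
  -- `t`.
  have hEinf : E.Infinite := by
    intro hfin
    have hmaps : ∀ x ∈ E, t x ∈ E := by
      rintro x ⟨n, hn⟩
      refine ⟨n, ?_⟩
      rw [← Function.iterate_succ_apply, Function.iterate_succ_apply', hn, map_zero]
    have hsur : Set.SurjOn t E E := by
      rintro y ⟨n, hn⟩
      obtain ⟨x, rfl⟩ := hts y
      exact ⟨x, ⟨n + 1, hn⟩, rfl⟩
    have hEinj : Set.InjOn t E := (hfin.surjOn_iff_bijOn_of_mapsTo hmaps).mp hsur |>.injOn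
    refine hinj ((injective_iff_map_eq_zero t).mpr fun x hx => ?_)
    exact hEinj ⟨1, hx⟩ ⟨0, rfl⟩ (hx.trans (map_zero t).symm)
  have hRE : ∀ r ∈ R, ∀ x ∈ E, r x ∈ E := by
    rintro r hr x ⟨n, hn⟩
    exact ⟨n, by rw [← (hpow n).2.2.1 r hr, hn, map_zero]⟩
  -- There are at most continuum many self-maps of `E`, so two distinct members of `F` agree on `E`.
  let Φ : F → E → E := fun f x => ⟨f.1 x, hRE _ (hFR _ f.2) _ x.2⟩
  have hΦ : ¬ Function.Injective Φ := by
    intro h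
    have h1 : Cardinal.mk F ≤ Cardinal.mk (E → E) := Cardinal.mk_le_of_injective h
    have h2 : Cardinal.mk (E → E) ≤ Cardinal.continuum := by
      rw [← Cardinal.power_def]
      calc Cardinal.mk E ^ Cardinal.mk E ≤ Cardinal.continuum ^ Cardinal.mk E :=
            Cardinal.power_le_power_right (hEc.le_aleph0.trans Cardinal.aleph0_le_continuum)
        _ ≤ Cardinal.continuum ^ Cardinal.aleph0 :=
            Cardinal.power_le_power_left Cardinal.continuum_ne_zero hEc.le_aleph0
        _ = Cardinal.continuum := Cardinal.continuum_power_aleph0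
    exact absurd hF (not_lt.mpr (h1.trans h2))
  rw [Function.Injective] at hΦ
  push Not at hΦ
  obtain ⟨f, f', hff, hne⟩ := hΦ
  have hmem := R.sub_mem (hFR _ f.2) (hFR _ f'.2)
  have hd0 : f.1 - f'.1 ≠ 0 := sub_ne_zero.mpr fun h => hne (Subtype.ext h)
  refine hEinf ((finite_ker_of_surjective D (hR _ hmem) (hsurj _ hmem hd0)).subset fun x hx => ?_)
  have : f.1 x = f'.1 x := congrArg Subtype.val (congrFun hff ⟨x, hx⟩)
  exact sub_eq_zero.mpr this

end LineFamily

end FinDim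

/-! ### The centraliser of an irreducible module -/

namespace FinDim

section Centralizer

variable {L : FirstOrder.Language.{u, v}} {T : L.Theory} (D : DimensionFunction.{u, v, w} T)
  {M : FirstOrder.Language.Theory.ModelType.{u, v, w} T} {κ : Cardinal.{w}}
  (hM : IsSaturated L M κ) (hκ : Cardinal.aleph0 ≤ κ)
  {X : Type w} [AddCommGroup X] [Coded L M X] [DefAdd L M X]
  {S : Subring (AddMonoid.End X)} (hS : ∀ s ∈ S, DefFun L M s)
  (hconn : IsConn L M (⊤ : AddSubgroup X))
  (hirr : ∀ W : AddSubgroup X, DefSet L M (W : Set X) → IsConn L M W →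
    (∀ s ∈ S, ∀ x ∈ W, s x ∈ W) → W = ⊥ ∨ W = ⊤)
  {C : Subring (AddMonoid.End X)} (hC : ∀ t, t ∈ C ↔ DefFun L M t ∧ ∀ s ∈ S, s * t = t * s)

theorem DefSet.exists_finset {ι Y : Type*} [Coded L M Y] (s : Finset ι) {φ : ι → Y → Prop}
    (h : ∀ i ∈ s, DefSet L M {x | φ i x}) : DefSet L M {x | ∃ i ∈ s, φ i x} := by
  have := (DefSet.forall_finset s (φ := fun i x => ¬ φ i x) fun i hi => (h i hi).not).not
  simpa only [not_forall, not_not, exists_prop] using this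

omit [DefAdd L M X] in
include hconn hirr hC in
-- Right multiplication by a surjective `t` is injective on the finite ring `C`, hence hits 1.
theorem bijective_of_finite_centralizer [Finite C] {t : AddMonoid.End X} (ht : t ∈ C)
    (hne : t ≠ 0) : Function.Bijective t := by
  have hsurj := surjective_of_commute hconn hirr ((hC t).mp ht).1 ((hC t).mp ht).2 hne
  refine ⟨?_, hsurj⟩
  have hinj : Function.Injective fun u : C => u * ⟨t, ht⟩ := by
    intro u u' h
    refine Subtype.ext (DFunLike.ext _ _ fun x => ?_)
    obtain ⟨y, rfl⟩ := hsurj x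
    exact DFunLike.congr_fun (congrArg Subtype.val h) y
  obtain ⟨u, hu⟩ := Finite.surjective_of_injective hinj 1
  intro x y hxy
  have h : ∀ z, u.1 (t z) = z := fun z => DFunLike.congr_fun (congrArg Subtype.val hu) z
  rw [← h x, hxy, h y]

omit [DefAdd L M X] in
theorem defSet_action_of_finite [Finite C] (hCd : ∀ t ∈ C, DefFun L M t) (v : X) :
    DefSet L M {p : X × (X × X) | ∃ t ∈ C, t v = p.1 ∧ t p.2.1 = p.2.2} := by
  have hfin : (C : Set (AddMonoid.End X)).Finite := Set.toFinite (C : Set (AddMonoid.End X))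
  have := DefSet.exists_finset (L := L) (M := M) hfin.toFinset
    (φ := fun t (p : X × (X × X)) => t v = p.1 ∧ t p.2.1 = p.2.2) (by
      intro t ht
      have hd := hCd t (hfin.mem_toFinset.mp ht)
      exact .and (.eq (by fun_prop) (by fun_prop)) (.eq (by fun_prop) (by fun_prop)))
  simpa using this

variable {F : Set (AddMonoid.End X)} (hFS : ∀ f ∈ F, f ∈ S) (hF : UnifTDef L M κ F)
  (hFc : Cardinal.continuum < Cardinal.mk F)

include D hM hκ hS hconn hirr hC hFS hF hFc in
/-- The case of an infinite centraliser: the module `X` is embedded in a power of a line, and the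
centraliser acts on the line simply transitively. -/
theorem exists_line_of_infinite_centralizer [Infinite C] :
    ∃ (s : AddMonoid.End X) (hs : DefFun L M s) (J : Finset (AddMonoid.End X)),
      (∀ j ∈ J, DefFun L M j) ∧ (∀ t ∈ C, s * t = t * s) ∧
      letI := Coded.addSubgroup (defSet_range hs)
      ∃ (v : AddMonoidHom.range s) (τ : AddMonoidHom.range s → AddMonoid.End (AddMonoidHom.range s)),
        v ≠ 0 ∧ DefFun L M (fun p : AddMonoidHom.range s × AddMonoidHom.range s => τ p.1 p.2) ∧
        (∀ t ∈ C, t ≠ 0 → Function.Bijective t) ∧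
        ∀ w : AddMonoidHom.range s, ∃ t ∈ C, t v = (w : X) ∧ ∀ x y, t x = y ↔ ∀ j ∈ J,
          (⟨s (j y), j y, rfl⟩ : AddMonoidHom.range s) = τ w ⟨s (j x), j x, rfl⟩ := by
  classical
  have hFinf : F.Infinite := by
    rw [← Set.infinite_coe_iff, Cardinal.infinite_iff]
    exact Cardinal.aleph0_le_continuum.trans hFc.le
  obtain ⟨s, hs, hs0, hmin⟩ := exists_minimal_range D hS hconn (by
    obtain ⟨f, hf, f', hf', h⟩ := hFinf.nontrivial
    exact ⟨f - f', S.sub_mem (hFS f hf) (hFS f' hf'), sub_ne_zero.mpr h⟩)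
  obtain ⟨J, hJ, hJC⟩ := exists_finset_inf_ker D hS hirr hs hs0
  have hsd := hS s hs
  let hcod := Coded.addSubgroup (defSet_range hsd)
  have hadd : DefAdd L M (AddMonoidHom.range s) := DefAdd.addSubgroup (defSet_range hsd)
  obtain ⟨I, hI, hItop⟩ := exists_finset_sup_map_eq_top D hS hirr (defSet_range hsd)
    (isConn_range hconn hsd) (fun h => hs0 (AddMonoidHom.range_eq_bot_iff.mp h))
  -- an unbounded family of endomorphisms of the line
  obtain ⟨⟨i, j⟩, hij⟩ := exists_continuum_lt_image (ι := I × J) hFc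
    (fun p f => lineEnd s (p.2.1 * f * p.1.1)) (by
      intro f hf f' hf' h
      have hg := S.sub_mem (hFS f hf) (hFS f' hf')
      refine sub_eq_zero.mp (AddMonoidHom.ker_eq_top_iff.mp (top_le_iff.mp ?_))
      rw [← hItop]
      refine Finset.sup_le fun i hi => ?_
      have hgi := S.mul_mem hg (hI i hi)
      -- `(f - f') i` sends the line to a connected group killed by every `s j`, hence to zero, and
      -- the images of the line under `I` generate `X`.
      have hbot := hJC _ (defSet_map (hS _ hgi) (defSet_range hsd))
        ((isConn_range hconn hsd).map (defSet_range hsd) (hS _ hgi)) (by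
          rintro j hj _ ⟨x, hx, rfl⟩
          have h1 : s (j (f (i x))) = s (j (f' (i x))) := congrArg Subtype.val
            (DFunLike.congr_fun (h (⟨i, hi⟩, ⟨j, hj⟩)) (⟨x, hx⟩ : AddMonoidHom.range s))
          change s (j (f (i x) - f' (i x))) = 0
          rw [map_sub, map_sub, h1, sub_self])
      rintro _ ⟨x, hx, rfl⟩
      have : (f - f') (i x) ∈ (⊥ : AddSubgroup X) := hbot ▸ ⟨x, hx, rfl⟩
      exact this)
  set F' := (fun f => lineEnd s (j.1 * f * i.1)) '' F with hF'
  have hF'R : ∀ f ∈ F', f ∈ lineRing hs := by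
    rintro _ ⟨f, hf, rfl⟩
    exact lineEnd_mem hs (S.mul_mem (S.mul_mem (hJ _ j.2) (hFS f hf)) (hI _ i.2))
  have hF't : UnifTDef L M κ F' := hF.lineEnd hsd (hS _ (hI _ i.2)) (hS _ (hJ _ j.2))
  have hF'inf : F'.Infinite := by
    rw [← Set.infinite_coe_iff, Cardinal.infinite_iff]
    exact Cardinal.aleph0_le_continuum.trans hij.le
  have hRd : ∀ ρ ∈ lineRing hs, DefFun L M ρ := fun ρ hρ => defFun_of_mem_lineRing hS hs hρ
  have hRs : ∀ ρ ∈ lineRing hs, ρ ≠ 0 → Function.Surjective ρ := fun ρ hρ hne =>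
    surjective_of_mem_lineRing hs hmin hρ hne
  -- the centraliser acts on the line by injective maps
  have hts : ∀ t ∈ C, ∀ x, s (t x) = t (s x) := fun t ht x =>
    DFunLike.congr_fun (((hC t).mp ht).2 s hs) x
  let res : C → AddMonoid.End (AddMonoidHom.range s) := fun t =>
    { toFun := fun y => ⟨t.1 y, by
        obtain ⟨x, hx⟩ := y.2
        exact ⟨t.1 x, by rw [← hx]; exact hts _ t.2 x⟩⟩
      map_zero' := Subtype.ext (map_zero t.1)
      map_add' := fun x y => Subtype.ext (map_add t.1 x.1 y.1) }
  have hCs : ∀ t ∈ C, t ≠ 0 → Function.Surjective t := fun t ht hne =>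
    surjective_of_commute hconn hirr ((hC t).mp ht).1 ((hC t).mp ht).2 hne
  have hresR : ∀ t : C, ∀ ρ ∈ lineRing hs, ∀ x, ρ (res t x) = res t (ρ x) := by
    rintro ⟨t, ht⟩ _ ⟨r, hr, rfl⟩ x
    refine Subtype.ext ?_
    change s (r (t x)) = t (s (r x))
    rw [← hts t ht]
    exact congrArg s (DFunLike.congr_fun (((hC t).mp ht).2 r hr) x.1)
  have hresinj : ∀ t : C, t ≠ 0 → Function.Injective (res t) := by
    rintro ⟨t, ht⟩ hne
    have hne : t ≠ 0 := fun h => hne (Subtype.ext h)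
    have hco := defFun_coe (defSet_range hsd)
    have htd := ((hC t).mp ht).1
    refine injective_of_commute D hRd hRs hF'R hij ?_ ?_ (hresR ⟨t, ht⟩)
    · refine defFun_to_addSubgroup (defSet_range hsd) ?_
      change DefFun L M fun y : AddMonoidHom.range s => t (y : X)
      fun_prop
    · rintro ⟨_, x, rfl⟩
      obtain ⟨y, rfl⟩ := hCs t ht hne x
      exact ⟨⟨s y, y, rfl⟩, Subtype.ext (hts t ht y).symm⟩
  have hRb : ∀ ρ ∈ lineRing hs, ρ ≠ 0 → Function.Bijective ρ := by
    intro ρ hρ hne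
    refine ⟨(injective_iff_map_eq_zero ρ).mpr fun x hx => ?_, hRs ρ hρ hne⟩
    by_contra hx0
    have hfin := finite_ker_of_surjective D (hRd ρ hρ) (hRs ρ hρ hne)
    -- `C` preserves the finite kernel of `ρ`, but `t ↦ t x` is injective on the infinite `C` when
    -- `x ≠ 0`.
    have hmem : ∀ t : C, res t x ∈ (AddMonoidHom.ker ρ : Set (AddMonoidHom.range s)) := fun t => by
      change ρ (res t x) = 0
      rw [hresR t ρ hρ, hx, map_zero]
    have := hfin.to_subtype
    refine not_injective_infinite_finite
      (fun t : C => (⟨_, hmem t⟩ : (AddMonoidHom.ker ρ : Set (AddMonoidHom.range s)))) ?_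
    intro t t' htt
    by_contra hne
    refine hx0 (hresinj (t - t') (sub_ne_zero.mpr hne) ?_)
    refine Subtype.ext ?_
    have h1 : t.1 x = t'.1 x := congrArg (fun y => y.1.1) htt
    change t.1 x - t'.1 x = (t - t').1 0
    rw [h1, sub_self, map_zero]
  obtain ⟨v, hv⟩ : ∃ v : AddMonoidHom.range s, v ≠ 0 := by
    obtain ⟨x, hx⟩ := DFunLike.ne_iff.mp hs0
    exact ⟨⟨s x, x, rfl⟩, fun h => hx (congrArg Subtype.val h)⟩
  obtain ⟨τ, hτv, hτR, hτd, hτq⟩ := exists_transitive_commuting D hM hκ (lineRing hs) hRb hRd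
    hF'R hF't hF'inf (isConn_line hconn hsd) (irreducible_line D hS hirr hs) hv
  -- every element lies on an equivariant image of the line
  have hline : ∀ x : X, ∃ c : AddMonoidHom.range s →+ X, DefFun L M c ∧ c v = x ∧
      ∀ r ∈ S, ∀ w, (⟨s (r (c w)), r (c w), rfl⟩ : AddMonoidHom.range s) =
        τ w ⟨s (r x), r x, rfl⟩ := by
    let G : AddSubgroup X :=
      { carrier := {x | ∃ c : AddMonoidHom.range s →+ X, DefFun L M c ∧ c v = x ∧
          ∀ r ∈ S, ∀ w, (⟨s (r (c w)), r (c w), rfl⟩ : AddMonoidHom.range s) =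
            τ w ⟨s (r x), r x, rfl⟩}
        zero_mem' := by
          refine ⟨0, DefFun.const 0, rfl, fun r hr w => ?_⟩
          exact (map_zero (lineEnd s r)).trans (((congrArg (τ w) (map_zero (lineEnd s r))).trans
            (map_zero (τ w))).symm)
        add_mem' := by
          rintro _ _ ⟨c, hc, rfl, hcr⟩ ⟨c', hc', rfl, hcr'⟩
          refine ⟨c + c', DefFun.add hc hc', rfl, fun r hr w => ?_⟩
          have e : ∀ a b : X, (⟨s (r (a + b)), r (a + b), rfl⟩ : AddMonoidHom.range s) =
              ⟨s (r a), r a, rfl⟩ + ⟨s (r b), r b, rfl⟩ := fun a b => Subtype.ext (by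
            change s (r (a + b)) = s (r a) + s (r b)
            rw [map_add, map_add])
          refine (e _ _).trans ?_
          rw [e, map_add, hcr r hr, hcr' r hr]
        neg_mem' := by
          rintro _ ⟨c, hc, rfl, hcr⟩
          refine ⟨-c, DefFun.neg hc, rfl, fun r hr w => ?_⟩
          have e : ∀ a : X, (⟨s (r (-a)), r (-a), rfl⟩ : AddMonoidHom.range s) =
              -⟨s (r a), r a, rfl⟩ := fun a => Subtype.ext (by
            change s (r (-a)) = -s (r a)
            rw [map_neg, map_neg])
          refine (e _).trans ?_
          rw [e, map_neg, hcr r hr] }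
    have hG : (⊤ : AddSubgroup X) ≤ G := by
      rw [← hItop]
      refine Finset.sup_le fun i hi => ?_
      rintro _ ⟨x, hx, rfl⟩
      obtain ⟨q, hqd, hqv, hq⟩ := hτq ⟨x, hx⟩
      have hco := defFun_coe (defSet_range hsd)
      have hid := hS i (hI i hi)
      refine ⟨(i : X →+ X).comp ((AddMonoidHom.range s).subtype.comp q), ?_, ?_, fun r hr w => ?_⟩
      · change DefFun L M fun y : AddMonoidHom.range s => i ((q y : AddMonoidHom.range s) : X)
        fun_prop
      · exact congrArg (fun y : AddMonoidHom.range s => i y.1) hqv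
      · change lineEnd s (r * i) (q w) = τ w (lineEnd s (r * i) ⟨x, hx⟩)
        rw [hτR w _ (lineEnd_mem hs (S.mul_mem hr (hI i hi))), ← hqv, hq, hτv]
    exact fun x => hG (AddSubgroup.mem_top x)
  -- The choice of `J` only excludes connected groups. Here `x` lies in the image of `c`, which is
  -- connected and is killed along with `x`, so the maps `s j` jointly separate points.
  have hN : ∀ x : X, (∀ j ∈ J, s (j x) = 0) → x = 0 := by
    intro x hx
    obtain ⟨c, hcd, rfl, hc⟩ := hline x
    have hu : DefSet L M ((⊤ : AddSubgroup (AddMonoidHom.range s)) : Set (AddMonoidHom.range s)) :=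
      DefSet.univ
    have hbot := hJC _ (defSet_map hcd hu) ((isConn_line hconn hsd).map hu hcd) (by
      rintro j hj _ ⟨w, -, rfl⟩
      have h1 : (⟨s (j (c v)), j (c v), rfl⟩ : AddMonoidHom.range s) = 0 := Subtype.ext (hx j hj)
      have h2 := hc j (hJ j hj) w
      rw [h1, map_zero] at h2
      exact congrArg Subtype.val h2)
    have : c v ∈ (⊥ : AddSubgroup X) := hbot ▸ ⟨v, trivial, rfl⟩
    exact this
  have hN' : ∀ x y : X, (∀ j ∈ J, s (j x) = s (j y)) → x = y := fun x y h =>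
    sub_eq_zero.mp (hN _ fun j hj => by rw [map_sub, map_sub, h j hj, sub_self])
  choose c hcd hcv hc using hline
  refine ⟨s, hsd, J, fun j hj => hS j (hJ j hj), fun t ht => ((hC t).mp ht).2 s hs, v, τ, hv, hτd,
    fun t ht hne => ⟨(injective_iff_map_eq_zero t).mpr fun x hx => hN x fun j hj => ?_,
      hCs t ht hne⟩, fun w => ?_⟩
  · have h1 : t (s (j x)) = 0 := by
      have h2 : j (t x) = t (j x) := DFunLike.congr_fun (((hC t).mp ht).2 j (hJ j hj)) x
      rw [← hts t ht, ← h2, hx, map_zero, map_zero]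
    have h3 := hresinj ⟨t, ht⟩ (fun h => hne (congrArg Subtype.val h))
      (a₁ := ⟨s (j x), j x, rfl⟩) (a₂ := 0) (Subtype.ext (h1.trans (map_zero t).symm))
    exact congrArg Subtype.val h3
  -- Coordinates determine `c x w`. Thus `x ↦ c x w` does not depend on the choice of `c x`, and its
  -- additivity, definability and commutation with `S` can all be checked on coordinates.
  · have hchar : ∀ x y, c x w = y ↔ ∀ j ∈ J,
        (⟨s (j y), j y, rfl⟩ : AddMonoidHom.range s) = τ w ⟨s (j x), j x, rfl⟩ := by
      intro x y
      constructor
      · rintro rfl j hj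
        exact hc x j (hJ j hj) w
      · intro h
        exact hN' _ _ fun j hj =>
          congrArg Subtype.val ((hc x j (hJ j hj) w).trans (h j hj).symm)
    let t : AddMonoid.End X :=
      { toFun := fun x => c x w
        map_zero' := (hchar 0 0).mpr fun j hj => by
          exact (map_zero (lineEnd s j)).trans (((congrArg (τ w) (map_zero (lineEnd s j))).trans
            (map_zero (τ w))).symm)
        map_add' := fun x y => (hchar _ _).mpr fun j hj => by
          have e : ∀ a b : X, (⟨s (j (a + b)), j (a + b), rfl⟩ : AddMonoidHom.range s) =
              ⟨s (j a), j a, rfl⟩ + ⟨s (j b), j b, rfl⟩ := fun a b => Subtype.ext (by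
            change s (j (a + b)) = s (j a) + s (j b)
            rw [map_add, map_add])
          rw [e, e, map_add, hc x j (hJ j hj), hc y j (hJ j hj)] }
    have htd : DefFun L M t := by
      refine DefFun.of_graph (DefSet.forall_finset J (φ := fun j (p : X × X) =>
        (⟨s (j p.2), j p.2, rfl⟩ : AddMonoidHom.range s) = τ w ⟨s (j p.1), j p.1, rfl⟩)
        fun j hj => DefSet.eq ?_ ?_) hchar
      · have hjd := hS j (hJ j hj)
        exact defFun_to_addSubgroup (defSet_range hsd)
          (f := fun p : X × X => ⟨s (j p.2), j p.2, rfl⟩) (by fun_prop)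
      · have hjd := hS j (hJ j hj)
        have h1 : DefFun L M fun p : X × X => (⟨s (j p.1), j p.1, rfl⟩ : AddMonoidHom.range s) :=
          defFun_to_addSubgroup (defSet_range hsd) (by fun_prop)
        exact DefFun.comp (f := fun p : X × X =>
          (w, (⟨s (j p.1), j p.1, rfl⟩ : AddMonoidHom.range s))) hτd (by fun_prop)
    have htC : t ∈ C := (hC t).mpr ⟨htd, fun r hr => DFunLike.ext _ _ fun x =>
      ((hchar (r x) (r (c x w))).mpr fun j hj => hc x (j * r) (S.mul_mem (hJ j hj) hr) w).symm⟩
    refine ⟨t, htC, (hchar _ _).mpr fun j hj => ?_, hchar⟩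
    change lineEnd s j w = τ w (lineEnd s j v)
    rw [hτR w _ (lineEnd_mem hs (hJ j hj)), hτv]

include D hM hκ hS hconn hirr hC hFS hF hFc in
-- Evaluation at a single vector `v` serves as the parametrisation of `C`, so that one ternary
-- relation encodes its whole action.
theorem centralizer_bijective_and_definable :
    (∀ t ∈ C, t ≠ 0 → Function.Bijective t) ∧ ∃ v : X, v ≠ 0 ∧
      DefSet L M {p : X × (X × X) | ∃ t ∈ C, t v = p.1 ∧ t p.2.1 = p.2.2} := by
  have hCd : ∀ t ∈ C, DefFun L M t := fun t ht => ((hC t).mp ht).1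
  rcases finite_or_infinite C with _ | _
  · refine ⟨fun t ht => bijective_of_finite_centralizer hconn hirr hC ht, ?_⟩
    have hFinf : F.Infinite := by
      rw [← Set.infinite_coe_iff, Cardinal.infinite_iff]
      exact Cardinal.aleph0_le_continuum.trans hFc.le
    obtain ⟨f, -, f', -, hne⟩ := hFinf.nontrivial
    obtain ⟨x, hx⟩ := DFunLike.ne_iff.mp hne
    exact ⟨f x - f' x, sub_ne_zero.mpr hx, defSet_action_of_finite hCd _⟩
  · obtain ⟨s, hsd, J, hJ, hst, v, τ, hv, hτd, hbij, hτ⟩ := exists_line_of_infinite_centralizer D hM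
      hκ hS hconn hirr hC hFS hF hFc
    let hcod := Coded.addSubgroup (defSet_range hsd)
    have hco := defFun_coe (defSet_range hsd)
    have hv' : (v : X) ≠ 0 := fun h => hv (Subtype.ext h)
    refine ⟨hbij, v, hv', ?_⟩
    have : DefSet L M {p : X × (X × X) | ∃ w : AddMonoidHom.range s, (w : X) = p.1 ∧ ∀ j ∈ J,
        (⟨s (j p.2.2), j p.2.2, rfl⟩ : AddMonoidHom.range s) =
          τ w ⟨s (j p.2.1), j p.2.1, rfl⟩} := by
      refine DefSet.ex (.and (.eq ?_ ?_) (DefSet.forall_finset J fun j hj => .eq ?_ ?_))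
      · fun_prop
      · fun_prop
      · have hjd := hJ j hj
        exact defFun_to_addSubgroup (defSet_range hsd)
          (f := fun q : (X × (X × X)) × AddMonoidHom.range s => ⟨s (j q.1.2.2), j q.1.2.2, rfl⟩)
          (by fun_prop)
      · have hjd := hJ j hj
        have h1 : DefFun L M fun q : (X × (X × X)) × AddMonoidHom.range s =>
            (⟨s (j q.1.2.1), j q.1.2.1, rfl⟩ : AddMonoidHom.range s) :=
          defFun_to_addSubgroup (defSet_range hsd) (by fun_prop)
        exact DefFun.comp (f := fun q : (X × (X × X)) × AddMonoidHom.range s =>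
          (q.2, (⟨s (j q.1.2.1), j q.1.2.1, rfl⟩ : AddMonoidHom.range s))) hτd (by fun_prop)
    refine (congrArg (DefSet L M) ?_).mp this
    ext ⟨a, b, d⟩
    constructor
    · rintro ⟨w, rfl, h⟩
      obtain ⟨t, ht, htv, htx⟩ := hτ w
      exact ⟨t, ht, htv, (htx b d).mpr h⟩
    · rintro ⟨t, ht, hta, htb⟩
      obtain ⟨x, hx⟩ := v.2
      -- `t` commutes with `s`, so it maps `v = s x` to a point of the line.
      have hw : a ∈ AddMonoidHom.range s := by
        exact ⟨t x, (DFunLike.congr_fun (hst t ht) x).trans ((congrArg t hx).trans hta)⟩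
      obtain ⟨t', ht', htv', htx'⟩ := hτ ⟨a, hw⟩
      -- `t - t'` kills the non-zero `v`, and non-zero elements of `C` are injective.
      have htt : t = t' := by
        by_contra hne
        have h1 := (hbij _ (C.sub_mem ht ht') (sub_ne_zero.mpr hne)).1
        refine hv' (h1 ?_)
        rw [map_zero]
        change t v - t' v = 0
        rw [htv', sub_eq_zero]
        exact hta
      subst htt
      exact ⟨⟨a, hw⟩, rfl, (htx' b d).mp htb⟩

end Centralizer

end FinDim

namespace FinDim

/-! ### Definable abelian groups as coded types -/

namespace DefAbGroup

variable {L : FirstOrder.Language.{u, v}} {M : Type w} [L.Structure M] {κ : Cardinal.{w}}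
variable {V : DefAbGroup L M}

instance : Coded L M V.Elem where
  idx := Fin V.arity
  finite_idx := inferInstance
  IsCode a x := x.1 = V.sort.cls a
  exists_code := exists_rep
  code_unique h h' := Subtype.ext (h.trans h'.symm)
  definable_code := by
    exact isDefinableMap_id (V := V)

theorem defFun_iff {f : V.Elem → V.Elem} : DefFun L M f ↔ V.IsDefinableMap f := by
  refine iff_of_eq (congrArg (Set.Definable Set.univ L) (Set.ext fun p => ?_))
  constructor
  · rintro ⟨⟨x, y⟩, hxy, hx, hy⟩
    have hxy : f x = y := hxy
    subst hxy
    exact ⟨x, hx, hy⟩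
  · rintro ⟨x, hx, hy⟩
    exact ⟨(x, f x), rfl, hx, hy⟩

theorem defSet_subgroup_iff {W : AddSubgroup V.Elem} :
    DefSet L M (W : Set V.Elem) ↔ V.IsDefinableSubgroup W := Iff.rfl

theorem isConn_iff {W : AddSubgroup V.Elem} : IsConn L M W ↔ V.IsConnected W := Iff.rfl

theorem definableRel_iff {R : V.Elem → V.Elem → V.Elem → Prop} :
    DefSet L M {p : V.Elem × (V.Elem × V.Elem) | R p.1 p.2.1 p.2.2} ↔
      ImagSort.DefinableRel₃ V.sort V.sort V.sort fun a b c =>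
        ∃ x y z : V.Elem, x.1 = a ∧ y.1 = b ∧ z.1 = c ∧ R x y z := by
  refine iff_of_eq (congrArg (Set.Definable Set.univ L) (Set.ext fun p => ?_))
  constructor
  · rintro ⟨⟨x, y, z⟩, h, hx, hy, hz⟩
    exact ⟨x, y, z, hx, hy, hz, h⟩
  · rintro ⟨x, y, z, hx, hy, hz, h⟩
    exact ⟨(x, y, z), h, hx, hy, hz⟩

instance : DefAdd L M V.Elem where
  defFun_add := by
    have h : DefSet L M {p : V.Elem × (V.Elem × V.Elem) | p.1 + p.2.1 = p.2.2} := by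
      refine definableRel_iff (R := fun x y z => x + y = z) |>.mpr ?_
      refine definable_of_eq V.definable_add' (Set.ext fun p => ?_)
      constructor
      · rintro ⟨x, y, z, hx, hy, hz, rfl⟩
        exact ⟨x, y, hx, hy, hz⟩
      · rintro ⟨x, y, hx, hy, hz⟩
        exact ⟨x, y, x + y, hx, hy, hz, rfl⟩
    exact DefSet.preimage_reindex (f := fun p : (V.Elem × V.Elem) × V.Elem => (p.1.1, p.1.2, p.2))
      (IsReindex.id.fst.fst.prodMk (IsReindex.id.fst.snd.prodMk IsReindex.id.snd)) h

/-! ### Type-definable families -/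

/-- The image of a set of definable endomorphisms in the ring of all endomorphisms. -/
abbrev toEnd (F : Set V.DefEnd) : Set (AddMonoid.End V.Elem) := Subtype.val '' F

/-- The difference between the two notions is that `UnifTDef` wants an endomorphism for every
parameter, so parameters whose fibre is no such graph must be removed. -/
theorem IsTypeDefinable.unifTDef (hκ : Cardinal.aleph0 ≤ κ) {F : Set V.DefEnd}
    (hF : IsTypeDefinable κ F) : UnifTDef L M κ (toEnd F) := by
  obtain ⟨m, G, 𝒟, hG, h𝒟, hdef, rfl⟩ := hF
  let N := Fin V.arity → M
  let rel : (Fin m → M) → N → N → Prop := fun c a b => Sum.elim c (Sum.elim a b) ∈ G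
  let code : N → V.Elem → Prop := fun a x => Coded.Code (M := M) L a x
  let ev : (Fin m → M) → V.Elem → V.Elem → Prop := fun c x y =>
    ∃ a b : N, code a x ∧ code b y ∧ rel c a b
  have hrel : DefSet L M {p : (Fin m → M) × (N × N) | rel p.1 p.2.1 p.2.2} := by
    refine definable_of_eq hG (Set.ext fun p => ?_)
    have key : Sum.elim (p ∘ Sum.inl) (Sum.elim (p ∘ Sum.inr ∘ Sum.inl) (p ∘ Sum.inr ∘ Sum.inr))
        = p := by
      funext i; rcases i with i | i | i <;> rfl
    constructor
    · rintro ⟨⟨c, a, b⟩, h, hc, ha, hb⟩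
      have hc : p ∘ Sum.inl = c := hc
      have ha : p ∘ Sum.inr ∘ Sum.inl = a := ha
      have hb : p ∘ Sum.inr ∘ Sum.inr = b := hb
      subst hc ha hb
      exact (congrArg (· ∈ G) key).mp h
    · intro h
      exact ⟨(_, _, _), (congrArg (· ∈ G) key).mpr h, rfl, rfl, rfl⟩
  have hcode : DefSet L M {p : N × V.Elem | code p.1 p.2} := by
    refine definable_of_eq
      (Coded.definable_code (L := L) (M := M) (X := V.Elem)) (Set.ext fun p => ?_)
    constructor
    · rintro ⟨⟨a, x⟩, h, ha, hx⟩
      have ha : p ∘ Sum.inl = a := ha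
      subst ha
      exact ⟨x, h, hx⟩
    · rintro ⟨x, h, hx⟩
      exact ⟨(_, x), h, rfl, hx⟩
  have hev : DefSet L M {p : (Fin m → M) × (V.Elem × V.Elem) | ev p.1 p.2.1 p.2.2} := by
    refine DefSet.ex (DefSet.ex (.and ?_ (.and ?_ ?_)))
    · exact DefSet.preimage (f := fun q : (((Fin m → M) × (V.Elem × V.Elem)) × N) × N =>
        (q.1.2, q.1.1.2.1)) (by fun_prop) hcode
    · exact DefSet.preimage (f := fun q : (((Fin m → M) × (V.Elem × V.Elem)) × N) × N =>
        (q.2, q.1.1.2.2)) (by fun_prop) hcode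
    · exact DefSet.preimage (f := fun q : (((Fin m → M) × (V.Elem × V.Elem)) × N) × N =>
        (q.1.1.1, q.1.2, q.2)) (by fun_prop) hrel
  have hgraph : ∀ (c : Fin m → M) (f : V.Elem → V.Elem),
      V.graph f = {p | Sum.elim c p ∈ G} ↔
        ∀ a b, rel c a b ↔ ∃ x, code a x ∧ code b (f x) := by
    intro c f
    constructor
    · intro h a b
      exact (Set.ext_iff.mp h (Sum.elim a b)).symm
    · intro h
      ext p
      have := h (p ∘ Sum.inl) (p ∘ Sum.inr)
      rw [← Sum.elim_comp_inl_inr p]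
      exact this.symm
  have hevf : ∀ (c : Fin m → M) (f : V.Elem → V.Elem), V.graph f = {p | Sum.elim c p ∈ G} →
      ∀ x y, ev c x y ↔ f x = y := by
    intro c f h x y
    rw [hgraph] at h
    constructor
    · rintro ⟨a, b, ha, hb, hab⟩
      obtain ⟨x', hx', hy'⟩ := (h a b).mp hab
      obtain rfl := Coded.code_unique ha hx'
      exact Coded.code_unique hy' hb
    · rintro rfl
      obtain ⟨a, ha⟩ := Coded.exists_code (L := L) (M := M) x
      obtain ⟨b, hb⟩ := Coded.exists_code (L := L) (M := M) (f x)
      exact ⟨a, b, ha, hb, (h a b).mpr ⟨x, ha, hb⟩⟩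
  -- A definable condition on `c`: the fibre of `G` consists of whole classes of codes and is the
  -- graph of an everywhere defined additive map.
  let good : (Fin m → M) → Prop := fun c =>
    (∀ a b, rel c a b ↔ ∃ x y, code a x ∧ code b y ∧ ev c x y) ∧
    (∀ x, ∃ y, ev c x y) ∧ (∀ x y y', ev c x y → ev c x y' → y = y') ∧
    (∀ x x' y y', ev c x y → ev c x' y' → ev c (x + x') (y + y'))
  have hgood : DefSet L M {c | good c} := by
    have hev' : ∀ {Z : Type w} [Coded L M Z] {c : Z → Fin m → M} {x y : Z → V.Elem},
        DefFun L M c → DefFun L M x → DefFun L M y → DefSet L M {z | ev (c z) (x z) (y z)} :=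
      fun {Z} _ {c x y} hc hx hy =>
        DefSet.preimage (f := fun z => (c z, x z, y z)) (by fun_prop) hev
    have hcode' : ∀ {Z : Type w} [Coded L M Z] {a : Z → N} {x : Z → V.Elem},
        DefFun L M a → DefFun L M x → DefSet L M {z | code (a z) (x z)} :=
      fun {Z} _ {a x} ha hx => DefSet.preimage (f := fun z => (a z, x z)) (by fun_prop) hcode
    have hrel' : DefSet L M {q : ((Fin m → M) × N) × N | rel q.1.1 q.1.2 q.2} :=
      DefSet.preimage (f := fun q : ((Fin m → M) × N) × N => (q.1.1, q.1.2, q.2))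
        (by fun_prop) hrel
    have hR : DefSet L M {q : ((Fin m → M) × N) × N |
        ∃ x y, code q.1.2 x ∧ code q.2 y ∧ ev q.1.1 x y} := by
      refine .ex (.ex (.and (hcode' ?_ ?_) (.and (hcode' ?_ ?_) (hev' ?_ ?_ ?_)))) <;> fun_prop
    refine .and (.all (.all ?_)) (.and (.all (.ex (hev' ?_ ?_ ?_)))
      (.and (.all (.all (.all (.imp (hev' ?_ ?_ ?_) (.imp (hev' ?_ ?_ ?_) (.eq ?_ ?_))))))
        (.all (.all (.all (.all (.imp (hev' ?_ ?_ ?_) (.imp (hev' ?_ ?_ ?_) (hev' ?_ ?_ ?_)))))))))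
    · simp only [iff_iff_implies_and_implies]
      exact .and (.imp hrel' hR) (.imp hR hrel')
    all_goals fun_prop
  refine ⟨Fin m → M, inferInstance, ⋂₀ 𝒟 ∩ {c | good c}, ev, ?_, hev, ?_, ?_⟩
  · refine TDef.inter hκ ⟨𝒟, fun D => D.1, h𝒟, fun D => defSet_tuple_iff.mpr (hdef D D.2), ?_⟩
      (hgood.tdef hκ)
    exact Set.sInter_eq_iInter
  · rintro c ⟨hc, h1, h2, h3, h4⟩
    choose f hf using h2
    have hff : ∀ x y, ev c x y ↔ f x = y := fun x y =>
      ⟨fun h => h3 _ _ _ (hf x) h, fun h => h ▸ hf x⟩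
    let g : AddMonoid.End V.Elem := AddMonoidHom.mk' f fun x y =>
      (hff _ _).mp (h4 _ _ _ _ (hf x) (hf y))
    have hg : V.graph g = {p | Sum.elim c p ∈ G} := by
      refine (hgraph c g).mpr fun a b => (h1 a b).trans ?_
      constructor
      · rintro ⟨x, y, hx, hy, h⟩
        obtain rfl := (hff x y).mp h
        exact ⟨x, hx, hy⟩
      · rintro ⟨x, hx, hy⟩
        exact ⟨x, f x, hx, hy, hf x⟩
    have hgd : g ∈ V.DefEnd := by
      refine defFun_iff.mp (DefFun.of_graph (G := fun x y => ev c x y) ?_ fun x y => (hff x y).symm)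
      exact DefSet.preimage (f := fun q : V.Elem × V.Elem => (c, q.1, q.2)) (by fun_prop) hev
    exact ⟨g, ⟨⟨g, hgd⟩, ⟨c, hc, hg⟩, rfl⟩, hff⟩
  · rintro _ ⟨f, ⟨c, hc, hf⟩, rfl⟩
    have hff := hevf c f.1 hf
    refine ⟨c, ⟨hc, fun a b => ((hgraph c _).mp hf a b).trans ?_, fun x => ⟨_, (hff _ _).mpr rfl⟩,
      fun x y y' h h' => ((hff _ _).mp h).symm.trans ((hff _ _).mp h'), ?_⟩, hff⟩
    · constructor
      · rintro ⟨x, hx, hy⟩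
        exact ⟨x, _, hx, hy, (hff _ _).mpr rfl⟩
      · rintro ⟨x, y, hx, hy, h⟩
        exact ⟨x, hx, ((hff x y).mp h) ▸ hy⟩
    · intro x x' y y' h h'
      rw [hff] at h h' ⊢
      rw [map_add, h, h']

/-- Fewer than `κ` pieces of size at most the continuum have a union of size less than `κ`. -/
theorem IsInvariant.exists_continuum_lt (hκ : Cardinal.aleph0 ≤ κ) (hκ₀ : Cardinal.continuum < κ)
    {F : Set V.DefEnd} (hF : IsInvariant κ F) (hcard : κ ≤ Cardinal.mk F) :
    ∃ F' ⊆ F, IsTypeDefinable κ F' ∧ Cardinal.continuum < Cardinal.mk F' := by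
  obtain ⟨𝓕, h𝓕, htd, rfl⟩ := hF
  by_contra! hcon
  refine absurd hcard (not_le.mpr ?_)
  refine lt_of_le_of_lt (Cardinal.mk_sUnion_le 𝓕) (Cardinal.mul_lt_of_lt hκ h𝓕 ?_)
  exact lt_of_le_of_lt (ciSup_le' fun F' : 𝓕 =>
    hcon F'.1 (Set.subset_sUnion_of_mem F'.2) (htd F'.1 F'.2)) hκ₀

/-! ### Definable rings of endomorphisms -/

/-- The orbit `{t v : t ∈ T}` serves as `K`, inside the sort of `V` itself, which is therefore real
if `V` is. Addition on `K` is that of `V`, and the product comes from the action through `(t t') v =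
t (t' v)`. -/
theorem isDefinableRing {T : Subring V.DefEnd} {v : V.Elem}
    (hinj : ∀ t ∈ T, t ≠ 0 → t.1 v ≠ 0)
    (hA : DefSet L M {p : V.Elem × (V.Elem × V.Elem) | ∃ t ∈ T, t.1 v = p.1 ∧ t.1 p.2.1 = p.2.2}) :
    IsDefinableRing T := by
  have hev : ∀ t t' : T, t.1.1 v = t'.1.1 v → t = t' := by
    intro t t' h
    by_contra hne
    refine hinj (t - t').1 (t - t').2 (fun h0 => hne (sub_eq_zero.mp (Subtype.ext h0))) ?_
    change t.1.1 v - t'.1.1 v = 0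
    rw [h, sub_self]
  let K : Set V.sort.Elem := {a | ∃ x : V.Elem, x ∈ {x : V.Elem | ∃ t ∈ T, t.1 v = x} ∧ x.1 = a}
  let φ : T → K := fun t => ⟨(t.1.1 v).1, t.1.1 v, ⟨t.1, t.2, rfl⟩, rfl⟩
  have hφ : Function.Bijective φ := by
    constructor
    · intro t t' h
      exact hev t t' (Subtype.ext (congrArg (fun k : K => k.1) h))
    · rintro ⟨_, _, ⟨t, ht, rfl⟩, rfl⟩
      exact ⟨⟨t, ht⟩, rfl⟩
  let e : K ≃ T := (Equiv.ofBijective φ hφ).symm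
  have he : ∀ x : K, (((e x).1.1 v).1 : V.sort.Elem) = x.1 := fun x =>
    congrArg Subtype.val ((Equiv.ofBijective φ hφ).apply_symm_apply x)
  have hK : DefSet L M {x : V.Elem | ∃ t ∈ T, t.1 v = x} := by
    have := DefSet.ex (φ := fun x y => ∃ t ∈ T, t.1 v = x ∧ t.1 v = y)
      (DefSet.preimage (f := fun q : V.Elem × V.Elem => (q.1, v, q.2)) (by fun_prop) hA)
    refine (congrArg (DefSet L M) (Set.ext fun x => ?_)).mp this
    constructor
    · rintro ⟨y, t, ht, hx, -⟩
      exact ⟨t, ht, hx⟩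
    · rintro ⟨t, ht, hx⟩
      exact ⟨_, t, ht, hx, rfl⟩
  have hsur : ∀ t ∈ T, ∃ x : K, (e x).1 = t ∧ x.1 = (t.1 v).1 := by
    intro t ht
    exact ⟨φ ⟨t, ht⟩, congrArg Subtype.val ((Equiv.ofBijective φ hφ).symm_apply_apply ⟨t, ht⟩), rfl⟩
  refine ⟨V.arity, V.sort, K, e, id, hK, ?_, ?_, ?_⟩
  · refine definable_of_eq (definableRel_iff
      (R := fun x y z => (∃ t ∈ T, t.1 v = x) ∧ (∃ t ∈ T, t.1 v = y) ∧ x + y = z) |>.mp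
      (.and ?_ (.and ?_ (.eq ?_ ?_)))) (Set.ext fun p => ?_)
    · exact DefSet.preimage (f := fun q : V.Elem × (V.Elem × V.Elem) => q.1) (by fun_prop) hK
    · exact DefSet.preimage (f := fun q : V.Elem × (V.Elem × V.Elem) => q.2.1) (by fun_prop) hK
    · fun_prop
    · fun_prop
    · constructor
      · rintro ⟨x, y, z, hx, hy, hz, h⟩
        refine ⟨_, _, _, (he x).trans hx, (he y).trans hy, (he z).trans hz,
          ⟨_, (e x).2, rfl⟩, ⟨_, (e y).2, rfl⟩, ?_⟩
        rw [← h]; rfl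
      · rintro ⟨_, _, _, hx, hy, hz, ⟨t, ht, rfl⟩, ⟨t', ht', rfl⟩, rfl⟩
        obtain ⟨x, h1, h2⟩ := hsur t ht
        obtain ⟨y, h3, h4⟩ := hsur t' ht'
        obtain ⟨z, h5, h6⟩ := hsur (t + t') (T.add_mem ht ht')
        refine ⟨x, y, z, h2.trans hx, h4.trans hy, h6.trans hz, Subtype.ext ?_⟩
        rw [h5, ← h1, ← h3]; rfl
  · refine definable_of_eq (definableRel_iff
      (R := fun x y z => (∃ t ∈ T, t.1 v = y) ∧ ∃ t ∈ T, t.1 v = x ∧ t.1 y = z) |>.mp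
      (.and ?_ hA)) (Set.ext fun p => ?_)
    · exact DefSet.preimage (f := fun q : V.Elem × (V.Elem × V.Elem) => q.2.1) (by fun_prop) hK
    · constructor
      · rintro ⟨x, y, z, hx, hy, hz, h⟩
        refine ⟨_, _, _, (he x).trans hx, (he y).trans hy, (he z).trans hz,
          ⟨_, (e y).2, rfl⟩, ⟨_, (e x).2, rfl, ?_⟩⟩
        rw [← h]; rfl
      · rintro ⟨_, _, _, hx, hy, hz, ⟨t', ht', rfl⟩, ⟨t, ht, rfl, rfl⟩⟩
        obtain ⟨x, h1, h2⟩ := hsur t ht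
        obtain ⟨y, h3, h4⟩ := hsur t' ht'
        obtain ⟨z, h5, h6⟩ := hsur (t * t') (T.mul_mem ht ht')
        refine ⟨x, y, z, h2.trans hx, h4.trans hy, h6.trans hz, Subtype.ext ?_⟩
        rw [h5, ← h1, ← h3]; rfl
  · refine definable_of_eq (definableRel_iff
      (R := fun x y z => ∃ t ∈ T, t.1 v = x ∧ t.1 y = z) |>.mp hA) (Set.ext fun p => ?_)
    constructor
    · rintro ⟨x, y, z, hx, hy, hz, h⟩
      exact ⟨_, y, z, (he x).trans hx, hy, hz, ⟨_, (e x).2, rfl, h⟩⟩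
    · rintro ⟨_, y, z, hx, hy, hz, ⟨t, ht, rfl, h⟩⟩
      obtain ⟨x, h1, h2⟩ := hsur t ht
      exact ⟨x, y, z, h2.trans hx, hy, hz, by rw [h1]; exact h⟩

/-- A bijective definable endomorphism that commutes with `S` is invertible in the centralizer. -/
theorem isUnit_of_bijective {S : Set V.DefEnd} (t : Subring.centralizer S)
    (ht : Function.Bijective t.1.1) : IsUnit t := by
  let g := AddEquiv.ofBijective t.1.1 ht
  have h1 : ∀ x, t.1.1 (g.symm x) = x := g.apply_symm_apply
  have h2 : ∀ x, g.symm (t.1.1 x) = x := g.symm_apply_apply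
  let i : AddMonoid.End V.Elem := g.symm.toAddMonoidHom
  have hi : i ∈ V.DefEnd := by
    refine defFun_iff.mp (DefFun.of_graph (G := fun x y => t.1.1 y = x)
      (.eq (.comp (f := fun p : V.Elem × V.Elem => p.2) (defFun_iff.mpr t.1.2) (by fun_prop))
        (by fun_prop)) fun x y => ?_)
    constructor
    · rintro rfl
      exact h1 x
    · rintro rfl
      exact h2 y
  have hmul : t.1 * ⟨i, hi⟩ = 1 := Subtype.ext (DFunLike.ext _ _ h1)
  have hmul' : ⟨i, hi⟩ * t.1 = 1 := Subtype.ext (DFunLike.ext _ _ h2)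
  have hc : (⟨i, hi⟩ : V.DefEnd) ∈ Subring.centralizer S := by
    rw [Subring.mem_centralizer_iff]
    intro s hs
    have hst := Subring.mem_centralizer_iff.mp t.2 s hs
    calc s * ⟨i, hi⟩ = ⟨i, hi⟩ * t.1 * s * ⟨i, hi⟩ := by rw [hmul', one_mul]
      _ = ⟨i, hi⟩ * (s * t.1) * ⟨i, hi⟩ := by
        rw [hst, mul_assoc (⟨i, hi⟩ : V.DefEnd) t.1 s]
      _ = ⟨i, hi⟩ * s := by
        rw [mul_assoc, mul_assoc s, hmul, mul_one]
  exact ⟨⟨t, ⟨_, hc⟩, Subtype.ext hmul, Subtype.ext hmul'⟩, rfl⟩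

end DefAbGroup

end FinDim
-- The Schur–Zilber lemma
theorem corollaryc {L : FirstOrder.Language.{u, v}} (T : L.Theory)
    (hT : FinDim.IsFiniteDimensional.{u, v, w} T)
    (M : FirstOrder.Language.Theory.ModelType.{u, v, w} T)
    (κ : Cardinal.{w}) (hκ : κ.IsRegular) (hκ₀ : Cardinal.continuum < κ)
    (hL : Cardinal.lift.{w} L.card < Cardinal.lift.{max u v} κ)
    (hM : FinDim.IsSaturated L M κ)
    (V : FinDim.DefAbGroup L M) (hV : V.IsConnected ⊤)
    (S : Subring V.DefEnd)
    (hS : FinDim.DefAbGroup.IsInvariant κ (S : Set V.DefEnd))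
    (hS_unbounded : κ ≤ Cardinal.mk S)
    (hVS : FinDim.DefAbGroup.IsIrreducible S) :
    FinDim.DefAbGroup.IsDefinableSkewField (Subring.centralizer (S : Set V.DefEnd)) := by
  have hκ' := hκ.aleph0_le
  obtain ⟨D⟩ := hT
  obtain ⟨F, hFS, hF, hFc⟩ := hS.exists_continuum_lt hκ' hκ₀ hS_unbounded
  -- The argument runs in the ring of all endomorphisms, where the centraliser becomes the definable
  -- endomorphisms that commute with `S`.
  have hC : ∀ t, t ∈ (Subring.centralizer (S : Set V.DefEnd)).map V.DefEnd.subtype ↔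
      FinDim.DefFun L M t ∧ ∀ s ∈ S.map V.DefEnd.subtype, s * t = t * s := by
    intro t
    constructor
    · rintro ⟨t, ht, rfl⟩
      refine ⟨FinDim.DefAbGroup.defFun_iff.mpr t.2, ?_⟩
      rintro _ ⟨s, hs, rfl⟩
      exact congrArg Subtype.val (Subring.mem_centralizer_iff.mp ht s hs)
    · rintro ⟨ht, hts⟩
      exact ⟨⟨t, FinDim.DefAbGroup.defFun_iff.mp ht⟩, Subring.mem_centralizer_iff.mpr fun s hs =>
        Subtype.ext (hts s.1 ⟨s, hs, rfl⟩), rfl⟩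
  obtain ⟨hbij, v, hv, hA⟩ := FinDim.centralizer_bijective_and_definable D hM hκ'
    (S := S.map V.DefEnd.subtype)
    (C := (Subring.centralizer (S : Set V.DefEnd)).map V.DefEnd.subtype)
    (by rintro _ ⟨s, -, rfl⟩; exact FinDim.DefAbGroup.defFun_iff.mpr s.2)
    (FinDim.DefAbGroup.isConn_iff.mpr hV)
    (fun W hW hWc hWS => hVS W (FinDim.DefAbGroup.defSet_subgroup_iff.mp hW)
      (FinDim.DefAbGroup.isConn_iff.mp hWc) fun s hs => hWS s.1 ⟨s, hs, rfl⟩)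
    hC (F := FinDim.DefAbGroup.toEnd F)
    (by rintro _ ⟨f, hf, rfl⟩; exact ⟨f, hFS hf, rfl⟩)
    (hF.unifTDef hκ') (by rwa [Cardinal.mk_image_eq Subtype.val_injective])
  have hbij' : ∀ t ∈ Subring.centralizer (S : Set V.DefEnd), t ≠ 0 → Function.Bijective t.1 :=
    fun t ht h0 => hbij t.1 ⟨t, ht, rfl⟩ fun h => h0 (Subtype.ext h)
  refine ⟨⟨⟨0, 1, fun h => hv ?_⟩, fun t ht => FinDim.DefAbGroup.isUnit_of_bijective t
    (hbij' t.1 t.2 fun h => ht (Subtype.ext h))⟩,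
    FinDim.DefAbGroup.isDefinableRing (v := v) (fun t ht h0 h => hv ?_) ?_⟩
  · exact (DFunLike.congr_fun (congrArg (fun t => t.1.1) h) v).symm
  · exact (hbij' t ht h0).1 (h.trans (map_zero _).symm)
  · refine (congrArg (FinDim.DefSet L M) (Set.ext fun p => ?_)).mp hA
    constructor
    · rintro ⟨_, ⟨t, ht, rfl⟩, h⟩
      exact ⟨t, ht, h⟩
    · rintro ⟨t, ht, h⟩
      exact ⟨t.1, ⟨t, ht, rfl⟩, h⟩
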